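/- **Conventions.** A connectivity system $(E,\lambda)$ is a finite set $E$ with a function $\lambda:2^E\to\mathbb Z$ such that $\lambda(X)=\lambda(E-X)$ and $\lambda(X)+\lambda(Y)\ge\lambda(X\cup Y)+\lambda(X\cap Y)$ for all $X,Y\subseteq E$. Let $k$ be a positive integer. A set $X\subseteq E$ is $k$-separating if $\lambda(X)\le k$; then the unordered partition $(X,E-X)$ (whose parts may be empty) is a $k$-separation. A robust tangle of order $k$ is a collection $\mathcal T$ of subsets of $E$ such that: $\lambda(A)<k$ for all $A\in\mathcal T$; if $\lambda(A)\le k-1$, then $A\in\mathcal T$ or $E-A\in\mathcal T$; $A_1\cup\dots\cup A_8\ne E$ for all $A_1,\dots,A_8\in\mathcal T$; and $E-\{e\}\notin\mathcal T$ for each $e\in E$. Fix such a $\mathcal T$. **Separations.** A subset of $E$ is weak if it is contained in a member of $\mathcal T$, and strong otherwise; a partition of $E$ is strong if all its parts are. A strong $k$-separating set $X$ is fully closed if $\lambda(X\cup Y)>k$ for every non-empty weak $Y\subseteq E-X$. For a strong $k$-separating set $X$, $\mathrm{fcl}(X)$ is the intersection of all fully closed sets containing $X$. Strong $k$-separations $(X,Y)$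 and $(X',Y')$ are equivalent if $\{\mathrm{fcl}(X),\mathrm{fcl}(Y)\}=\{\mathrm{fcl}(X'),\mathrm{fcl}(Y')\}$. A $k$-separating set $X$ is sequential if $E-X$ is strong and $\mathrm{fcl}(E-X)=E$; a $k$-separation $(X,Y)$ is non-sequential (with respect to $\mathcal T$) if neither $X$ nor $Y$ is sequential. (A non-sequential $k$-separation is strong.) **Flowers.** For $n\ge1$, a $k$-flower is a strong partition $\Phi=(P_1,\dots,P_n)$ of $E$ such that $P_i$ and $P_i\cup P_{i+1}$ are $k$-separating for all $i$ (indices modulo $n$). A $k$-separation $(X,E-X)$ is displayed by $\Phi$ if $X$ is a union of petals $P_i$. A $k$-flower is a $k$-anemone if every non-empty union of petals is $k$-separating, and a $k$-daisy if, for non-empty $I\subseteq\{1,\dots,n\}$, the set $\bigcup_{i\in I}P_i$ is $k$-separating precisely when $I$ is consecutive in the cyclic order. Two $k$-flowers are equivalent if every non-sequential $k$-separation displayed by either of them is equivalent to a non-sequential $k$-separation displayed by the other. The order of $\Phi$ is the least number of petals of a $k$-flower equivalent to $\Phi$. A petal $P_i$ is loose if $P_i\subseteq\mathrm{fcl}(P_j)$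 for some $j\ne i$ such that $\Phi$ is an anemone or $i,j$ are cyclically consecutive. **Trees.** Consider a finite tree $T$ some of whose vertices, the bag vertices, are labelled by pairwise disjoint, possibly empty sets (bags) with union $E$, and each of whose other vertices is labelled $D$ or $A$; the edges at each vertex labelled $D$ carry a cyclic ordering. An edge $e$ displays the partition of $E$ into the unions of the bags in the two components of $T\setminus e$. A non-bag vertex $v$ displays the partition of $E$ into the unions of the bags in the components of $T-v$, ordered cyclically in accordance with the edges at $v$ if $v$ is labelled $D$. If this partition is a $k$-flower, then $v$ is a $k$-flower vertex. A $k$-separation is displayed by $T$ if it is displayed by an edge of $T$ or by the $k$-flower of a $k$-flower vertex of $T$. A strong $k$-separation conforms with $T$ if it is equivalent to a $k$-separation displayed by $T$, or to a $k$-separation $(X',Y')$ such that $X'$ or $Y'$ is contained in a bag. Such a $T$ is a partial $k$-tree for $\mathcal T$ if: 1. each edge displays a strong $k$-separation, which is non-sequential if both ends of the edge are bag vertices; 2. each vertex labelled $A$ displays a $k$-anemone of order at least three with no loose petals; 3. each vertex labelled $D$ displays a $k$-daisy of order at least three with no loose petals; 4. every non-sequential $k$-separation conforms with $T$. For partial $k$-trees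 write $T\preccurlyeq T'$ if every non-sequential $k$-separation displayed by $T$ is equivalent to a non-sequential $k$-separation displayed by $T'$. A partial $k$-tree $T$ is maximal if $T\preccurlyeq T'$ implies $T'\preccurlyeq T$ for every partial $k$-tree $T'$. **Corollary 6.2.** Let $\mathcal T$ be a robust tangle of order $k$ in a connectivity system $(E,\lambda)$. If $T$ is a maximal partial $k$-tree for $\mathcal T$, then every $k$-separation of $\lambda$ that is non-sequential with respect to $\mathcal T$ is equivalent to a $k$-separation displayed by $T$. -/

import Mathlib

namespace TangleTree

universe u

/-- A connectivity system `(E, conn)`: a finite set `E` and an integer-valued function on its subsets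
that is symmetric and submodular. -/
structure ConnectivitySystem (E : Type u) [Finite E] where
  conn : Set E → ℤ
  symmetric : ∀ X : Set E, conn X = conn Xᶜ
  submodular : ∀ X Y : Set E, conn (X ∪ Y) + conn (X ∩ Y) ≤ conn X + conn Y

section Separations

variable {E : Type u} [Finite E] (C : ConnectivitySystem E) (k : ℤ) (𝒯 : Set (Set E))

/-- A set `X` with `conn X ≤ k`. A `k`-separation `(X, E - X)` is an unordered partition; throughout
it is represented by either one of its two sides. -/
def IsSeparating (X : Set E) : Prop := C.conn X ≤ k

/-- `𝒯` is a robust tangle of order `k`: the usual tangle axioms, except that even eight members do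
not cover `E`. -/
structure IsRobustTangle : Prop where
  lt_of_mem : ∀ A ∈ 𝒯, C.conn A < k
  mem_or_compl_mem : ∀ A : Set E, IsSeparating C (k - 1) A → A ∈ 𝒯 ∨ Aᶜ ∈ 𝒯
  not_cover : ∀ A : Fin 8 → Set E, (∀ i, A i ∈ 𝒯) → (⋃ i, A i) ≠ Set.univ
  compl_singleton_notMem : ∀ e : E, ({e} : Set E)ᶜ ∉ 𝒯

/-- `X` is contained in a member of the tangle. -/
def IsWeak (X : Set E) : Prop := ∃ A ∈ 𝒯, X ⊆ A

/-- `X` is not contained in any member of the tangle. -/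
def IsStrong (X : Set E) : Prop := ¬ IsWeak 𝒯 X

/-- The `k`-separation `(X, E - X)` has two strong sides. -/
def IsStrongSeparation (X : Set E) : Prop :=
  IsSeparating C k X ∧ IsStrong 𝒯 X ∧ IsStrong 𝒯 Xᶜ

/-- A strong `k`-separating set to which no non-empty weak set disjoint from it can be added so
that the union is still `k`-separating. -/
def IsFullyClosed (X : Set E) : Prop :=
  IsSeparating C k X ∧ IsStrong 𝒯 X ∧
    ∀ Y : Set E, Y.Nonempty → IsWeak 𝒯 Y → Y ⊆ Xᶜ → ¬ IsSeparating C k (X ∪ Y)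

/-- The full closure of `X`: the intersection of all fully closed sets that contain `X`.
It is only meaningful when `X` is a strong `k`-separating set. -/
def fcl (X : Set E) : Set E := ⋂₀ {F | IsFullyClosed C k 𝒯 F ∧ X ⊆ F}

/-- Equivalence of the strong `k`-separations `(X, E - X)` and `(Y, E - Y)`. -/
def SepEquiv (X Y : Set E) : Prop :=
  IsStrongSeparation C k 𝒯 X ∧ IsStrongSeparation C k 𝒯 Y ∧
    ({fcl C k 𝒯 X, fcl C k 𝒯 Xᶜ} : Set (Set E)) = {fcl C k 𝒯 Y, fcl C k 𝒯 Yᶜ}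

/-- `X` is a sequential `k`-separating set. -/
def IsSequentialSet (X : Set E) : Prop :=
  IsSeparating C k X ∧ IsStrong 𝒯 Xᶜ ∧ fcl C k 𝒯 Xᶜ = Set.univ

/-- `(X, E - X)` is a `k`-separation that is non-sequential with respect to `𝒯`: neither of its
sides is a sequential set. -/
def IsNonSequentialSeparation (X : Set E) : Prop :=
  IsSeparating C k X ∧ ¬ IsSequentialSet C k 𝒯 X ∧ ¬ IsSequentialSet C k 𝒯 Xᶜ

/-- The set of all non-sequential `k`-separating sets with strong complements. -/
def nonSequentialSets : Set (Set E) :=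
  {X | IsSeparating C k X ∧ ¬ IsSequentialSet C k 𝒯 X ∧ IsStrong 𝒯 Xᶜ}

/-- `(X, E - X)` is a `(k, 𝒮)`-separation. -/
def IsSSeparation (𝒮 : Set (Set E)) (X : Set E) : Prop :=
  IsSeparating C k X ∧ X ∈ 𝒮 ∧ Xᶜ ∈ 𝒮

end Separations

section Flowers

variable {E : Type u} [Finite E] (C : ConnectivitySystem E) (k : ℤ) (𝒯 : Set (Set E))
  (𝒮 : Set (Set E))

/-- `(P 0, …, P (n - 1))` is a `k`-flower in `𝒯`: a partition of `E` into strong petals, such that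
every petal and every union of two cyclically consecutive petals is `k`-separating
(`finRotate n i` is `i + 1` modulo `n`). -/
structure IsFlower {n : ℕ} (P : Fin n → Set E) : Prop where
  pos : 0 < n
  disjoint : Pairwise fun i j => Disjoint (P i) (P j)
  cover : (⋃ i, P i) = Set.univ
  strong : ∀ i, IsStrong 𝒯 (P i)
  petal : ∀ i, IsSeparating C k (P i)
  consecutive : ∀ i, IsSeparating C k (P i ∪ P (finRotate n i))

/-- The `k`-separation `(X, E - X)` is displayed by the flower: `X` is a union of petals. -/
def FlowerDisplays {n : ℕ} (P : Fin n → Set E) (X : Set E) : Prop :=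
  IsSeparating C k X ∧ ∃ I : Set (Fin n), X = ⋃ i ∈ I, P i

/-- The members of `I` are consecutive in the cyclic order on `Fin n`. -/
def IsCyclicInterval {n : ℕ} (I : Set (Fin n)) : Prop :=
  ∃ (a : Fin n) (m : ℕ), I = {j | ∃ t < m, j = (finRotate n)^[t] a}

/-- A `k`-flower all of whose non-empty unions of petals are `k`-separating. -/
def IsAnemone {n : ℕ} (P : Fin n → Set E) : Prop :=
  IsFlower C k 𝒯 P ∧ ∀ I : Set (Fin n), I.Nonempty → IsSeparating C k (⋃ i ∈ I, P i)

/-- A `k`-flower in which precisely the non-empty unions of consecutive petals are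
`k`-separating. -/
def IsDaisy {n : ℕ} (P : Fin n → Set E) : Prop :=
  IsFlower C k 𝒯 P ∧
    ∀ I : Set (Fin n), I.Nonempty → (IsSeparating C k (⋃ i ∈ I, P i) ↔ IsCyclicInterval I)

/-- The quasi-order on `k`-flowers: every `(k, 𝒮)`-separation displayed by `P` is equivalent to one
displayed by `Q`. -/
def FlowerLE {n m : ℕ} (P : Fin n → Set E) (Q : Fin m → Set E) : Prop :=
  ∀ X, FlowerDisplays C k P X → IsSSeparation C k 𝒮 X →
    ∃ Y, FlowerDisplays C k Q Y ∧ IsSSeparation C k 𝒮 Y ∧ SepEquiv C k 𝒯 X Y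

/-- The `𝒮`-order of a `k`-flower: the least number of petals of an equivalent `k`-flower. -/
noncomputable def flowerOrder {n : ℕ} (P : Fin n → Set E) : ℕ :=
  sInf {m | ∃ Q : Fin m → Set E,
    IsFlower C k 𝒯 Q ∧ FlowerLE C k 𝒯 𝒮 P Q ∧ FlowerLE C k 𝒯 𝒮 Q P}

/-- The petal `P i` is loose: it lies in the full closure of another petal that is, up to labels,
consecutive to it. The petals of an anemone may be permuted arbitrarily, so in an anemone any two
petals are consecutive up to labels; otherwise the permitted relabellings are the symmetries of a
regular `n`-gon. -/
def IsLoose {n : ℕ} (P : Fin n → Set E) (i : Fin n) : Prop :=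
  ∃ j, j ≠ i ∧ (IsAnemone C k 𝒯 P ∨ j = finRotate n i ∨ i = finRotate n j) ∧
    P i ⊆ fcl C k 𝒯 (P j)

end Flowers

/-- The three kinds of vertices: bag vertices, and non-bag vertices labelled `D` or `A`. -/
inductive VertexKind where
  | bag
  | daisy
  | anemone

/-- A `π`-labelled tree, all of whose non-bag vertices are labelled `D` (`daisy`) or `A` (`anemone`).
The partition `π` of `E` (with possibly empty members), indexed by the bag vertices, is given by
the map `label` that sends an element to the bag vertex whose bag contains it. -/
structure LabelledTree (E : Type u) where
  V : Type
  finite : Finite V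
  graph : SimpleGraph V
  isTree : graph.IsTree
  kind : V → VertexKind
  label : E → V
  kind_label : ∀ e, kind (label e) = VertexKind.bag
  /-- A cyclic ordering of the edges `vw` incident with `v`, listed by their other ends `w`.
  Only the orderings at vertices of kind `daisy` matter; at all other vertices this is an
  arbitrary enumeration. -/
  order : ∀ v, Fin (Nat.card (graph.neighborSet v)) ≃ graph.neighborSet v

namespace LabelledTree

/-- The bag at `v`. -/
def bag {E : Type u} (T : LabelledTree E) (v : T.V) : Set E := {e | T.label e = v}

/-- The union of the bags in the component of `T \ vw` (the edge deleted) that contains `w`. The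
partition of `E` displayed by the edge `vw` is `(T.edgeSide v w, T.edgeSide w v)`. -/
def edgeSide {E : Type u} (T : LabelledTree E) (v w : T.V) : Set E :=
  {e | (T.graph.deleteEdges {s(v, w)}).Reachable w (T.label e)}

/-- The union of the bags in the component of `T - v` (the vertex deleted) that contains the
vertex `w ≠ v`. Instead of removing `v` from the vertex set we delete all edges at `v`. -/
def branch {E : Type u} (T : LabelledTree E) (v w : T.V) : Set E :=
  {e | (T.graph.deleteIncidenceSet v).Reachable w (T.label e)}

/-- The partition of `E` displayed by the non-bag vertex `v`, in the order of the edges at `v`. -/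
def petals {E : Type u} (T : LabelledTree E) (v : T.V) :
    Fin (Nat.card (T.graph.neighborSet v)) → Set E :=
  fun i => T.branch v (T.order v i)

end LabelledTree

section Trees

variable {E : Type u} [Finite E] (C : ConnectivitySystem E) (k : ℤ) (𝒯 : Set (Set E))
  (𝒮 : Set (Set E))

/-- The `k`-separation `(X, E - X)` is displayed by `T`: it is displayed by an edge or by a
`k`-flower vertex of `T`. -/
def TreeDisplays (T : LabelledTree E) (X : Set E) : Prop :=
  IsSeparating C k X ∧
    ((∃ v w, T.graph.Adj v w ∧ X = T.edgeSide v w) ∨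
      ∃ v, T.kind v ≠ VertexKind.bag ∧ IsFlower C k 𝒯 (T.petals v) ∧
        FlowerDisplays C k (T.petals v) X)

/-- The strong `k`-separation `(X, E - X)` conforms with `T`: it is equivalent to one displayed by
`T`, or to one with a side that is contained in a bag of `T`. -/
def Conforms (T : LabelledTree E) (X : Set E) : Prop :=
  (∃ Y, TreeDisplays C k 𝒯 T Y ∧ SepEquiv C k 𝒯 X Y) ∨
    ∃ Y, SepEquiv C k 𝒯 X Y ∧
      ∃ v, T.kind v = VertexKind.bag ∧ (Y ⊆ T.bag v ∨ Yᶜ ⊆ T.bag v)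

/-- `T` is a partial `(k, 𝒮)`-tree for `𝒯`. -/
structure IsPartialTree (T : LabelledTree E) : Prop where
  strong_edge : ∀ v w, T.graph.Adj v w → IsStrongSeparation C k 𝒯 (T.edgeSide v w)
  bag_edge : ∀ v w, T.graph.Adj v w → T.kind v = VertexKind.bag → T.kind w = VertexKind.bag →
    IsSSeparation C k 𝒮 (T.edgeSide v w)
  anemone_vertex : ∀ v, T.kind v = VertexKind.anemone →
    IsAnemone C k 𝒯 (T.petals v) ∧ 3 ≤ flowerOrder C k 𝒯 𝒮 (T.petals v) ∧
      ∀ i, ¬ IsLoose C k 𝒯 (T.petals v) i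
  daisy_vertex : ∀ v, T.kind v = VertexKind.daisy →
    IsDaisy C k 𝒯 (T.petals v) ∧ 3 ≤ flowerOrder C k 𝒯 𝒮 (T.petals v) ∧
      ∀ i, ¬ IsLoose C k 𝒯 (T.petals v) i
  conforms : ∀ X, IsSSeparation C k 𝒮 X → Conforms C k 𝒯 T X

/-- The quasi-order on partial `(k, 𝒮)`-trees: every `(k, 𝒮)`-separation displayed by `T` is
equivalent to one displayed by `T'`. -/
def TreeLE (T T' : LabelledTree E) : Prop :=
  ∀ X, TreeDisplays C k 𝒯 T X → IsSSeparation C k 𝒮 X →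
    ∃ Y, TreeDisplays C k 𝒯 T' Y ∧ IsSSeparation C k 𝒮 Y ∧ SepEquiv C k 𝒯 X Y

/-- `T` is an `𝒮`-maximal partial `(k, 𝒮)`-tree for `𝒯`. -/
def IsMaximalPartialSTree (T : LabelledTree E) : Prop :=
  IsPartialTree C k 𝒯 𝒮 T ∧
    ∀ T' : LabelledTree E, IsPartialTree C k 𝒯 𝒮 T' → TreeLE C k 𝒯 𝒮 T T' → TreeLE C k 𝒯 𝒮 T' T

/-- `T` is a maximal partial `k`-tree for `𝒯`: the case in which the `(k, 𝒮)`-separations are all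
the non-sequential `k`-separations. -/
def IsMaximalPartialTree (T : LabelledTree E) : Prop :=
  IsMaximalPartialSTree C k 𝒯 (nonSequentialSets C k 𝒯) T

end Trees

end TangleTree

/-! A partial tree that fails to display some non-sequential separation can be enlarged, so a
maximal one displays them all up to equivalence. By conformity, a missed separation is equivalent to
one with a side inside some bag, say the bag at `v`. Among the undisplayed non-sequential sets
contained in this bag, choose `X` with `fcl X` maximal. If every other one is, up to equivalence and
complement, contained in `X` or in its complement, attach a leaf with bag `X` at `v`. If some `U`
crosses `X`, build a flower that displays both up to equivalence and keeps the outside of the bag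
within one petal. Then attach a flower vertex at `v`, with one new leaf for each other petal, while
`v` itself stands for the distinguished petal. The delicate point is that the new tree still
satisfies conformity: a separation can fail to fit into the new bags only if `X ⊆ fcl Y` for its
side `Y` in the old bag, and then the choice of `X` makes it equivalent to `X`. This is
`IsPartialTree.exists_extension`.

All the geometry comes from uncrossing: a set that is strong together with its complement has
connectivity at least `k`, so submodularity makes the union (or intersection) of two `k`-separating
sets `k`-separating whenever the other of the two is strong on both sides.

The flower is obtained from the two petals `X` and `Xᶜ` by refinement. Among the flowers that
display at least as much, one is taken whose displayed closures are maximal, and then one with the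
fewest petals; it is tight, because a petal in the closure of a compatible one could be merged into
it. To see that every admissible `U` is displayed or lies in a petal (`RankFlower.conforms`),
replace `U` by an equivalent set that splits as few petals as possible. If all pieces of the split
petals are strong, uncrossing cuts the petals one after another along `U`
(`RankFlower.exists_refinement`), contrary to maximality. The obstruction is a petal cut into two
weak pieces. Then all petals but one consist of two weak pieces (`Reduced.exists_center`; this is
where a cover by eight sets has to be excluded), and tightness together with two inequivalent
displayed separations rules this out (`Reduced.not_isSmall`). -/

namespace TangleTree

universe u

set_option linter.unusedSectionVars false

/-! ### Weak and strong sets, and uncrossing in a robust tangle. -/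

section SmallSets

variable {E : Type u} [Finite E] {C : ConnectivitySystem E} {k : ℤ} {𝒯 : Set (Set E)}

/-- `X` is empty or weak. The two notions differ only if the tangle has no members. -/
def IsSmall (𝒯 : Set (Set E)) (X : Set E) : Prop := X = ∅ ∨ IsWeak 𝒯 X

/-- `X` is nonempty and strong. -/
def IsBig (𝒯 : Set (Set E)) (X : Set E) : Prop := ¬ IsSmall 𝒯 X

theorem IsWeak.mono {X Y : Set E} (h : IsWeak 𝒯 Y) (hXY : X ⊆ Y) : IsWeak 𝒯 X := by
  obtain ⟨A, hA, hY⟩ := h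
  exact ⟨A, hA, hXY.trans hY⟩

theorem IsStrong.mono {X Y : Set E} (h : IsStrong 𝒯 X) (hXY : X ⊆ Y) : IsStrong 𝒯 Y :=
  fun hY => h (hY.mono hXY)

theorem IsSmall.mono {X Y : Set E} (h : IsSmall 𝒯 Y) (hXY : X ⊆ Y) : IsSmall 𝒯 X := by
  rcases h with h | h
  · exact Or.inl (Set.subset_eq_empty hXY h)
  · exact Or.inr (h.mono hXY)

theorem isSmall_empty : IsSmall 𝒯 (∅ : Set E) := Or.inl rfl

theorem IsBig.mono {X Y : Set E} (h : IsBig 𝒯 X) (hXY : X ⊆ Y) : IsBig 𝒯 Y :=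
  fun hY => h (hY.mono hXY)

theorem IsBig.nonempty {X : Set E} (h : IsBig 𝒯 X) : X.Nonempty := by
  rw [Set.nonempty_iff_ne_empty]
  exact fun h0 => h (Or.inl h0)

theorem IsBig.isStrong {X : Set E} (h : IsBig 𝒯 X) : IsStrong 𝒯 X := fun h0 => h (Or.inr h0)

theorem IsSeparating.compl {X : Set E} (h : IsSeparating C k X) : IsSeparating C k Xᶜ := by
  unfold IsSeparating at *
  rwa [← C.symmetric]

theorem isSeparating_compl_iff {X : Set E} : IsSeparating C k Xᶜ ↔ IsSeparating C k X :=
  ⟨fun h => by simpa using h.compl, fun h => h.compl⟩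

theorem IsSeparating.empty {X : Set E} (h : IsSeparating C k X) : IsSeparating C k (∅ : Set E) := by
  unfold IsSeparating at *
  have h1 := C.submodular X Xᶜ
  have h2 := C.symmetric X
  have h3 := C.symmetric ∅
  rw [Set.union_compl_self, Set.inter_compl_self] at h1
  rw [Set.compl_empty] at h3
  omega

theorem IsSeparating.univ {X : Set E} (h : IsSeparating C k X) :
    IsSeparating C k (Set.univ : Set E) := by
  simpa using h.empty.compl

theorem IsRobustTangle.le_conn (h : IsRobustTangle C k 𝒯) {X : Set E} (h1 : IsStrong 𝒯 X)
    (h2 : IsStrong 𝒯 Xᶜ) : k ≤ C.conn X := by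
  by_contra hlt
  rcases h.mem_or_compl_mem X (by unfold IsSeparating; omega) with h0 | h0
  · exact h1 ⟨X, h0, le_rfl⟩
  · exact h2 ⟨Xᶜ, h0, le_rfl⟩

/-- Submodularity: the intersection already accounts for at least `k` of the total `2k`. This and
its dual below are the basic uncrossing steps. -/
theorem IsRobustTangle.separating_union (h : IsRobustTangle C k 𝒯) {X Y : Set E}
    (hX : IsSeparating C k X) (hY : IsSeparating C k Y) (h1 : IsStrong 𝒯 (X ∩ Y))
    (h2 : IsStrong 𝒯 (X ∩ Y)ᶜ) : IsSeparating C k (X ∪ Y) := by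
  have h3 := h.le_conn h1 h2
  have h4 := C.submodular X Y
  unfold IsSeparating at *
  omega

theorem IsRobustTangle.separating_inter (h : IsRobustTangle C k 𝒯) {X Y : Set E}
    (hX : IsSeparating C k X) (hY : IsSeparating C k Y) (h1 : IsStrong 𝒯 (X ∪ Y))
    (h2 : IsStrong 𝒯 (X ∪ Y)ᶜ) : IsSeparating C k (X ∩ Y) := by
  have h3 := h.le_conn h1 h2
  have h4 := C.submodular X Y
  unfold IsSeparating at *
  omega

/-- Empty sets can be enlarged to a member of the tangle if there is one; otherwise all small sets
are empty and cannot cover the nonempty ground set. -/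
theorem IsRobustTangle.exists_mem_of_isSmall (h : IsRobustTangle C k 𝒯) [Nonempty E]
    (A : Fin 8 → Set E) (hA : ∀ i, IsSmall 𝒯 (A i)) : (⋃ i, A i) ≠ Set.univ := by
  intro hU
  by_cases h𝒯 : 𝒯.Nonempty
  · obtain ⟨T, hT⟩ := h𝒯
    have h1 : ∀ i, ∃ B ∈ 𝒯, A i ⊆ B := by
      intro i
      rcases hA i with h0 | h0
      · exact ⟨T, hT, by rw [h0]; exact Set.empty_subset _⟩
      · exact h0
    choose B hB hAB using h1
    apply h.not_cover B hB
    apply Set.eq_univ_of_univ_subset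
    rw [← hU]
    exact Set.iUnion_mono hAB
  · have h1 : ∀ i, A i = ∅ := by
      intro i
      rcases hA i with h0 | ⟨B, hB, -⟩
      · exact h0
      · exact absurd ⟨B, hB⟩ h𝒯
    rw [Set.iUnion_congr h1] at hU
    have := Set.univ_nonempty (α := E)
    rw [← hU] at this
    simp at this

theorem IsRobustTangle.exists_notMem (h : IsRobustTangle C k 𝒯) [Nonempty E]
    {A₁ A₂ A₃ A₄ A₅ A₆ A₇ A₈ : Set E} (h₁ : IsSmall 𝒯 A₁) (h₂ : IsSmall 𝒯 A₂) (h₃ : IsSmall 𝒯 A₃)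
    (h₄ : IsSmall 𝒯 A₄) (h₅ : IsSmall 𝒯 A₅) (h₆ : IsSmall 𝒯 A₆) (h₇ : IsSmall 𝒯 A₇)
    (h₈ : IsSmall 𝒯 A₈) :
    ∃ x, x ∉ A₁ ∧ x ∉ A₂ ∧ x ∉ A₃ ∧ x ∉ A₄ ∧ x ∉ A₅ ∧ x ∉ A₆ ∧ x ∉ A₇ ∧ x ∉ A₈ := by
  have h0 := h.exists_mem_of_isSmall ![A₁, A₂, A₃, A₄, A₅, A₆, A₇, A₈]
    (by intro i; fin_cases i <;> assumption)
  rw [Set.ne_univ_iff_exists_notMem] at h0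
  obtain ⟨x, hx⟩ := h0
  refine ⟨x, ?_⟩
  simpa [Fin.forall_fin_succ] using hx

theorem IsRobustTangle.isBig_univ (h : IsRobustTangle C k 𝒯) [Nonempty E] :
    IsBig 𝒯 (Set.univ : Set E) := by
  intro h0
  have e := isSmall_empty (𝒯 := 𝒯)
  obtain ⟨x, hx, -⟩ := h.exists_notMem h0 e e e e e e e
  exact hx trivial

theorem IsRobustTangle.isBig_compl (h : IsRobustTangle C k 𝒯) [Nonempty E] {X : Set E}
    (hX : IsSmall 𝒯 X) : IsBig 𝒯 Xᶜ := by
  intro h0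
  have e := isSmall_empty (𝒯 := 𝒯)
  obtain ⟨x, h1, h2, -⟩ := h.exists_notMem h0 hX e e e e e e
  exact h1 h2

end SmallSets

/-! ### Full closure, non-sequential separations and equivalence. -/

section FullClosure

variable {E : Type u} [Finite E] {C : ConnectivitySystem E} {k : ℤ} {𝒯 : Set (Set E)}

theorem subset_fcl (X : Set E) : X ⊆ fcl C k 𝒯 X := Set.subset_sInter fun _ h => h.2

theorem fcl_mono {X Y : Set E} (h : X ⊆ Y) : fcl C k 𝒯 X ⊆ fcl C k 𝒯 Y :=
  Set.sInter_subset_sInter fun _ hF => ⟨hF.1, h.trans hF.2⟩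

theorem fcl_subset {X F : Set E} (h : IsFullyClosed C k 𝒯 F) (hX : X ⊆ F) : fcl C k 𝒯 X ⊆ F :=
  Set.sInter_subset_of_mem ⟨h, hX⟩

theorem fcl_subset_fcl {X Y : Set E} (h : X ⊆ fcl C k 𝒯 Y) : fcl C k 𝒯 X ⊆ fcl C k 𝒯 Y :=
  Set.subset_sInter fun _ hF => fcl_subset hF.1 (h.trans (fcl_subset hF.1 hF.2))

theorem fcl_eq_of_subset {X Y : Set E} (h : X ⊆ Y) (h' : Y ⊆ fcl C k 𝒯 X) :
    fcl C k 𝒯 Y = fcl C k 𝒯 X :=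
  (fcl_subset_fcl h').antisymm (fcl_mono h)

/-- A fully closed `F ⊇ X` not containing `Y` could be enlarged: uncrossing `F` with `X ∪ Y` shows
that `F ∪ Y` is separating, unless `Fᶜ` is itself weak and can be added to `F`. This is the only way
in which elements are shown to lie in a closure. -/
theorem subset_fcl_of_separating (h : IsRobustTangle C k 𝒯) [Nonempty E] {X Y : Set E}
    (hX : IsStrong 𝒯 X) (hXY : IsSeparating C k (X ∪ Y)) (hY : IsSmall 𝒯 Y) :
    Y ⊆ fcl C k 𝒯 X := by
  refine Set.subset_sInter ?_
  rintro F ⟨hF, hXF⟩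
  by_contra hYF
  obtain ⟨y, hy, hyF⟩ := Set.not_subset.1 hYF
  have hYw : IsWeak 𝒯 Y := by
    rcases hY with h0 | h0
    · rw [h0] at hy
      exact absurd hy (Set.notMem_empty y)
    · exact h0
  have h1 : ¬ IsSeparating C k (F ∪ Y \ F) :=
    hF.2.2 (Y \ F) ⟨y, hy, hyF⟩ (hYw.mono Set.sdiff_subset) (fun z hz => hz.2)
  have h2 : F ∪ (X ∪ Y) = F ∪ Y \ F := by
    ext z
    have := @hXF z
    simp only [Set.mem_union, Set.mem_sdiff]
    tauto
  rw [← h2] at h1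
  by_cases hw : IsStrong 𝒯 (F ∩ (X ∪ Y))ᶜ
  · exact h1 (h.separating_union hF.1 hXY
      (hX.mono (Set.subset_inter hXF Set.subset_union_left)) hw)
  · have hw' : IsWeak 𝒯 (F ∩ (X ∪ Y))ᶜ := not_not.1 hw
    have h3 := hF.2.2 Fᶜ ⟨y, hyF⟩ (hw'.mono (Set.compl_subset_compl.2 Set.inter_subset_left)) le_rfl
    rw [Set.union_compl_self] at h3
    exact h3 hXY.univ

/-- The full closure is fully closed, and its complement has the full closure of `Xᶜ`. -/
theorem isFullyClosed_fcl_and_fcl_compl (h : IsRobustTangle C k 𝒯) [Nonempty E] {X : Set E} (hX : IsStrong 𝒯 X)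
    (hs : IsSeparating C k X) :
    IsFullyClosed C k 𝒯 (fcl C k 𝒯 X) ∧
      (fcl C k 𝒯 X ≠ Set.univ → fcl C k 𝒯 (fcl C k 𝒯 X)ᶜ = fcl C k 𝒯 Xᶜ) := by
  by_cases hU : fcl C k 𝒯 X = Set.univ
  · refine ⟨?_, fun h0 => absurd hU h0⟩
    rw [hU]
    refine ⟨hs.univ, h.isBig_univ.isStrong, fun Y hY _ hYc => ?_⟩
    rw [Set.compl_univ, Set.subset_empty_iff] at hYc
    exact absurd hYc hY.ne_empty
  · have hfin : ({Z : Set E | X ⊆ Z ∧ IsSeparating C k Z ∧ Z ⊆ fcl C k 𝒯 X ∧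
        fcl C k 𝒯 Zᶜ = fcl C k 𝒯 Xᶜ}).Finite := Set.toFinite _
    obtain ⟨M, hM⟩ := hfin.exists_maximal ⟨X, le_rfl, hs, subset_fcl X, rfl⟩
    obtain ⟨⟨hXM, hMs, hMf, hMc⟩, hmax⟩ := hM
    have hMstr : IsStrong 𝒯 M := hX.mono hXM
    have hclosed : IsFullyClosed C k 𝒯 M := by
      refine ⟨hMs, hMstr, fun Y hYne hYw hYc hYs => ?_⟩
      have h1 : Y ⊆ fcl C k 𝒯 M := subset_fcl_of_separating h hMstr hYs (Or.inr hYw)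
      have h2 : M ∪ Y ⊆ fcl C k 𝒯 X := Set.union_subset hMf (h1.trans (fcl_subset_fcl hMf))
      -- If the remaining complement were weak it would be absorbed as well, and the closure would
      -- be everything.
      have hbig : IsStrong 𝒯 (M ∪ Y)ᶜ := by
        intro hw
        apply hU
        apply Set.eq_univ_of_univ_subset
        have h3 : (M ∪ Y)ᶜ ⊆ fcl C k 𝒯 (M ∪ Y) :=
          subset_fcl_of_separating h (hMstr.mono Set.subset_union_left)
            (by rw [Set.union_compl_self]; exact hs.univ) (Or.inr hw)
        rw [← Set.union_compl_self (M ∪ Y)]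
        exact Set.union_subset h2 (h3.trans (fcl_subset_fcl h2))
      have h4 : (M ∪ Y)ᶜ ∪ Y = Mᶜ := by
        ext z
        have := @hYc z
        simp only [Set.mem_union, Set.mem_compl_iff] at *
        tauto
      have h5 : Y ⊆ fcl C k 𝒯 (M ∪ Y)ᶜ :=
        subset_fcl_of_separating h hbig (by rw [h4]; exact hMs.compl) (Or.inr hYw)
      have h6 : fcl C k 𝒯 (M ∪ Y)ᶜ = fcl C k 𝒯 Mᶜ := by
        symm
        apply fcl_eq_of_subset
        · exact Set.compl_subset_compl.2 Set.subset_union_left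
        · rw [← h4]
          exact Set.union_subset (subset_fcl _) h5
      have h7 := hmax (show M ∪ Y ∈ _ from
        ⟨hXM.trans Set.subset_union_left, hYs, h2, h6.trans hMc⟩) Set.subset_union_left
      obtain ⟨y, hy⟩ := hYne
      exact hYc hy (h7 (Or.inr hy))
    have hMeq : fcl C k 𝒯 X = M := (fcl_subset hclosed hXM).antisymm hMf
    rw [hMeq]
    exact ⟨hclosed, fun _ => hMc⟩

theorem fcl_compl_fcl (h : IsRobustTangle C k 𝒯) [Nonempty E] {X : Set E} (hX : IsStrong 𝒯 X)
    (hs : IsSeparating C k X) (hU : fcl C k 𝒯 X ≠ Set.univ) :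
    fcl C k 𝒯 (fcl C k 𝒯 X)ᶜ = fcl C k 𝒯 Xᶜ :=
  (isFullyClosed_fcl_and_fcl_compl h hX hs).2 hU

theorem isSeparating_fcl (h : IsRobustTangle C k 𝒯) [Nonempty E] {X : Set E} (hX : IsStrong 𝒯 X)
    (hs : IsSeparating C k X) : IsSeparating C k (fcl C k 𝒯 X) :=
  (isFullyClosed_fcl_and_fcl_compl h hX hs).1.1

theorem isBig_compl_of_fcl_ne (h : IsRobustTangle C k 𝒯) [Nonempty E] {X : Set E}
    (hX : IsStrong 𝒯 X) (hs : IsSeparating C k X) (hU : fcl C k 𝒯 X ≠ Set.univ) : IsBig 𝒯 Xᶜ := by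
  intro hw
  apply hU
  apply Set.eq_univ_of_univ_subset
  rw [← Set.union_compl_self X]
  exact Set.union_subset (subset_fcl X) (subset_fcl_of_separating h hX
    (by rw [Set.union_compl_self]; exact hs.univ) hw)

/-- A non-sequential separation, in a form in which the strength of its sides is explicit. -/
structure NonSeq (C : ConnectivitySystem E) (k : ℤ) (𝒯 : Set (Set E)) (X : Set E) : Prop where
  sep : IsSeparating C k X
  big : IsBig 𝒯 X
  big_compl : IsBig 𝒯 Xᶜ
  fcl_ne : fcl C k 𝒯 X ≠ Set.univ
  fcl_compl_ne : fcl C k 𝒯 Xᶜ ≠ Set.univ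

theorem NonSeq.compl {X : Set E} (h : NonSeq C k 𝒯 X) : NonSeq C k 𝒯 Xᶜ :=
  ⟨h.sep.compl, h.big_compl, by simpa using h.big, h.fcl_compl_ne, by simpa using h.fcl_ne⟩

theorem NonSeq.isStrongSeparation {X : Set E} (h : NonSeq C k 𝒯 X) : IsStrongSeparation C k 𝒯 X :=
  ⟨h.sep, h.big.isStrong, h.big_compl.isStrong⟩

theorem nonSeq_of_fcl_ne (h : IsRobustTangle C k 𝒯) [Nonempty E] {X : Set E}
    (hs : IsSeparating C k X) (hX : IsStrong 𝒯 X) (h1 : fcl C k 𝒯 X ≠ Set.univ)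
    (h2 : fcl C k 𝒯 Xᶜ ≠ Set.univ) : NonSeq C k 𝒯 X := by
  have h3 := isBig_compl_of_fcl_ne h hX hs h1
  have h4 := isBig_compl_of_fcl_ne h h3.isStrong hs.compl h2
  rw [compl_compl] at h4
  exact ⟨hs, h4, h3, h1, h2⟩

theorem isNonSequentialSeparation_iff (h : IsRobustTangle C k 𝒯) [Nonempty E] {X : Set E} :
    IsNonSequentialSeparation C k 𝒯 X ↔ NonSeq C k 𝒯 X := by
  constructor
  · rintro ⟨hs, h1, h2⟩
    -- A small set with strong complement is absorbed by that complement, hence is sequential.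
    have key : ∀ Z : Set E, IsSeparating C k Z → ¬ IsSequentialSet C k 𝒯 Z →
        IsBig 𝒯 Z ∨ ¬ IsStrong 𝒯 Zᶜ := by
      intro Z hZs hZ
      by_contra hcon
      push Not at hcon
      obtain ⟨hc1, hc2⟩ := hcon
      have hw : IsSmall 𝒯 Z := not_not.1 hc1
      refine hZ ⟨hZs, hc2, ?_⟩
      apply Set.eq_univ_of_univ_subset
      rw [← Set.compl_union_self Z]
      exact Set.union_subset (subset_fcl _) (subset_fcl_of_separating h hc2
        (by rw [Set.compl_union_self]; exact hs.univ) hw)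
    have k1 := key X hs h1
    have k2 := key Xᶜ hs.compl h2
    rw [compl_compl] at k2
    have hX : IsStrong 𝒯 X := by
      rcases k1 with h0 | h0
      · exact h0.isStrong
      · intro hw
        have := h.isBig_compl (Or.inr hw)
        exact h0 this.isStrong
    have hXc : IsStrong 𝒯 Xᶜ := by
      rcases k2 with h0 | h0
      · exact h0.isStrong
      · exact absurd hX h0
    refine nonSeq_of_fcl_ne h hs hX ?_ ?_
    · intro h0
      exact h2 ⟨hs.compl, by rwa [compl_compl], by rwa [compl_compl]⟩
    · intro h0
      exact h1 ⟨hs, hXc, h0⟩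
  · intro hX
    refine ⟨hX.sep, fun h0 => hX.fcl_compl_ne h0.2.2, fun h0 => hX.fcl_ne ?_⟩
    simpa using h0.2.2

theorem isSSeparation_iff (h : IsRobustTangle C k 𝒯) [Nonempty E] {X : Set E} :
    IsSSeparation C k (nonSequentialSets C k 𝒯) X ↔ NonSeq C k 𝒯 X := by
  rw [← isNonSequentialSeparation_iff h]
  constructor
  · rintro ⟨h1, ⟨-, h2, -⟩, ⟨-, h3, -⟩⟩
    exact ⟨h1, h2, h3⟩
  · intro hX
    have hX' := (isNonSequentialSeparation_iff h).1 hX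
    exact ⟨hX.1, ⟨hX.1, hX.2.1, hX'.big_compl.isStrong⟩,
      ⟨hX.1.compl, hX.2.2, by rw [compl_compl]; exact hX'.big.isStrong⟩⟩

/-- By `fcl_compl_fcl`, the closure of one side determines the closure of the other. Equivalence can
therefore be tested on a single side. -/
theorem NonSeq.of_fcl_eq (h : IsRobustTangle C k 𝒯) [Nonempty E] {U W : Set E}
    (hU : NonSeq C k 𝒯 U) (hs : IsSeparating C k W) (hW : IsStrong 𝒯 W)
    (he : fcl C k 𝒯 W = fcl C k 𝒯 U) : NonSeq C k 𝒯 W ∧ fcl C k 𝒯 Wᶜ = fcl C k 𝒯 Uᶜ := by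
  have h1 : fcl C k 𝒯 W ≠ Set.univ := by rw [he]; exact hU.fcl_ne
  have h2 : fcl C k 𝒯 Wᶜ = fcl C k 𝒯 Uᶜ := by
    rw [← fcl_compl_fcl h hW hs h1, he, fcl_compl_fcl h hU.big.isStrong hU.sep hU.fcl_ne]
  exact ⟨nonSeq_of_fcl_ne h hs hW h1 (by rw [h2]; exact hU.fcl_compl_ne), h2⟩

theorem NonSeq.sepEquiv (h : IsRobustTangle C k 𝒯) [Nonempty E] {U W : Set E}
    (hU : NonSeq C k 𝒯 U) (hs : IsSeparating C k W) (hW : IsStrong 𝒯 W)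
    (he : fcl C k 𝒯 W = fcl C k 𝒯 U) : SepEquiv C k 𝒯 U W := by
  obtain ⟨h1, h2⟩ := hU.of_fcl_eq h hs hW he
  refine ⟨hU.isStrongSeparation, h1.isStrongSeparation, ?_⟩
  rw [he, h2]

theorem SepEquiv.symm {U W : Set E} (h : SepEquiv C k 𝒯 U W) : SepEquiv C k 𝒯 W U :=
  ⟨h.2.1, h.1, h.2.2.symm⟩

theorem SepEquiv.trans {U V W : Set E} (h : SepEquiv C k 𝒯 U V) (h' : SepEquiv C k 𝒯 V W) :
    SepEquiv C k 𝒯 U W :=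
  ⟨h.1, h'.2.1, h.2.2.trans h'.2.2⟩

theorem IsStrongSeparation.compl {U : Set E} (h : IsStrongSeparation C k 𝒯 U) :
    IsStrongSeparation C k 𝒯 Uᶜ :=
  ⟨h.1.compl, h.2.2, by rw [compl_compl]; exact h.2.1⟩

theorem SepEquiv.compl_right {U W : Set E} (h : SepEquiv C k 𝒯 U W) : SepEquiv C k 𝒯 U Wᶜ := by
  refine ⟨h.1, h.2.1.compl, ?_⟩
  rw [compl_compl, Set.pair_comm (fcl C k 𝒯 Wᶜ)]
  exact h.2.2

theorem SepEquiv.compl_left {U W : Set E} (h : SepEquiv C k 𝒯 U W) : SepEquiv C k 𝒯 Uᶜ W :=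
  h.symm.compl_right.symm

theorem SepEquiv.fcl_eq {U W : Set E} (h : SepEquiv C k 𝒯 U W) :
    (fcl C k 𝒯 W = fcl C k 𝒯 U ∧ fcl C k 𝒯 Wᶜ = fcl C k 𝒯 Uᶜ) ∨
      (fcl C k 𝒯 Wᶜ = fcl C k 𝒯 U ∧ fcl C k 𝒯 W = fcl C k 𝒯 Uᶜ) := by
  have h1 := h.2.2
  rw [Set.pair_eq_pair_iff] at h1
  rcases h1 with ⟨h1, h2⟩ | ⟨h1, h2⟩
  · exact Or.inl ⟨h1.symm, h2.symm⟩
  · exact Or.inr ⟨h1.symm, h2.symm⟩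

theorem SepEquiv.nonSeq (h : IsRobustTangle C k 𝒯) [Nonempty E] {U W : Set E}
    (hUW : SepEquiv C k 𝒯 U W) (hU : NonSeq C k 𝒯 U) : NonSeq C k 𝒯 W := by
  rcases hUW.fcl_eq with ⟨h1, h2⟩ | ⟨h1, h2⟩
  · exact nonSeq_of_fcl_ne h hUW.2.1.1 hUW.2.1.2.1 (by rw [h1]; exact hU.fcl_ne)
      (by rw [h2]; exact hU.fcl_compl_ne)
  · exact nonSeq_of_fcl_ne h hUW.2.1.1 hUW.2.1.2.1 (by rw [h2]; exact hU.fcl_compl_ne)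
      (by rw [h1]; exact hU.fcl_ne)

/-- Adding a small piece to a non-sequential set gives an equivalent non-sequential set. -/
theorem NonSeq.union_small (h : IsRobustTangle C k 𝒯) [Nonempty E] {U W : Set E}
    (hU : NonSeq C k 𝒯 U) (hs : IsSeparating C k (U ∪ W)) (hW : IsSmall 𝒯 (W ∩ Uᶜ)) :
    fcl C k 𝒯 (U ∪ W) = fcl C k 𝒯 U := by
  have he : U ∪ W = U ∪ W ∩ Uᶜ := by
    ext z
    simp only [Set.mem_union, Set.mem_inter_iff, Set.mem_compl_iff]
    tauto
  rw [he] at hs ⊢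
  exact fcl_eq_of_subset Set.subset_union_left (Set.union_subset (subset_fcl U)
    (subset_fcl_of_separating h hU.big.isStrong hs hW))

theorem compl_fcl_compl_subset {U W : Set E} (he : fcl C k 𝒯 Wᶜ = fcl C k 𝒯 Uᶜ) :
    (fcl C k 𝒯 Uᶜ)ᶜ ⊆ W := by
  rw [← he, Set.compl_subset_comm]
  exact subset_fcl _

/-- The smallest set equivalent to the non-sequential set `U`. -/
theorem NonSeq.sepEquiv_core (h : IsRobustTangle C k 𝒯) [Nonempty E] {U : Set E}
    (hU : NonSeq C k 𝒯 U) : SepEquiv C k 𝒯 U (fcl C k 𝒯 Uᶜ)ᶜ := by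
  have hV := hU.compl
  have h1 : IsSeparating C k (fcl C k 𝒯 Uᶜ) := isSeparating_fcl h hV.big.isStrong hV.sep
  have h2 : fcl C k 𝒯 (fcl C k 𝒯 Uᶜ) = fcl C k 𝒯 Uᶜ :=
    fcl_eq_of_subset (subset_fcl _) le_rfl
  have h3 := (hV.sepEquiv h h1 (hV.big.isStrong.mono (subset_fcl _)) h2).compl_left.compl_right
  rwa [compl_compl] at h3

end FullClosure

/-! ### Uncrossing for unions of strong fibers. -/

section Fibers

variable {E : Type u} [Finite E] {C : ConnectivitySystem E} {k : ℤ} {𝒯 : Set (Set E)}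
  {ι : Type*} {τ : E → ι}

/-- `W` is a union of fibers of `τ`. -/
def Saturated (τ : E → ι) (W : Set E) : Prop := ∀ x y, τ x = τ y → (x ∈ W ↔ y ∈ W)

/-- The fiber of `τ` through `x`. -/
def fiberAt (τ : E → ι) (x : E) : Set E := {y | τ y = τ x}

/-- All fibers of `τ` are nonempty strong sets. -/
def BigFibers (𝒯 : Set (Set E)) (τ : E → ι) : Prop := ∀ x, IsBig 𝒯 (fiberAt τ x)

theorem mem_fiberAt {x y : E} : y ∈ fiberAt τ x ↔ τ y = τ x := Iff.rfl

theorem mem_fiberAt_self (x : E) : x ∈ fiberAt τ x := rfl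

theorem saturated_fiberAt (x : E) : Saturated τ (fiberAt τ x) := by
  intro y z hyz
  rw [mem_fiberAt, mem_fiberAt, hyz]

theorem Saturated.compl {W : Set E} (h : Saturated τ W) : Saturated τ Wᶜ :=
  fun x y hxy => not_congr (h x y hxy)

theorem Saturated.union {W Z : Set E} (h : Saturated τ W) (h' : Saturated τ Z) :
    Saturated τ (W ∪ Z) :=
  fun x y hxy => or_congr (h x y hxy) (h' x y hxy)

theorem Saturated.inter {W Z : Set E} (h : Saturated τ W) (h' : Saturated τ Z) :
    Saturated τ (W ∩ Z) :=
  fun x y hxy => and_congr (h x y hxy) (h' x y hxy)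

theorem Saturated.fiberAt_subset {W : Set E} (h : Saturated τ W) {x : E} (hx : x ∈ W) :
    fiberAt τ x ⊆ W :=
  fun y hy => (h y x hy).2 hx

theorem BigFibers.isBig (hτ : BigFibers 𝒯 τ) {W : Set E} (h : Saturated τ W) (hW : W.Nonempty) :
    IsBig 𝒯 W := by
  obtain ⟨x, hx⟩ := hW
  exact (hτ x).mono (h.fiberAt_subset hx)

/-- A nonempty union of big fibers is strong, so the strength conditions of uncrossing become
nonemptiness conditions. -/
theorem BigFibers.separating_union (hτ : BigFibers 𝒯 τ) (h : IsRobustTangle C k 𝒯) {X Y : Set E}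
    (hX : IsSeparating C k X) (hY : IsSeparating C k Y) (hXs : Saturated τ X) (hYs : Saturated τ Y)
    (hne : (X ∩ Y).Nonempty) : IsSeparating C k (X ∪ Y) := by
  by_cases hc : (X ∩ Y)ᶜ.Nonempty
  · exact h.separating_union hX hY (hτ.isBig (hXs.inter hYs) hne).isStrong
      (hτ.isBig (hXs.inter hYs).compl hc).isStrong
  · rw [Set.not_nonempty_iff_eq_empty, Set.compl_empty_iff] at hc
    have : X ∪ Y = Set.univ :=
      Set.eq_univ_of_univ_subset (hc ▸ Set.inter_subset_left.trans Set.subset_union_left)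
    rw [this]
    exact hX.univ

theorem BigFibers.separating_inter (hτ : BigFibers 𝒯 τ) (h : IsRobustTangle C k 𝒯) {X Y : Set E}
    (hX : IsSeparating C k X) (hY : IsSeparating C k Y) (hXs : Saturated τ X) (hYs : Saturated τ Y)
    {z : E} (hzX : z ∉ X) (hzY : z ∉ Y) : IsSeparating C k (X ∩ Y) := by
  have h1 := hτ.separating_union h hX.compl hY.compl hXs.compl hYs.compl ⟨z, hzX, hzY⟩
  rw [← Set.compl_inter] at h1
  exact isSeparating_compl_iff.1 h1

end Fibers

/-! ### Flowers encoded by rank functions, with fibers as petals; anemones and merging. -/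

section RankFlowers

variable {E : Type u} [Finite E] {C : ConnectivitySystem E} {k : ℤ} {𝒯 : Set (Set E)}
  {ρ : E → ℕ}

/-- The fibers of `ρ`, in the order of their values, are the petals of a `k`-flower. -/
structure RankFlower (C : ConnectivitySystem E) (k : ℤ) (𝒯 : Set (Set E)) (ρ : E → ℕ) : Prop where
  big : BigFibers 𝒯 ρ
  sep : ∀ i j, IsSeparating C k {y | i ≤ ρ y ∧ ρ y ≤ j}

/-- All unions of fibers of `ρ` are separating. -/
def RankAnemone (C : ConnectivitySystem E) (k : ℤ) (ρ : E → ℕ) : Prop :=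
  ∀ W, Saturated ρ W → IsSeparating C k W

theorem saturated_Icc (i j : ℕ) : Saturated ρ {y | i ≤ ρ y ∧ ρ y ≤ j} := by
  intro x y hxy
  simp only [Set.mem_ofPred_eq, hxy]

theorem RankFlower.separating_fiberAt (hρ : RankFlower C k 𝒯 ρ) (x : E) :
    IsSeparating C k (fiberAt ρ x) := by
  have h1 := hρ.sep (ρ x) (ρ x)
  have h2 : {y | ρ x ≤ ρ y ∧ ρ y ≤ ρ x} = fiberAt ρ x := by
    ext y
    simp only [Set.mem_ofPred_eq, mem_fiberAt]
    omega
  rwa [h2] at h1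

theorem Saturated.congr {ι κ : Type*} {τ : E → ι} {σ : E → κ} {W : Set E} (h : Saturated τ W)
    (hσ : ∀ x y, σ x = σ y → τ x = τ y) : Saturated σ W :=
  fun x y hxy => h x y (hσ x y hxy)

theorem RankAnemone.congr {σ : E → ℕ} (h : RankAnemone C k ρ) (hσ : ∀ x y, ρ x = ρ y → σ x = σ y) :
    RankAnemone C k σ :=
  fun W hW => h W (hW.congr hσ)

theorem RankAnemone.rankFlower {σ : E → ℕ} (h : RankAnemone C k ρ) (hb : BigFibers 𝒯 ρ)
    (hσ : ∀ x y, σ x = σ y ↔ ρ x = ρ y) : RankFlower C k 𝒯 σ := by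
  refine ⟨fun x => ?_, fun i j => h.congr (fun x y => (hσ x y).2) _ (saturated_Icc i j)⟩
  have h1 : fiberAt σ x = fiberAt ρ x := by
    ext y
    exact hσ y x
  rw [h1]
  exact hb x

/-- Intersect `W` first with the interval from `a` to `c`, where `d` witnesses that uncrossing is
allowed, and then with the complement of the open interval between them, where `b` is the witness.
Only the two end petals survive. -/
theorem RankFlower.separating_pair (hρ : RankFlower C k 𝒯 ρ) (h : IsRobustTangle C k 𝒯)
    {W : Set E} (hs : IsSeparating C k W) (hW : Saturated ρ W) {a b c d : E} (hab : ρ a < ρ b)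
    (hbc : ρ b < ρ c) (hcd : ρ c < ρ d ∨ ρ d < ρ a) (ha : a ∈ W) (hb : b ∉ W) (hc : c ∈ W)
    (hd : d ∉ W) : IsSeparating C k (fiberAt ρ a ∪ fiberAt ρ c) := by
  have h1 : IsSeparating C k (W ∩ {y | ρ a ≤ ρ y ∧ ρ y ≤ ρ c}) := by
    refine hρ.big.separating_inter h hs (hρ.sep _ _) hW (saturated_Icc _ _) hd ?_
    simp only [Set.mem_ofPred_eq]
    omega
  have h2 : IsSeparating C k ((W ∩ {y | ρ a ≤ ρ y ∧ ρ y ≤ ρ c}) ∩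
      {y | ρ a + 1 ≤ ρ y ∧ ρ y ≤ ρ c - 1}ᶜ) := by
    refine hρ.big.separating_inter h h1 (hρ.sep _ _).compl (hW.inter (saturated_Icc _ _))
      (saturated_Icc _ _).compl (fun h0 => hb h0.1) ?_
    simp only [Set.mem_compl_iff, Set.mem_ofPred_eq]
    omega
  convert h2 using 1
  ext y
  have hya := hW y a
  have hyc := hW y c
  simp only [Set.mem_union, mem_fiberAt, Set.mem_inter_iff, Set.mem_compl_iff, Set.mem_ofPred_eq]
  constructor
  · rintro (h0 | h0)
    · exact ⟨⟨(hya h0).2 ha, by omega⟩, by omega⟩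
    · exact ⟨⟨(hyc h0).2 hc, by omega⟩, by omega⟩
  · rintro ⟨⟨-, h3⟩, h4⟩
    omega

/-- A union of petals grows from one petal by adjoining separating pairs that share this petal. -/
theorem RankFlower.rankAnemone_of_pairs (hρ : RankFlower C k 𝒯 ρ) (h : IsRobustTangle C k 𝒯)
    (hp : ∀ x y, IsSeparating C k (fiberAt ρ x ∪ fiberAt ρ y)) : RankAnemone C k ρ := by
  intro W hW
  by_cases hne : W.Nonempty
  · obtain ⟨x, hx⟩ := hne
    have hfin : {Z : Set E | Saturated ρ Z ∧ IsSeparating C k Z ∧ Z ⊆ W ∧ x ∈ Z}.Finite :=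
      Set.toFinite _
    obtain ⟨M, ⟨hMsat, hMs, hMW, hxM⟩, hmax⟩ := hfin.exists_maximal
      ⟨fiberAt ρ x, saturated_fiberAt x, hρ.separating_fiberAt x, hW.fiberAt_subset hx,
        mem_fiberAt_self x⟩
    have hMW' : W ⊆ M := by
      intro y hy
      have h1 := hρ.big.separating_union h hMs (hp x y) hMsat
        ((saturated_fiberAt x).union (saturated_fiberAt y)) ⟨x, hxM, Or.inl (mem_fiberAt_self x)⟩
      refine hmax (show M ∪ (fiberAt ρ x ∪ fiberAt ρ y) ∈ _ from
        ⟨hMsat.union ((saturated_fiberAt x).union (saturated_fiberAt y)), h1, ?_, Or.inl hxM⟩)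
        Set.subset_union_left (Or.inr (Or.inr (mem_fiberAt_self y)))
      exact Set.union_subset hMW
        (Set.union_subset (hW.fiberAt_subset hx) (hW.fiberAt_subset hy))
    rwa [hMW'.antisymm hMW]
  · rw [Set.not_nonempty_iff_eq_empty] at hne
    rw [hne]
    exact (hρ.sep 0 0).empty

/-- If a pair of petals is separating, then so is every pair that crosses it. -/
theorem RankFlower.separating_crossing_pair (hρ : RankFlower C k 𝒯 ρ) (h : IsRobustTangle C k 𝒯)
    {a b c d : E} (hab : ρ a < ρ b) (hbc : ρ b < ρ c) (hcd : ρ c < ρ d ∨ ρ d < ρ a) :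
    IsSeparating C k (fiberAt ρ a ∪ fiberAt ρ c) ↔ IsSeparating C k (fiberAt ρ b ∪ fiberAt ρ d) := by
  have key : ∀ {a b c d : E}, ρ a < ρ b → ρ b < ρ c → ρ c < ρ d →
      (IsSeparating C k (fiberAt ρ a ∪ fiberAt ρ c) ↔
        IsSeparating C k (fiberAt ρ b ∪ fiberAt ρ d)) := by
    intro a b c d hab hbc hcd
    constructor
    -- The complement of a separating pair alternates with it along any crossing pair, so
    -- `separating_pair` applies to the complement.
    · intro hs
      have hsat := ((saturated_fiberAt (τ := ρ) a).union (saturated_fiberAt c)).compl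
      refine hρ.separating_pair h hs.compl hsat hbc hcd (Or.inr hab) ?_ ?_ ?_ ?_ <;>
        simp only [Set.mem_compl_iff, Set.mem_union, mem_fiberAt, not_not, true_or, or_true] <;> omega
    · intro hs
      have hsat := ((saturated_fiberAt (τ := ρ) b).union (saturated_fiberAt d)).compl
      refine hρ.separating_pair h hs.compl hsat hab hbc (Or.inl hcd) ?_ ?_ ?_ ?_ <;>
        simp only [Set.mem_compl_iff, Set.mem_union, mem_fiberAt, not_not, true_or, or_true] <;> omega
  rcases hcd with hcd | hcd
  · exact key hab hbc hcd
  · rw [Set.union_comm (fiberAt ρ b)]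
    exact (key hcd hab hbc).symm

/-- One separating union that is not cyclically consecutive yields one separating chord. Being
separating passes between crossing chords, and any two chords with petals on both sides are joined
by a chain of crossings. -/
theorem RankFlower.rankAnemone (hρ : RankFlower C k 𝒯 ρ) (h : IsRobustTangle C k 𝒯)
    {W : Set E} (hs : IsSeparating C k W) (hW : Saturated ρ W) {a b c d : E} (hab : ρ a < ρ b)
    (hbc : ρ b < ρ c) (hcd : ρ c < ρ d) (ha : a ∈ W) (hb : b ∉ W) (hc : c ∈ W)
    (hd : d ∉ W) : RankAnemone C k ρ := by
  have hac := hρ.separating_pair h hs hW hab hbc (Or.inl hcd) ha hb hc hd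
  apply hρ.rankAnemone_of_pairs h
  have key : ∀ p q : E, ρ p < ρ q → IsSeparating C k (fiberAt ρ p ∪ fiberAt ρ q) := by
    intro p q hpq
    by_cases hr : ∃ r, ρ p < ρ r ∧ ρ r < ρ q
    swap
    · convert hρ.sep (ρ p) (ρ q) using 1
      ext y
      simp only [Set.mem_union, mem_fiberAt, Set.mem_ofPred_eq]
      push Not at hr
      have := hr y
      omega
    by_cases ht : ∃ t, ρ q < ρ t ∨ ρ t < ρ p
    swap
    · convert (hρ.sep (ρ p + 1) (ρ q - 1)).compl using 1
      ext y
      simp only [Set.mem_union, mem_fiberAt, Set.mem_compl_iff, Set.mem_ofPred_eq]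
      push Not at ht
      have := ht y
      omega
    obtain ⟨r, hpr, hrq⟩ := hr
    obtain ⟨t, ht⟩ := ht
    have cross : ∀ {a b c d : E}, ρ a < ρ b → ρ b < ρ c → (ρ c < ρ d ∨ ρ d < ρ a) →
      (IsSeparating C k (fiberAt ρ a ∪ fiberAt ρ c) ↔
        IsSeparating C k (fiberAt ρ b ∪ fiberAt ρ d)) := hρ.separating_crossing_pair h
    -- According to the position of the chord `pq` relative to `ac`: the two chords cross, or some
    -- chord among `bt`, `rd` and `rb` crosses both.
    by_cases c1 : ρ p ≤ ρ a ∧ ρ c ≤ ρ q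
    · rw [cross (b := b) (d := t) (by omega) (by omega) ht]
      rwa [← cross hab hbc (by omega)]
    by_cases c2 : ρ a ≤ ρ p ∧ ρ q ≤ ρ c
    · rw [cross (b := r) (d := d) hpr hrq (by omega)]
      rwa [← cross (a := a) (c := c) (by omega) (by omega) (by omega)]
    by_cases c3 : ρ c ≤ ρ p ∨ ρ q ≤ ρ a
    · rw [cross (b := r) (d := b) hpr hrq (by omega), Set.union_comm]
      rwa [← cross hab hbc (by omega)]
    by_cases c4 : ρ a < ρ p
    · exact (cross c4 (by omega) (Or.inl (by omega))).1 hac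
    · exact (cross (a := p) (b := a) (c := q) (d := c) (by omega) (by omega)
        (Or.inl (by omega))).2 hac
  intro x y
  rcases lt_trichotomy (ρ x) (ρ y) with h0 | h0 | h0
  · exact key x y h0
  · have : fiberAt ρ x = fiberAt ρ y := by
      ext z
      rw [mem_fiberAt, mem_fiberAt, h0]
    rw [this, Set.union_self]
    exact hρ.separating_fiberAt y
  · rw [Set.union_comm]
    exact key y x h0

/-- A flower may be rotated so that any given petal becomes the first one. -/
theorem RankFlower.exists_rotate (hρ : RankFlower C k 𝒯 ρ) (x : E) :
    ∃ σ : E → ℕ, RankFlower C k 𝒯 σ ∧ (∀ y z, σ y = σ z ↔ ρ y = ρ z) ∧ σ x = 0 := by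
  obtain ⟨N, hN⟩ : ∃ N, ∀ y, ρ y < N := by
    obtain ⟨N, hN⟩ := (Set.finite_range ρ).bddAbove
    exact ⟨N + 1, fun y => Nat.lt_succ_of_le (hN ⟨y, rfl⟩)⟩
  obtain ⟨σ, hσ⟩ : ∃ σ : E → ℕ, ∀ y, (ρ x ≤ ρ y ∧ σ y = ρ y - ρ x) ∨
      (ρ y < ρ x ∧ σ y = ρ y + N - ρ x) := by
    refine ⟨fun y => if ρ x ≤ ρ y then ρ y - ρ x else ρ y + N - ρ x, fun y => ?_⟩
    by_cases h0 : ρ x ≤ ρ y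
    · exact Or.inl ⟨h0, if_pos h0⟩
    · exact Or.inr ⟨by omega, if_neg h0⟩
  have hx := hN x
  have hker : ∀ y z, σ y = σ z ↔ ρ y = ρ z := by
    intro y z
    have h1 := hσ y
    have h2 := hσ z
    have h3 := hN y
    have h4 := hN z
    omega
  refine ⟨σ, ⟨fun y => ?_, fun i j => ?_⟩, hker, ?_⟩
  · have h1 : fiberAt σ y = fiberAt ρ y := by
      ext z
      exact hker z y
    rw [h1]
    exact hρ.big y
  -- An interval for `σ` lies in the part of `ρ` from `x` on, or in the part before `x`, or runs
  -- across the junction; in the last case it is the complement of an interval, or everything.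
  · by_cases h1 : j < N - ρ x
    · convert hρ.sep (ρ x + i) (ρ x + j) using 1
      ext y
      have := hσ y
      have := hN y
      simp only [Set.mem_ofPred_eq]
      omega
    by_cases h2 : N - ρ x ≤ i
    · by_cases h3 : ρ x = 0
      · convert (hρ.sep 0 0).empty using 1
        ext y
        have := hσ y
        have := hN y
        simp only [Set.mem_ofPred_eq, Set.mem_empty_iff_false, iff_false]
        omega
      convert hρ.sep (i + ρ x - N) (min (j + ρ x - N) (ρ x - 1)) using 1
      ext y
      have := hσ y
      have := hN y
      simp only [Set.mem_ofPred_eq]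
      omega
    · by_cases h3 : ρ x + i = 0
      · convert (hρ.sep 0 0).univ using 1
        ext y
        have := hσ y
        have := hN y
        simp only [Set.mem_ofPred_eq, Set.mem_univ, iff_true]
        omega
      convert (hρ.sep (min (j + ρ x - N + 1) (ρ x)) (ρ x + i - 1)).compl using 1
      ext y
      have := hσ y
      have := hN y
      simp only [Set.mem_ofPred_eq, Set.mem_compl_iff]
      omega
  · have := hσ x
    omega

/-- A separating union of petals that contains the petal at `c` and another one contains a petal
whose union with the petal at `c` is separating. -/
theorem RankFlower.exists_neighbour (hρ : RankFlower C k 𝒯 ρ) (h : IsRobustTangle C k 𝒯)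
    {W : Set E} (hs : IsSeparating C k W) (hW : Saturated ρ W) {c z : E} (hc : c ∈ W) (hz : z ∈ W)
    (hcz : ρ z ≠ ρ c) :
    ∃ y ∈ W, ρ y ≠ ρ c ∧ IsSeparating C k (fiberAt ρ c ∪ fiberAt ρ y) := by
  obtain ⟨σ, hσ, hker, hc0⟩ := hρ.exists_rotate c
  have hfib : ∀ y, fiberAt ρ y = fiberAt σ y := by
    intro y
    ext z
    exact (hker z y).symm
  have hne : ∀ y, ρ y ≠ ρ c ↔ 0 < σ y := by
    intro y
    rw [Ne, ← hker, hc0]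
    omega
  simp only [hfib, hne] at hcz ⊢
  -- With the petal at `c` in position zero, `p` and `q` lie in its two cyclic neighbours. If `W`
  -- misses both of them, they separate `c` from `z` and `separating_pair` applies to `c` and `z`.
  obtain ⟨p, hp, hpmin⟩ := Set.exists_min_image {y | 0 < σ y} σ (Set.toFinite _) ⟨z, hcz⟩
  obtain ⟨q, hq, hqmax⟩ := Set.exists_max_image {y | 0 < σ y} σ (Set.toFinite _) ⟨z, hcz⟩
  simp only [Set.mem_ofPred_eq] at hp hpmin hq hqmax
  by_cases hpW : p ∈ W
  · refine ⟨p, hpW, hp, ?_⟩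
    convert hσ.sep 0 (σ p) using 1
    ext y
    have := hpmin y
    simp only [Set.mem_union, mem_fiberAt, Set.mem_ofPred_eq]
    omega
  by_cases hqW : q ∈ W
  · refine ⟨q, hqW, hq, ?_⟩
    convert (hσ.sep 1 (σ q - 1)).compl using 1
    ext y
    have := hqmax y
    simp only [Set.mem_union, mem_fiberAt, Set.mem_compl_iff, Set.mem_ofPred_eq]
    omega
  have hWσ : Saturated σ W := hW.congr fun x y => (hker x y).1
  refine ⟨z, hz, hcz, ?_⟩
  have h1 : σ z ≠ σ p := fun h0 => hpW ((hWσ _ _ h0).1 hz)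
  have h2 : σ z ≠ σ q := fun h0 => hqW ((hWσ _ _ h0).1 hz)
  have h3 := hpmin z hcz
  have h4 := hqmax z hcz
  exact hσ.separating_pair h hs hWσ (b := p) (d := q) (by omega) (by omega) (by omega) hc hpW hz hqW

/-- Two petals whose union is separating may be merged. -/
theorem RankFlower.merge (hρ : RankFlower C k 𝒯 ρ) (h : IsRobustTangle C k 𝒯) {p q : E}
    (hpq : IsSeparating C k (fiberAt ρ p ∪ fiberAt ρ q)) :
    RankFlower C k 𝒯 (fun x => if ρ x = ρ p then ρ q else ρ x) := by
  set σ : E → ℕ := fun x => if ρ x = ρ p then ρ q else ρ x with hσdef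
  have hσ : ∀ y, (ρ y = ρ p ∧ σ y = ρ q) ∨ (ρ y ≠ ρ p ∧ σ y = ρ y) := by
    intro y
    by_cases h0 : ρ y = ρ p
    · exact Or.inl ⟨h0, if_pos h0⟩
    · exact Or.inr ⟨h0, if_neg h0⟩
  have hsat : Saturated ρ (fiberAt ρ p ∪ fiberAt ρ q) :=
    (saturated_fiberAt p).union (saturated_fiberAt q)
  refine ⟨fun x => (hρ.big x).mono ?_, fun i j => ?_⟩
  · intro y hy
    have := hσ x
    have := hσ y
    rw [mem_fiberAt] at hy ⊢
    omega
  · by_cases hqI : i ≤ ρ q ∧ ρ q ≤ j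
    · convert hρ.big.separating_union h (hρ.sep i j) hpq (saturated_Icc i j) hsat
        ⟨q, hqI, Or.inr (mem_fiberAt_self q)⟩ using 1
      ext y
      have := hσ y
      simp only [Set.mem_union, mem_fiberAt, Set.mem_ofPred_eq]
      omega
    · convert (hρ.big.separating_union h (hρ.sep i j).compl hpq (saturated_Icc i j).compl hsat
        ⟨q, hqI, Or.inr (mem_fiberAt_self q)⟩).compl using 1
      ext y
      have := hσ y
      simp only [Set.mem_union, mem_fiberAt, Set.mem_compl_iff, Set.mem_ofPred_eq]
      omega

/-- The side that contains the petal at `q` can absorb the petal at `p` without changing its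
closure, so merging loses no displayed separation up to equivalence. -/
theorem RankFlower.merge_saturated (hρ : RankFlower C k 𝒯 ρ) (h : IsRobustTangle C k 𝒯)
    [Nonempty E] {p q : E} (hpq : IsSeparating C k (fiberAt ρ p ∪ fiberAt ρ q))
    (hcl : fiberAt ρ p ⊆ fcl C k 𝒯 (fiberAt ρ q)) {W : Set E} (hW : Saturated ρ W)
    (hN : NonSeq C k 𝒯 W) :
    ∃ Z, Saturated (fun x => if ρ x = ρ p then ρ q else ρ x) Z ∧ NonSeq C k 𝒯 Z ∧
      fcl C k 𝒯 Z = fcl C k 𝒯 W := by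
  have key : ∀ W : Set E, Saturated ρ W → NonSeq C k 𝒯 W → q ∈ W →
      ∃ Z, Saturated (fun x => if ρ x = ρ p then ρ q else ρ x) Z ∧ NonSeq C k 𝒯 Z ∧
      fcl C k 𝒯 Z = fcl C k 𝒯 W ∧ fcl C k 𝒯 Zᶜ = fcl C k 𝒯 Wᶜ := by
    intro W hW hN hqW
    have h1 := hρ.big.separating_union h hN.sep hpq hW
      ((saturated_fiberAt p).union (saturated_fiberAt q)) ⟨q, hqW, Or.inr (mem_fiberAt_self q)⟩
    have hqW' := hW.fiberAt_subset hqW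
    have h2 : fcl C k 𝒯 (W ∪ (fiberAt ρ p ∪ fiberAt ρ q)) = fcl C k 𝒯 W := by
      apply fcl_eq_of_subset Set.subset_union_left
      exact Set.union_subset (subset_fcl W) (Set.union_subset (hcl.trans (fcl_mono hqW'))
        (hqW'.trans (subset_fcl W)))
    obtain ⟨h3, h4⟩ := hN.of_fcl_eq h h1 (hN.big.isStrong.mono Set.subset_union_left) h2
    refine ⟨_, ?_, h3, h2, h4⟩
    intro x y hxy
    simp only [Set.mem_union, mem_fiberAt]
    have hx := hW x q
    have hy := hW y q
    have hxy' := hW x y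
    dsimp only at hxy
    split_ifs at hxy with c1 c2 c2
    · tauto
    · simp [c1, ← hxy]
    · simp [c2, hxy]
    · have := hxy' hxy
      rw [hxy]
      tauto
  by_cases hqW : q ∈ W
  · obtain ⟨Z, h1, h2, h3, -⟩ := key W hW hN hqW
    exact ⟨Z, h1, h2, h3⟩
  · obtain ⟨Z, h1, h2, h3, h4⟩ := key Wᶜ hW.compl hN.compl hqW
    rw [compl_compl] at h4
    exact ⟨Zᶜ, h1.compl, h2.compl, h4⟩

end RankFlowers

/-! ### A partition into three parts cut by a non-sequential separation. -/

section Trisections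

variable {E : Type u} [Finite E] {C : ConnectivitySystem E} {k : ℤ} {𝒯 : Set (Set E)}

/-- Uncrossing `S` with `U`, and then the result with `S₁ ∪ P`, shows that `S₁ ∪ (P ∩ U)` is
separating. Hence `S₁` absorbs the two small halves of `P` one after the other. -/
theorem subset_fcl_of_trisection (h : IsRobustTangle C k 𝒯) [Nonempty E] {U P S S₁ : Set E}
    (hU : NonSeq C k 𝒯 U) (hS : IsSeparating C k S) (hd : Disjoint P S)
    (hSU : IsBig 𝒯 (S ∩ U)) (hR : IsBig 𝒯 ((P ∪ S)ᶜ ∩ Uᶜ)) (hS₁ : S₁ ⊆ S) (hS₁b : IsBig 𝒯 S₁)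
    (hSP : IsSeparating C k (S₁ ∪ P)) (hP : IsSmall 𝒯 (P ∩ U)) (hP' : IsSmall 𝒯 (P ∩ Uᶜ)) :
    P ⊆ fcl C k 𝒯 S₁ := by
  have h1 : IsSeparating C k (S ∪ U) := h.separating_union hS hU.sep hSU.isStrong
    (hU.big_compl.isStrong.mono (Set.compl_subset_compl.2 Set.inter_subset_right))
  have h2 : IsSeparating C k ((S ∪ U) ∩ (S₁ ∪ P)) := by
    refine h.separating_inter h1 hSP (hSU.isStrong.mono ?_) (hR.isStrong.mono ?_)
    · exact Set.inter_subset_left.trans (Set.subset_union_left.trans Set.subset_union_left)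
    · rintro z ⟨hz1, hz2⟩
      have := @hS₁ z
      simp only [Set.mem_compl_iff, Set.mem_union] at *
      tauto
  have h3 : (S ∪ U) ∩ (S₁ ∪ P) = S₁ ∪ P ∩ U := by
    ext z
    have := @hS₁ z
    have := fun h0 : z ∈ P => Set.disjoint_left.1 hd h0
    simp only [Set.mem_union, Set.mem_inter_iff]
    tauto
  rw [h3] at h2
  have h4 := subset_fcl_of_separating h hS₁b.isStrong h2 hP
  have h5 : S₁ ∪ P ∩ U ⊆ fcl C k 𝒯 S₁ := Set.union_subset (subset_fcl _) h4
  have h6 : S₁ ∪ P ∩ U ∪ P ∩ Uᶜ = S₁ ∪ P := by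
    rw [Set.union_assoc, Set.inter_union_compl]
  have h7 := subset_fcl_of_separating h (hS₁b.isStrong.mono Set.subset_union_left)
    (by rw [h6]; exact hSP) hP'
  rw [← Set.inter_union_compl P U]
  exact Set.union_subset h4 (h7.trans (fcl_subset_fcl h5))

/-- Otherwise `(P ∪ S) ∩ U` is separating, and `Uᶜ` successively absorbs the three small parts of
`U`, which makes `U` sequential. -/
theorem not_isBig_of_trisection (h : IsRobustTangle C k 𝒯) [Nonempty E] {U P S : Set E}
    (hU : NonSeq C k 𝒯 U) (hPS : IsSeparating C k (P ∪ S)) (hPU : IsSeparating C k (P ∩ U))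
    (hP : IsSmall 𝒯 (P ∩ U)) (hS : IsSmall 𝒯 (S ∩ U)) (hR : IsSmall 𝒯 ((P ∪ S)ᶜ ∩ U)) :
    ¬ IsBig 𝒯 ((P ∪ S)ᶜ ∩ Uᶜ) := by
  intro hb
  have h1 : IsSeparating C k ((P ∪ S) ∩ U) := by
    refine h.separating_inter hPS hU.sep (hU.big.isStrong.mono Set.subset_union_right) ?_
    rw [Set.compl_union]
    exact hb.isStrong
  have h2 := h1.compl
  have h3 : ((P ∪ S) ∩ U)ᶜ = Uᶜ ∪ (P ∪ S)ᶜ ∩ U := by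
    ext z
    simp only [Set.mem_union, Set.mem_inter_iff, Set.mem_compl_iff]
    tauto
  rw [h3] at h2
  have h4 := subset_fcl_of_separating h hU.big_compl.isStrong h2 hR
  have h5 : Uᶜ ∪ (P ∪ S)ᶜ ∩ U ⊆ fcl C k 𝒯 Uᶜ := Set.union_subset (subset_fcl _) h4
  have h6 : IsSeparating C k (Uᶜ ∪ (P ∪ S)ᶜ ∩ U ∪ (S ∩ U) \ P) := by
    convert hPU.compl using 1
    ext z
    simp only [Set.mem_union, Set.mem_inter_iff, Set.mem_compl_iff, Set.mem_sdiff]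
    tauto
  have hst := hU.big_compl.isStrong.mono (Set.subset_union_left (t := (P ∪ S)ᶜ ∩ U))
  have h7 := subset_fcl_of_separating h hst h6 (hS.mono Set.sdiff_subset)
  have h8 := Set.union_subset h5 (h7.trans (fcl_subset_fcl h5))
  have h9 : Uᶜ ∪ (P ∪ S)ᶜ ∩ U ∪ (S ∩ U) \ P ∪ P ∩ U = Set.univ := by
    ext z
    simp only [Set.mem_union, Set.mem_inter_iff, Set.mem_compl_iff, Set.mem_sdiff, Set.mem_univ]
    tauto
  have h10 := subset_fcl_of_separating h (hst.mono Set.subset_union_left)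
    (by rw [h9]; exact hPU.univ) hP
  apply hU.fcl_compl_ne
  apply Set.eq_univ_of_univ_subset
  rw [← h9]
  exact Set.union_subset h8 (h10.trans (fcl_subset_fcl h8))

/-- Applying the previous lemma to `S` and to the third part in its place makes all six pieces
small, yet they cover `E`. -/
theorem false_of_trisection (h : IsRobustTangle C k 𝒯) [Nonempty E] {U P S : Set E}
    (hU : NonSeq C k 𝒯 U) (hPS : IsSeparating C k (P ∪ S)) (hSs : IsSeparating C k S)
    (hd : Disjoint P S) (hPU : IsSeparating C k (P ∩ U)) (hP : IsSmall 𝒯 (P ∩ U))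
    (hP' : IsSmall 𝒯 (P ∩ Uᶜ)) (hS : IsSmall 𝒯 (S ∩ U)) (hR : IsSmall 𝒯 ((P ∪ S)ᶜ ∩ U)) :
    False := by
  have h1 := not_not.1 (not_isBig_of_trisection h hU hPS hPU hP hS hR)
  have h2 : (P ∪ (P ∪ S)ᶜ)ᶜ = S := by
    ext z
    have := fun h0 : z ∈ P => Set.disjoint_left.1 hd h0
    simp only [Set.mem_union, Set.mem_compl_iff]
    tauto
  have h3 := not_isBig_of_trisection h hU (S := (P ∪ S)ᶜ)
    (by rw [← isSeparating_compl_iff, h2]; exact hSs) hPU hP hR (by rw [h2]; exact hS)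
  rw [h2] at h3
  have h3 := not_not.1 h3
  have e := isSmall_empty (𝒯 := 𝒯)
  obtain ⟨x, hx⟩ := h.exists_notMem h1 h3 hP hP' hS hR e e
  simp only [Set.mem_union, Set.mem_inter_iff, Set.mem_compl_iff] at hx
  tauto

end Trisections

/-! ### Separations that split as few petals as possible. -/

section Reduced

variable {E : Type u} [Finite E] {C : ConnectivitySystem E} {k : ℤ} {𝒯 : Set (Set E)}
  {ρ : E → ℕ} {F U : Set E}

/-- The union of the petals that meet both `U` and its complement. -/
def splitPoints (ρ : E → ℕ) (U : Set E) : Set E :=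
  {x | (fiberAt ρ x ∩ U).Nonempty ∧ (fiberAt ρ x ∩ Uᶜ).Nonempty}

/-- `F` is not split by `U`. -/
def Respects (F U : Set E) : Prop := ∀ x ∈ F, ∀ y ∈ F, x ∈ U → y ∈ U

theorem Respects.compl (h : Respects F U) : Respects F Uᶜ :=
  fun x hx y hy hxU hyU => hxU (h y hy x hx hyU)

theorem splitPoints_compl : splitPoints ρ Uᶜ = splitPoints ρ U := by
  ext x
  simp only [splitPoints, compl_compl, Set.mem_ofPred_eq]
  exact and_comm

/-- A non-sequential set that splits as few petals as possible among the equivalent sets that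
respect `F`. -/
structure Reduced (C : ConnectivitySystem E) (k : ℤ) (𝒯 : Set (Set E)) (ρ : E → ℕ) (F U : Set E) :
    Prop where
  nonSeq : NonSeq C k 𝒯 U
  respects : Respects F U
  minimal : ∀ W, NonSeq C k 𝒯 W → Respects F W → fcl C k 𝒯 W = fcl C k 𝒯 U →
    (splitPoints ρ U).ncard ≤ (splitPoints ρ W).ncard

theorem NonSeq.exists_reduced (hU : NonSeq C k 𝒯 U) (hF : Respects F U) (ρ : E → ℕ) :
    ∃ W, Reduced C k 𝒯 ρ F W ∧ fcl C k 𝒯 W = fcl C k 𝒯 U := by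
  obtain ⟨W, ⟨h1, h2, h3⟩, hmin⟩ := Set.exists_min_image
    {W | NonSeq C k 𝒯 W ∧ Respects F W ∧ fcl C k 𝒯 W = fcl C k 𝒯 U}
    (fun W => (splitPoints ρ W).ncard) (Set.toFinite _) ⟨U, hU, hF, rfl⟩
  exact ⟨W, ⟨h1, h2, fun Z hZ hZF he => hmin Z ⟨hZ, hZF, he.trans h3⟩⟩, h3⟩

theorem Reduced.compl (h : IsRobustTangle C k 𝒯) [Nonempty E] (hU : Reduced C k 𝒯 ρ F U) :
    Reduced C k 𝒯 ρ F Uᶜ := by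
  refine ⟨hU.nonSeq.compl, hU.respects.compl, fun W hW hWF he => ?_⟩
  obtain ⟨h1, h2⟩ := hU.nonSeq.compl.of_fcl_eq h hW.sep hW.big.isStrong he
  rw [compl_compl] at h2
  have := hU.minimal Wᶜ hW.compl hWF.compl h2
  rwa [splitPoints_compl] at this ⊢

theorem Reduced.congr {σ : E → ℕ} (hU : Reduced C k 𝒯 ρ F U)
    (hσ : fiberAt σ = fiberAt ρ) : Reduced C k 𝒯 σ F U := by
  have : splitPoints σ = splitPoints ρ := by
    unfold splitPoints
    rw [hσ]
  refine ⟨hU.nonSeq, hU.respects, ?_⟩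
  rw [this]
  exact hU.minimal

/-- Otherwise `U ∪ W` would be an equivalent set that splits no petal in `W` and no new petal
elsewhere, contrary to minimality. -/
theorem Reduced.not_separating (h : IsRobustTangle C k 𝒯) [Nonempty E]
    (hU : Reduced C k 𝒯 ρ F U) (hF : ∀ x ∈ F, ∀ y ∈ F, ρ x = ρ y) {W : Set E}
    (hW : Saturated ρ W) (hs : IsSmall 𝒯 (W ∩ Uᶜ)) {x : E} (hx : x ∈ W)
    (hxs : x ∈ splitPoints ρ U) : ¬ IsSeparating C k (U ∪ W) := by
  intro hsep
  have h1 := hU.nonSeq.union_small h hsep hs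
  obtain ⟨h2, -⟩ := hU.nonSeq.of_fcl_eq h hsep
    (hU.nonSeq.big.isStrong.mono Set.subset_union_left) h1
  have h3 : Respects F (U ∪ W) := by
    rintro y hy z hz (h0 | h0)
    · exact Or.inl (hU.respects y hy z hz h0)
    · exact Or.inr ((hW y z (hF y hy z hz)).1 h0)
  have h4 := hU.minimal _ h2 h3 h1
  refine absurd h4 (not_le.2 (Set.ncard_lt_ncard ?_ (Set.toFinite _)))
  refine ⟨?_, fun h5 => ?_⟩
  · rintro y ⟨⟨z, hz1, hz2⟩, w, hw1, hw2⟩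
    have hw3 : w ∉ W := fun h0 => hw2 (Or.inr h0)
    have hz3 : z ∉ W := fun h0 => hw3 ((hW z w (hz1.trans hw1.symm)).1 h0)
    exact ⟨⟨z, hz1, hz2.resolve_right hz3⟩, w, hw1, fun h0 => hw2 (Or.inl h0)⟩
  · obtain ⟨-, w, hw1, hw2⟩ := h5 hxs
    exact hw2 (Or.inr ((hW w x hw1).2 hx))

/-- Since the union has connectivity above `k`, submodularity bounds the intersection even though it
may be weak, where ordinary uncrossing says nothing. -/
theorem Reduced.separating_inter (h : IsRobustTangle C k 𝒯) [Nonempty E]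
    (hU : Reduced C k 𝒯 ρ F U) (hF : ∀ x ∈ F, ∀ y ∈ F, ρ x = ρ y) {W : Set E}
    (hW : Saturated ρ W) (hWs : IsSeparating C k W) (hs : IsSmall 𝒯 (W ∩ Uᶜ)) {x : E} (hx : x ∈ W)
    (hxs : x ∈ splitPoints ρ U) : IsSeparating C k (W ∩ U) := by
  have h1 := hU.not_separating h hF hW hs hx hxs
  have h2 := hU.nonSeq.sep
  have h3 := C.submodular U W
  rw [Set.inter_comm W U]
  unfold IsSeparating at *
  omega

theorem Reduced.isBig_of_mem_splitPoints (h : IsRobustTangle C k 𝒯) [Nonempty E]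
    (hρ : RankFlower C k 𝒯 ρ) (hU : Reduced C k 𝒯 ρ F U) (hF : ∀ x ∈ F, ∀ y ∈ F, ρ x = ρ y) {x : E}
    (hxs : x ∈ splitPoints ρ U) (hb : IsBig 𝒯 (fiberAt ρ x ∩ U)) :
    IsBig 𝒯 (fiberAt ρ x ∩ Uᶜ) := by
  intro hs
  refine hU.not_separating h hF (saturated_fiberAt x) hs (mem_fiberAt_self x) hxs ?_
  rw [Set.union_comm]
  exact h.separating_union (hρ.separating_fiberAt x) hU.nonSeq.sep hb.isStrong
    (hU.nonSeq.big_compl.isStrong.mono (Set.compl_subset_compl.2 Set.inter_subset_right))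

/-- No petal is contained in the full closure of another one with which it has separating union. -/
def Tight (C : ConnectivitySystem E) (k : ℤ) (𝒯 : Set (Set E)) (ρ : E → ℕ) : Prop :=
  ∀ p q, ρ p ≠ ρ q → IsSeparating C k (fiberAt ρ p ∪ fiberAt ρ q) →
    ¬ fiberAt ρ p ⊆ fcl C k 𝒯 (fiberAt ρ q)

theorem Tight.congr {σ : E → ℕ} (ht : Tight C k 𝒯 ρ) (hσ : fiberAt σ = fiberAt ρ) :
    Tight C k 𝒯 σ := by
  intro p q hpq
  rw [hσ]
  refine ht p q fun h0 => hpq ?_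
  rw [← mem_fiberAt, hσ]
  exact h0

/-- Cut the cycle into the first petal, the petals up to `c`, and the rest. Big halves in opposite
corners of the last two blocks would put the first petal into the closure of its neighbour, against
tightness. The one remaining configuration is excluded by `false_of_trisection`. -/
theorem Tight.isSmall_of_isBig (ht : Tight C k 𝒯 ρ) (h : IsRobustTangle C k 𝒯) [Nonempty E]
    (hρ : RankFlower C k 𝒯 ρ) (hU : NonSeq C k 𝒯 U) {x c : E} (hx : ρ x = 0) (hc : ρ c ≠ 0)
    (hs : IsSmall 𝒯 (fiberAt ρ x ∩ U)) (hs' : IsSmall 𝒯 (fiberAt ρ x ∩ Uᶜ))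
    (hsep : IsSeparating C k (fiberAt ρ x ∩ Uᶜ))
    (hb : IsBig 𝒯 ({y | 1 ≤ ρ y ∧ ρ y ≤ ρ c} ∩ U)) :
    IsSmall 𝒯 ({y | ρ c < ρ y} ∩ U) ∧ IsSmall 𝒯 ({y | ρ c < ρ y} ∩ Uᶜ) := by
  obtain ⟨p, hp, hpmin⟩ := Set.exists_min_image {y | ρ y ≠ 0} ρ (Set.toFinite _) ⟨c, hc⟩
  have hpc : ρ p ≤ ρ c := hpmin c hc
  simp only [Set.mem_ofPred_eq] at hp hpmin
  have hd : Disjoint (fiberAt ρ x) {y | 1 ≤ ρ y ∧ ρ y ≤ ρ c} := by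
    rw [Set.disjoint_left]
    intro y hy
    simp only [mem_fiberAt, Set.mem_ofPred_eq] at *
    omega
  have hR : (fiberAt ρ x ∪ {y | 1 ≤ ρ y ∧ ρ y ≤ ρ c})ᶜ = {y | ρ c < ρ y} := by
    ext y
    simp only [mem_fiberAt, Set.mem_ofPred_eq, Set.mem_compl_iff, Set.mem_union]
    omega
  have hp1 : fiberAt ρ p ⊆ {y | 1 ≤ ρ y ∧ ρ y ≤ ρ c} := by
    intro y hy
    simp only [mem_fiberAt, Set.mem_ofPred_eq] at *
    omega
  have hp2 : IsSeparating C k (fiberAt ρ p ∪ fiberAt ρ x) := by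
    convert hρ.sep 0 (ρ p) using 1
    ext y
    have := hpmin y
    simp only [mem_fiberAt, Set.mem_ofPred_eq, Set.mem_union]
    omega
  have hnot := ht x p (by omega) (by rw [Set.union_comm]; exact hp2)
  have h1 : IsSmall 𝒯 ({y | ρ c < ρ y} ∩ Uᶜ) := by
    by_contra hcon
    exact hnot (subset_fcl_of_trisection h hU (hρ.sep 1 (ρ c)) hd hb (by rw [hR]; exact hcon) hp1
      (hρ.big p) hp2 hs hs')
  refine ⟨?_, h1⟩
  by_contra hcon
  have h2 : IsSmall 𝒯 ({y | 1 ≤ ρ y ∧ ρ y ≤ ρ c} ∩ Uᶜ) := by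
    by_contra hcon'
    exact hnot (subset_fcl_of_trisection h hU.compl (hρ.sep 1 (ρ c)) hd hcon'
      (by rw [hR, compl_compl]; exact hcon) hp1 (hρ.big p) hp2 hs' (by rwa [compl_compl]))
  refine false_of_trisection h hU.compl (P := fiberAt ρ x) (S := {y | 1 ≤ ρ y ∧ ρ y ≤ ρ c}) ?_
    (hρ.sep _ _) hd hsep hs' (by rwa [compl_compl]) h2 (by rwa [hR])
  rw [← isSeparating_compl_iff, hR, ← isSeparating_compl_iff]
  convert hρ.sep 0 (ρ c) using 1
  ext y
  simp only [Set.mem_ofPred_eq, Set.mem_compl_iff]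
  omega

/-- Walk around the flower from `x` until the union of the petals passed first acquires a big half.
The last petal reached is the centre: everything before it is small by choice, and everything after
it by `Tight.isSmall_of_isBig`. -/
theorem Reduced.exists_center (h : IsRobustTangle C k 𝒯) [Nonempty E] (hρ : RankFlower C k 𝒯 ρ)
    (ht : Tight C k 𝒯 ρ) (hU : Reduced C k 𝒯 ρ F U) (hF : ∀ x ∈ F, ∀ y ∈ F, ρ x = ρ y) {x : E}
    (hx : x ∈ splitPoints ρ U) (hs : IsSmall 𝒯 (fiberAt ρ x ∩ U))
    (hs' : IsSmall 𝒯 (fiberAt ρ x ∩ Uᶜ)) :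
    ∃ c, IsBig 𝒯 (fiberAt ρ c ∩ U) ∧ IsBig 𝒯 (fiberAt ρ c ∩ Uᶜ) ∧
      ∀ y, ρ y ≠ ρ c → IsSmall 𝒯 (fiberAt ρ y ∩ U) ∧ IsSmall 𝒯 (fiberAt ρ y ∩ Uᶜ) := by
  obtain ⟨σ, hσ, hker, hx0⟩ := hρ.exists_rotate x
  have hfib : fiberAt σ = fiberAt ρ := by
    ext y z
    exact hker z y
  simp only [Ne, ← hker]
  replace hF : ∀ x ∈ F, ∀ y ∈ F, σ x = σ y := fun x hx y hy => (hker x y).2 (hF x hx y hy)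
  replace hU := hU.congr hfib
  replace ht := ht.congr hfib
  have hx : x ∈ splitPoints σ U := by
    unfold splitPoints
    rwa [hfib]
  rw [← hfib] at hs hs' ⊢
  clear hfib hker hρ
  have e := isSmall_empty (𝒯 := 𝒯)
  have hUc := hU.compl h
  have hxc : x ∈ splitPoints σ Uᶜ := by rwa [splitPoints_compl]
  have hsep : IsSeparating C k (fiberAt σ x ∩ U) := hU.separating_inter h hF
    (saturated_fiberAt x) (hσ.separating_fiberAt x) hs' (mem_fiberAt_self x) hx
  have hsep' : IsSeparating C k (fiberAt σ x ∩ Uᶜ) := hUc.separating_inter h hF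
    (saturated_fiberAt x) (hσ.separating_fiberAt x) (by rwa [compl_compl]) (mem_fiberAt_self x) hxc
  let bad : ℕ → Prop := fun t => IsSmall 𝒯 ({y | 1 ≤ σ y ∧ σ y ≤ t} ∩ U) ∧
    IsSmall 𝒯 ({y | 1 ≤ σ y ∧ σ y ≤ t} ∩ Uᶜ)
  have hbad : ∃ t, ¬ bad t := by
    obtain ⟨N, hN⟩ := (Set.finite_range σ).bddAbove
    refine ⟨N, fun hb => ?_⟩
    obtain ⟨z, hz⟩ := h.exists_notMem hs hs' hb.1 hb.2 e e e e
    have hzN : σ z ≤ N := hN ⟨z, rfl⟩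
    simp only [Set.mem_inter_iff, mem_fiberAt, Set.mem_ofPred_eq, Set.mem_compl_iff, hx0] at hz
    by_cases hzU : z ∈ U <;> simp only [hzU, and_true, and_false, not_true_eq_false,
      not_false_eq_true, true_and] at hz <;> omega
  classical
  obtain ⟨t, htb, hmin⟩ : ∃ t, ¬ bad t ∧ ∀ s < t, bad s :=
    ⟨Nat.find hbad, Nat.find_spec hbad, fun s hs => not_not.1 (Nat.find_min hbad hs)⟩
  have ht0 : t ≠ 0 := by
    rintro rfl
    apply htb
    have : {y | 1 ≤ σ y ∧ σ y ≤ 0} = ∅ := by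
      ext y
      simp only [Set.mem_ofPred_eq, Set.mem_empty_iff_false, iff_false]
      omega
    simp only [bad, this, Set.empty_inter]
    exact ⟨e, e⟩
  have hb1 := hmin (t - 1) (by omega)
  obtain ⟨c, rfl⟩ : ∃ c, σ c = t := by
    by_contra hcon
    push Not at hcon
    apply htb
    have : {y | 1 ≤ σ y ∧ σ y ≤ t} = {y | 1 ≤ σ y ∧ σ y ≤ t - 1} := by
      ext y
      have := hcon y
      simp only [Set.mem_ofPred_eq]
      omega
    simp only [bad, this]
    exact hb1
  have hR : IsSmall 𝒯 ({y | σ c < σ y} ∩ U) ∧ IsSmall 𝒯 ({y | σ c < σ y} ∩ Uᶜ) := by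
    by_cases hbU : IsBig 𝒯 ({y | 1 ≤ σ y ∧ σ y ≤ σ c} ∩ U)
    · exact ht.isSmall_of_isBig h hσ hU.nonSeq hx0 ht0 hs hs' hsep' hbU
    · have hbU' : IsBig 𝒯 ({y | 1 ≤ σ y ∧ σ y ≤ σ c} ∩ Uᶜ) := fun h0 => htb ⟨not_not.1 hbU, h0⟩
      have := ht.isSmall_of_isBig h hσ hUc.nonSeq hx0 ht0 hs' (by rwa [compl_compl])
        (by rwa [compl_compl]) hbU'
      rw [compl_compl] at this
      exact this.symm
  have key : ∀ V, Reduced C k 𝒯 σ F V → IsSeparating C k (fiberAt σ x ∩ Vᶜ) →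
      IsSmall 𝒯 (fiberAt σ x ∩ V) → IsSmall 𝒯 (fiberAt σ x ∩ Vᶜ) →
      IsSmall 𝒯 ({y | 1 ≤ σ y ∧ σ y ≤ σ c - 1} ∩ Vᶜ) → IsSmall 𝒯 ({y | σ c < σ y} ∩ Vᶜ) →
      IsBig 𝒯 (fiberAt σ c ∩ V) → IsBig 𝒯 (fiberAt σ c ∩ Vᶜ) := by
    intro V hV hVs hV1 hV2 hV3 hV4 hV5
    by_cases hcs : c ∈ splitPoints σ V
    · exact hV.isBig_of_mem_splitPoints h hσ hF hcs hV5
    exfalso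
    have hem : ∀ y, σ y = σ c → y ∈ V := by
      intro y hy
      by_contra hyV
      exact hcs ⟨hV5.nonempty, y, hy, hyV⟩
    -- If the petal at `c` lies inside `V`, then all three blocks meet `Vᶜ` in small sets.
    refine false_of_trisection h hV.nonSeq.compl (P := fiberAt σ x)
      (S := {y | 1 ≤ σ y ∧ σ y ≤ σ c}) ?_ (hσ.sep _ _) ?_ hVs hV2 (by rwa [compl_compl])
      (hV3.mono ?_) (hV4.mono ?_)
    · convert hσ.sep 0 (σ c) using 1
      ext y
      simp only [mem_fiberAt, Set.mem_union, Set.mem_ofPred_eq]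
      omega
    · rw [Set.disjoint_left]
      intro y hy
      simp only [mem_fiberAt, Set.mem_ofPred_eq] at *
      omega
    · rintro y ⟨⟨hy1, hy2⟩, hy3⟩
      have : σ y ≠ σ c := fun h0 => hy3 (hem y h0)
      exact ⟨⟨hy1, by omega⟩, hy3⟩
    · rintro y ⟨hy1, hy3⟩
      refine ⟨?_, hy3⟩
      simp only [mem_fiberAt, Set.mem_compl_iff, Set.mem_union, Set.mem_ofPred_eq] at *
      omega
  have hor : IsBig 𝒯 (fiberAt σ c ∩ U) ∨ IsBig 𝒯 (fiberAt σ c ∩ Uᶜ) := by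
    by_contra hcon
    rw [not_or] at hcon
    -- Two halves of four blocks: the petal at `x`, the petals between it and `c`, the petals after
    -- `c`, and the petal at `c`. This uses all eight sets in the robustness axiom.
    obtain ⟨z, hz⟩ := h.exists_notMem hs hs' hb1.1 hb1.2 hR.1 hR.2 (not_not.1 hcon.1)
      (not_not.1 hcon.2)
    simp only [Set.mem_inter_iff, mem_fiberAt, Set.mem_ofPred_eq, Set.mem_compl_iff, hx0] at hz
    by_cases hzU : z ∈ U <;> simp only [hzU, and_true, and_false, not_true_eq_false,
      not_false_eq_true, true_and] at hz <;> omega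
  have hand : IsBig 𝒯 (fiberAt σ c ∩ U) ∧ IsBig 𝒯 (fiberAt σ c ∩ Uᶜ) := by
    rcases hor with h0 | h0
    · exact ⟨h0, key U hU hsep' hs hs' hb1.2 hR.2 h0⟩
    · have := key Uᶜ hUc (by rwa [compl_compl]) hs' (by rwa [compl_compl])
        (by rw [compl_compl]; exact hb1.1) (by rw [compl_compl]; exact hR.1) h0
      rw [compl_compl] at this
      exact ⟨this, h0⟩
  refine ⟨c, hand.1, hand.2, fun y hy => ?_⟩
  have hcase : fiberAt σ y ⊆ fiberAt σ x ∨ fiberAt σ y ⊆ {y | 1 ≤ σ y ∧ σ y ≤ σ c - 1} ∨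
      fiberAt σ y ⊆ {y | σ c < σ y} := by
    rcases Nat.lt_or_gt_of_ne hy with h0 | h0
    · by_cases h1 : σ y = 0
      · left
        intro z hz
        simp only [mem_fiberAt] at *
        omega
      · right
        left
        intro z hz
        simp only [mem_fiberAt, Set.mem_ofPred_eq] at *
        omega
    · right
      right
      intro z hz
      simp only [mem_fiberAt, Set.mem_ofPred_eq] at *
      omega
  rcases hcase with h0 | h0 | h0
  · exact ⟨hs.mono (Set.inter_subset_inter_left _ h0), hs'.mono (Set.inter_subset_inter_left _ h0)⟩
  · exact ⟨hb1.1.mono (Set.inter_subset_inter_left _ h0),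
      hb1.2.mono (Set.inter_subset_inter_left _ h0)⟩
  · exact ⟨hR.1.mono (Set.inter_subset_inter_left _ h0),
      hR.2.mono (Set.inter_subset_inter_left _ h0)⟩

/-- A non-sequential union of petals that are split into two small parts contradicts reducedness. -/
theorem Reduced.false_of_isSmall (h : IsRobustTangle C k 𝒯) [Nonempty E]
    (hU : Reduced C k 𝒯 ρ F U) (hF : ∀ x ∈ F, ∀ y ∈ F, ρ x = ρ y) {W : Set E}
    (hW : Saturated ρ W) (hWN : NonSeq C k 𝒯 W) (hs : IsSmall 𝒯 (W ∩ U))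
    (hs' : IsSmall 𝒯 (W ∩ Uᶜ)) {x : E} (hx : x ∈ W) (hxs : x ∈ splitPoints ρ U) : False := by
  have h1 := (hU.compl h).separating_inter h hF hW hWN.sep (by rwa [compl_compl]) hx
    (by rwa [splitPoints_compl])
  have h3 : Wᶜ ∪ W ∩ U = (W ∩ Uᶜ)ᶜ := by
    ext z
    simp only [Set.mem_union, Set.mem_inter_iff, Set.mem_compl_iff]
    tauto
  -- The complement of `W` absorbs `W ∩ U`, and then the rest of `W`, so `W` would be sequential.
  have h4 := subset_fcl_of_separating h hWN.big_compl.isStrong (by rw [h3]; exact h1.compl) hs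
  have h5 : (W ∩ Uᶜ)ᶜ ⊆ fcl C k 𝒯 Wᶜ := by
    rw [← h3]
    exact Set.union_subset (subset_fcl _) h4
  have h6 : W ∩ Uᶜ ⊆ fcl C k 𝒯 (W ∩ Uᶜ)ᶜ := by
    refine subset_fcl_of_separating h (hWN.big_compl.isStrong.mono ?_) ?_ hs'
    · exact Set.compl_subset_compl.2 Set.inter_subset_left
    · rw [Set.compl_union_self]
      exact h1.univ
  apply hWN.fcl_compl_ne
  apply Set.eq_univ_of_univ_subset
  rw [← Set.compl_union_self (W ∩ Uᶜ)]
  exact Set.union_subset h5 (h6.trans (fcl_subset_fcl h5))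

/-- A petal cut into two small parts yields a centre `c`. Some non-sequential union `W` of petals
avoids `c` and a further petal compatible with `c`. Tightness of that pair forces both halves of `W`
to be small, which `Reduced.false_of_isSmall` forbids. -/
theorem Reduced.not_isSmall (h : IsRobustTangle C k 𝒯) [Nonempty E] (hρ : RankFlower C k 𝒯 ρ)
    (ht : Tight C k 𝒯 ρ) (hU : Reduced C k 𝒯 ρ F U) (hF : ∀ x ∈ F, ∀ y ∈ F, ρ x = ρ y)
    {W₁ W₂ : Set E} (hW₁ : Saturated ρ W₁) (hN₁ : NonSeq C k 𝒯 W₁) (hW₂ : Saturated ρ W₂)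
    (hN₂ : NonSeq C k 𝒯 W₂) (hne : ¬ SepEquiv C k 𝒯 W₁ W₂) {x : E} (hx : x ∈ splitPoints ρ U)
    (hs : IsSmall 𝒯 (fiberAt ρ x ∩ U)) : ¬ IsSmall 𝒯 (fiberAt ρ x ∩ Uᶜ) := by
  intro hs'
  obtain ⟨c, hc1, hc2, hsmall⟩ := hU.exists_center h hρ ht hF hx hs hs'
  -- If there were no such `W`, the central petal would be a side of every displayed non-sequential
  -- separation, so `W₁` and `W₂` would be equivalent.
  obtain ⟨W, hW, hWN, hcW, z, hzW, hzc⟩ : ∃ W, Saturated ρ W ∧ NonSeq C k 𝒯 W ∧ c ∉ W ∧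
      ∃ z ∉ W, ρ z ≠ ρ c := by
    by_contra hcon
    push Not at hcon
    have key : ∀ W, Saturated ρ W → NonSeq C k 𝒯 W → c ∉ W → Wᶜ = fiberAt ρ c := by
      intro W hW hWN hcW
      apply Set.Subset.antisymm
      · intro z hz
        exact hcon W hW hWN hcW z hz
      · exact hW.compl.fiberAt_subset hcW
    have key' : ∀ W, Saturated ρ W → NonSeq C k 𝒯 W → W = fiberAt ρ c ∨ Wᶜ = fiberAt ρ c := by
      intro W hW hWN
      by_cases hcW : c ∈ W
      · left
        have := key Wᶜ hW.compl hWN.compl (fun h0 => h0 hcW)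
        rwa [compl_compl] at this
      · exact Or.inr (key W hW hWN hcW)
    apply hne
    have hr : SepEquiv C k 𝒯 W₁ W₁ := ⟨hN₁.isStrongSeparation, hN₁.isStrongSeparation, rfl⟩
    rcases key' W₁ hW₁ hN₁ with h1 | h1 <;> rcases key' W₂ hW₂ hN₂ with h2 | h2
    · rwa [h2, ← h1]
    · have : W₂ = W₁ᶜ := by rw [h1, ← h2, compl_compl]
      rw [this]
      exact hr.compl_right
    · rw [h2, ← h1]
      exact hr.compl_right
    · have : W₂ = W₁ := by rw [← compl_compl W₂, h2, ← h1, compl_compl]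
      rwa [this]
  obtain ⟨y, hyW, hyc, hsep⟩ := hρ.exists_neighbour h hWN.sep.compl hW.compl hcW hzW hzc
  obtain ⟨hy1, hy2⟩ := hsmall y hyc
  have hd : Disjoint (fiberAt ρ y) (fiberAt ρ c) := by
    rw [Set.disjoint_left]
    intro z hz
    rw [mem_fiberAt] at *
    omega
  have hnot := ht y c hyc (by rw [Set.union_comm]; exact hsep)
  have hr1 : IsSmall 𝒯 ((fiberAt ρ y ∪ fiberAt ρ c)ᶜ ∩ Uᶜ) := by
    by_contra hcon
    exact hnot (subset_fcl_of_trisection h hU.nonSeq (hρ.separating_fiberAt c) hd hc1 hcon le_rfl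
      (hρ.big c) hsep hy1 hy2)
  have hr2 : IsSmall 𝒯 ((fiberAt ρ y ∪ fiberAt ρ c)ᶜ ∩ U) := by
    by_contra hcon
    exact hnot (subset_fcl_of_trisection h hU.nonSeq.compl (hρ.separating_fiberAt c) hd hc2
      (by rwa [compl_compl]) le_rfl (hρ.big c) hsep hy2 (by rwa [compl_compl]))
  have hsub : W ⊆ (fiberAt ρ y ∪ fiberAt ρ c)ᶜ := by
    rintro z hz (h0 | h0)
    · exact hyW ((hW z y h0).1 hz)
    · exact hcW ((hW z c h0).1 hz)
  obtain ⟨w, hw⟩ := hWN.big.nonempty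
  have hwc : ρ w ≠ ρ c := fun h0 => hcW ((hW w c h0).1 hw)
  obtain ⟨hw1, hw2⟩ := hsmall w hwc
  -- The petal of `w` is big while both of its halves are small, so neither half is empty.
  have hws : w ∈ splitPoints ρ U := by
    constructor
    · by_contra h0
      rw [Set.not_nonempty_iff_eq_empty, ← Set.disjoint_iff_inter_eq_empty,
        ← Set.subset_compl_iff_disjoint_right] at h0
      rw [Set.inter_eq_left.2 h0] at hw2
      exact hρ.big w hw2
    · by_contra h0
      rw [Set.not_nonempty_iff_eq_empty, ← Set.disjoint_iff_inter_eq_empty,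
        ← Set.subset_compl_iff_disjoint_right, compl_compl] at h0
      rw [Set.inter_eq_left.2 h0] at hw1
      exact hρ.big w hw1
  exact hU.false_of_isSmall h hF hW hWN (hr2.mono (Set.inter_subset_inter_left _ hsub))
    (hr1.mono (Set.inter_subset_inter_left _ hsub)) hw hws

end Reduced

/-! ### Cutting the petals of a flower along a separation. -/

section Refinement

variable {E : Type u} [Finite E] {C : ConnectivitySystem E} {k : ℤ} {𝒯 : Set (Set E)}
  {ρ : E → ℕ} {F U : Set E}

/-- The petals of `ρ`, cut by `U`. -/
def cutBy (ρ : E → ℕ) (U : Set E) : E → ℕ × Prop := fun x => (ρ x, x ∈ U)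

theorem cutBy_eq_iff {x y : E} : cutBy ρ U x = cutBy ρ U y ↔ ρ x = ρ y ∧ (x ∈ U ↔ y ∈ U) := by
  simp [cutBy]

theorem saturated_cutBy : Saturated (cutBy ρ U) U := fun _ _ hxy => (cutBy_eq_iff.1 hxy).2

theorem Saturated.cutBy {W : Set E} (hW : Saturated ρ W) : Saturated (cutBy ρ U) W :=
  hW.congr fun _ _ hxy => (cutBy_eq_iff.1 hxy).1

theorem bigFibers_cutBy_compl (hb : BigFibers 𝒯 (cutBy ρ U)) : BigFibers 𝒯 (cutBy ρ Uᶜ) := by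
  intro x
  convert hb x using 1
  ext y
  rw [mem_fiberAt, mem_fiberAt, cutBy_eq_iff, cutBy_eq_iff, Set.mem_compl_iff, Set.mem_compl_iff,
    not_iff_not]

/-- `σ` arises from `ρ` by splitting petals along `U`. -/
structure Refines (σ ρ : E → ℕ) (U : Set E) : Prop where
  eq_of_eq : ∀ x y, σ x = σ y → ρ x = ρ y
  eq_of_cutBy : ∀ x y, ρ x = ρ y → (x ∈ U ↔ y ∈ U) → σ x = σ y

theorem Refines.compl {σ : E → ℕ} (h : Refines σ ρ U) : Refines σ ρ Uᶜ :=
  ⟨h.eq_of_eq, fun x y hxy hU => h.eq_of_cutBy x y hxy (not_iff_not.1 hU)⟩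

theorem Refines.trans {σ τ : E → ℕ} (h : Refines σ ρ U) (h' : Refines τ σ U) : Refines τ ρ U :=
  ⟨fun x y hxy => h.eq_of_eq x y (h'.eq_of_eq x y hxy),
    fun x y hxy hU => h'.eq_of_cutBy x y (h.eq_of_cutBy x y hxy hU) hU⟩

theorem Refines.bigFibers {σ : E → ℕ} (h : Refines σ ρ U) (hb : BigFibers 𝒯 (cutBy ρ U)) :
    BigFibers 𝒯 (cutBy σ U) := by
  intro x
  refine (hb x).mono fun y hy => ?_
  rw [mem_fiberAt, cutBy_eq_iff] at *
  exact ⟨h.eq_of_cutBy y x hy.1 hy.2, hy.2⟩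

/-- The `U`-half of the first petal goes on the side of the last petal, which meets `U`, and the
other half on the side of the next petal, which meets `Uᶜ`. With this arrangement uncrossing with
`U` makes every new interval separating. -/
theorem RankFlower.split_first (hρ : RankFlower C k 𝒯 ρ) (h : IsRobustTangle C k 𝒯)
    (hU : IsSeparating C k U) (hb : BigFibers 𝒯 (cutBy ρ U)) {p r l : E} (hp : ρ p = 0)
    (hr : r ∉ U) (hr0 : 0 < ρ r) (hrmin : ∀ x, 0 < ρ x → ρ r ≤ ρ x) (hl : l ∈ U) (hl0 : 0 < ρ l)
    (hlmax : ∀ x, ρ x ≤ ρ l) :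
    ∃ σ, RankFlower C k 𝒯 σ ∧ Refines σ ρ U ∧
      ∀ x y, σ x = σ y → ρ x = ρ p → (x ∈ U ↔ y ∈ U) := by
  classical
  obtain ⟨σ, hσ, hσ1, hσ2⟩ : ∃ σ : E → ℕ,
      (∀ x, (ρ x = 0 ∧ σ x ≤ 1) ∨ (ρ x ≠ 0 ∧ σ x = ρ x + 1)) ∧
      (∀ x, x ∈ U → (ρ x = 0 → σ x = 0)) ∧ (∀ x, x ∉ U → (ρ x = 0 → σ x = 1)) := by
    refine ⟨fun x => if ρ x = 0 then (if x ∈ U then 0 else 1) else ρ x + 1, fun x => ?_,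
      fun x hx h0 => ?_, fun x hx h0 => ?_⟩
    · dsimp only
      split_ifs <;> simp_all
    · simp [h0, hx]
    · simp [h0, hx]
  have href : Refines σ ρ U := by
    constructor
    · intro x y hxy
      have := hσ x
      have := hσ y
      omega
    · intro x y hxy hUxy
      have := hσ x
      have := hσ y
      by_cases hx : x ∈ U
      · have := hσ1 x hx
        have := hσ1 y (hUxy.1 hx)
        omega
      · have := hσ2 x hx
        have := hσ2 y fun h0 => hx (hUxy.2 h0)
        omega
  have hPs := hρ.separating_fiberAt p
  have hPsat := (saturated_fiberAt (τ := ρ) p).cutBy (U := U)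
  have hUsat := saturated_cutBy (ρ := ρ) (U := U)
  refine ⟨σ, ⟨fun x => (hb x).mono fun y hy => ?_, fun i j => ?_⟩, href, ?_⟩
  · rw [mem_fiberAt, cutBy_eq_iff] at hy
    exact href.eq_of_cutBy y x hy.1 hy.2
  · have hPU : IsSeparating C k (fiberAt ρ p ∩ U) :=
      hb.separating_inter h hPs hU hPsat hUsat (z := r) (by rw [mem_fiberAt]; omega) hr
    have hPU' : IsSeparating C k (fiberAt ρ p ∩ Uᶜ) :=
      hb.separating_inter h hPs hU.compl hPsat hUsat.compl (z := l) (by rw [mem_fiberAt]; omega)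
        (fun h0 => h0 hl)
    by_cases hi2 : 2 ≤ i
    · convert hρ.sep (i - 1) (j - 1) using 1
      ext y
      have := hσ y
      simp only [Set.mem_ofPred_eq]
      omega
    by_cases hi0 : i = 0
    · by_cases hj0 : j = 0
      · convert hPU using 1
        ext y
        have := hσ y
        simp only [Set.mem_ofPred_eq, Set.mem_inter_iff, mem_fiberAt]
        by_cases hy : y ∈ U
        · have := hσ1 y hy
          simp only [hy, and_true]
          omega
        · have := hσ2 y hy
          simp only [hy, and_false, iff_false]
          omega
      · convert hρ.sep 0 (j - 1) using 1
        ext y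
        have := hσ y
        simp only [Set.mem_ofPred_eq]
        omega
    have hi1 : i = 1 := by omega
    subst hi1
    by_cases hj0 : j = 0
    · convert hPs.empty using 1
      ext y
      simp only [Set.mem_ofPred_eq, Set.mem_empty_iff_false, iff_false]
      omega
    by_cases hjr : j - 1 < ρ r
    · convert hPU' using 1
      ext y
      have := hσ y
      have := hrmin y
      simp only [Set.mem_ofPred_eq, Set.mem_inter_iff, mem_fiberAt, Set.mem_compl_iff]
      by_cases hy : y ∈ U
      · have := hσ1 y hy
        simp only [hy, not_true_eq_false, and_false, iff_false]
        omega
      · have := hσ2 y hy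
        simp only [hy, not_false_eq_true, and_true]
        omega
    by_cases hjl : ρ l ≤ j - 1
    · convert hPU.compl using 1
      ext y
      have := hσ y
      have := hlmax y
      simp only [Set.mem_ofPred_eq, Set.mem_inter_iff, mem_fiberAt, Set.mem_compl_iff]
      by_cases hy : y ∈ U
      · have := hσ1 y hy
        simp only [hy, and_true]
        omega
      · have := hσ2 y hy
        simp only [hy, and_false, not_false_eq_true, iff_true]
        omega
    · have hA := hρ.sep 1 (j - 1)
      have hB := hρ.sep 0 (j - 1)
      have hAs := (saturated_Icc (ρ := ρ) 1 (j - 1)).cutBy (U := U)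
      have hBs := (saturated_Icc (ρ := ρ) 0 (j - 1)).cutBy (U := U)
      -- The interval that starts at the second half is `(Uᶜ ∪ A) ∩ B`, for the intervals `A` and
      -- `B` behind `hA` and `hB`. The element `r` lies in `Uᶜ ∩ A`, and `l` lies outside both `Uᶜ ∪
      -- A` and `B`.
      have h1 := hb.separating_union h hU.compl hA hUsat.compl hAs
        ⟨r, hr, by simp only [Set.mem_ofPred_eq]; omega⟩
      have h2 := hb.separating_inter h h1 hB (hUsat.compl.union hAs) hBs (z := l) (by
        simp only [Set.mem_union, Set.mem_compl_iff, Set.mem_ofPred_eq, hl, not_true_eq_false,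
          false_or]
        omega) (by simp only [Set.mem_ofPred_eq]; omega)
      convert h2 using 1
      ext y
      have := hσ y
      simp only [Set.mem_ofPred_eq, Set.mem_inter_iff, Set.mem_compl_iff, Set.mem_union]
      by_cases hy : y ∈ U
      · have := hσ1 y hy
        simp only [hy, not_true_eq_false, false_or]
        omega
      · have := hσ2 y hy
        simp only [hy, not_false_eq_true, true_or, true_and]
        omega
  · intro x y hxy hxp
    have := hσ x
    have := hσ y
    by_cases hx : x ∈ U
    · refine iff_of_true hx ?_
      by_contra hy
      have := hσ1 x hx
      have := hσ2 y hy
      omega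
    · refine iff_of_false hx fun hy => ?_
      have := hσ2 x hx
      have := hσ1 y hy
      omega

/-- Since `Uᶜ` avoids both neighbours of the first petal but reaches beyond that petal, uncrossing
produces a separating union that is not consecutive. The flower is therefore an anemone, and its
petals may be reordered to suit `split_first`. -/
theorem RankFlower.split_first_of_subset (hρ : RankFlower C k 𝒯 ρ) (h : IsRobustTangle C k 𝒯)
    (hU : IsSeparating C k U) (hb : BigFibers 𝒯 (cutBy ρ U)) {p r l : E} (hp : ρ p = 0)
    (hpU : (fiberAt ρ p ∩ Uᶜ).Nonempty) (hUp : ¬ Uᶜ ⊆ fiberAt ρ p)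
    (hr : fiberAt ρ r ⊆ U) (hr0 : 0 < ρ r) (hrmin : ∀ x, 0 < ρ x → ρ r ≤ ρ x)
    (hl : fiberAt ρ l ⊆ U) (hlmax : ∀ x, ρ x ≤ ρ l) :
    ∃ σ, RankFlower C k 𝒯 σ ∧ Refines σ ρ U ∧
      ∀ x y, σ x = σ y → ρ x = ρ p → (x ∈ U ↔ y ∈ U) := by
  obtain ⟨m, hmU, hmp⟩ := Set.not_subset.1 hUp
  have hm0 : 0 < ρ m := by
    rw [mem_fiberAt] at hmp
    omega
  have hmr : ρ m ≠ ρ r := fun h0 => hmU (hr h0)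
  have hml : ρ m ≠ ρ l := fun h0 => hmU (hl h0)
  have hm1 := hrmin m hm0
  have hm2 := hlmax m
  have hUsat := saturated_cutBy (ρ := ρ) (U := U)
  have hJ := hρ.sep (ρ r + 1) (ρ l - 1)
  have hJsat : Saturated ρ {y | ρ r + 1 ≤ ρ y ∧ ρ y ≤ ρ l - 1} := saturated_Icc _ _
  have h1 := hb.separating_union h hU.compl hJ hUsat.compl hJsat.cutBy
    ⟨m, hmU, by simp only [Set.mem_ofPred_eq]; omega⟩
  have h2 := hb.separating_union h h1 (hρ.separating_fiberAt p) (hUsat.compl.union hJsat.cutBy)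
    (saturated_fiberAt p).cutBy (by
      obtain ⟨z, hz1, hz2⟩ := hpU
      exact ⟨z, Or.inl hz2, hz1⟩)
  have h3 : Uᶜ ∪ {y | ρ r + 1 ≤ ρ y ∧ ρ y ≤ ρ l - 1} ∪ fiberAt ρ p =
      {y | ρ r + 1 ≤ ρ y ∧ ρ y ≤ ρ l - 1} ∪ fiberAt ρ p := by
    apply Set.Subset.antisymm
    · refine Set.union_subset (Set.union_subset ?_ Set.subset_union_left) Set.subset_union_right
      intro y hy
      have hyr : ρ y ≠ ρ r := fun h0 => hy (hr h0)
      have hyl : ρ y ≠ ρ l := fun h0 => hy (hl h0)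
      have := hrmin y
      have := hlmax y
      simp only [Set.mem_union, mem_fiberAt, Set.mem_ofPred_eq]
      omega
    · exact Set.union_subset_union_left _ Set.subset_union_right
  rw [h3] at h2
  have hA : RankAnemone C k ρ := by
    refine hρ.rankAnemone h h2 (hJsat.union (saturated_fiberAt p)) (a := p) (b := r) (c := m)
      (d := l) (by omega) (by omega) (by omega) ?_ ?_ ?_ ?_ <;>
      simp only [Set.mem_union, mem_fiberAt, Set.mem_ofPred_eq, or_true] <;> omega
  -- The petal of `m`, which meets `Uᶜ`, is moved directly behind the first one; the shift by two
  -- makes room, and `l` stays in the last petal.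
  obtain ⟨ρ', hρ'⟩ : ∃ ρ' : E → ℕ, ∀ x, (ρ x = 0 ∧ ρ' x = 0) ∨ (ρ x = ρ m ∧ ρ' x = 1) ∨
      (ρ x ≠ 0 ∧ ρ x ≠ ρ m ∧ ρ' x = ρ x + 2) := by
    refine ⟨fun x => if ρ x = 0 then 0 else if ρ x = ρ m then 1 else ρ x + 2, fun x => ?_⟩
    dsimp only
    split_ifs <;> simp_all
  have hker : ∀ x y, ρ' x = ρ' y ↔ ρ x = ρ y := by
    intro x y
    have := hρ' x
    have := hρ' y
    omega
  have hfl := hA.rankFlower hρ.big hker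
  have href : Refines ρ' ρ U := ⟨fun x y => (hker x y).1, fun x y hxy _ => (hker x y).2 hxy⟩
  obtain ⟨σ, hσ, hσref, hσp⟩ := hfl.split_first h hU (href.bigFibers hb) (p := p) (r := m) (l := l)
    (by have := hρ' p; omega) hmU (by have := hρ' m; omega)
    (by intro x; have := hρ' x; have := hρ' m; omega)
    (hl rfl) (by have := hρ' l; omega)
    (by intro x; have := hρ' x; have := hρ' l; have := hlmax x; omega)
  exact ⟨σ, hσ, href.trans hσref, fun x y hxy hxp => hσp x y hxy ((hker x p).2 hxp)⟩

theorem RankFlower.exists_split (hρ : RankFlower C k 𝒯 ρ) (h : IsRobustTangle C k 𝒯)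
    (hU : IsSeparating C k U) (hb : BigFibers 𝒯 (cutBy ρ U)) {p : E} (hp : p ∈ splitPoints ρ U)
    (hUp : ¬ U ⊆ fiberAt ρ p) (hUp' : ¬ Uᶜ ⊆ fiberAt ρ p) :
    ∃ σ, RankFlower C k 𝒯 σ ∧ Refines σ ρ U ∧
      ∀ x y, σ x = σ y → ρ x = ρ p → (x ∈ U ↔ y ∈ U) := by
  obtain ⟨ρ', hρ', hker, hp0⟩ := hρ.exists_rotate p
  have hfib : fiberAt ρ' = fiberAt ρ := by
    ext y z
    exact hker z y
  have href : Refines ρ' ρ U := ⟨fun x y => (hker x y).1, fun x y hxy _ => (hker x y).2 hxy⟩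
  suffices hs : ∃ σ, RankFlower C k 𝒯 σ ∧ Refines σ ρ' U ∧
      ∀ x y, σ x = σ y → ρ' x = ρ' p → (x ∈ U ↔ y ∈ U) by
    obtain ⟨σ, h1, h2, h3⟩ := hs
    exact ⟨σ, h1, href.trans h2, fun x y hxy hxp => h3 x y hxy ((hker x p).2 hxp)⟩
  replace hb := href.bigFibers hb
  replace hp : (fiberAt ρ' p ∩ U).Nonempty ∧ (fiberAt ρ' p ∩ Uᶜ).Nonempty := by rwa [hfib]
  rw [← hfib] at hUp hUp'
  clear href hfib hker hρ
  have hex : ∃ z, 0 < ρ' z := by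
    obtain ⟨z, -, hz⟩ := Set.not_subset.1 hUp
    rw [mem_fiberAt] at hz
    exact ⟨z, by omega⟩
  obtain ⟨r, hr0, hrmin⟩ := Set.exists_min_image {y | 0 < ρ' y} ρ' (Set.toFinite _) hex
  obtain ⟨l, hl0, hlmax⟩ := Set.exists_max_image {y | 0 < ρ' y} ρ' (Set.toFinite _) hex
  simp only [Set.mem_ofPred_eq] at hr0 hrmin hl0 hlmax
  have hlmax : ∀ x, ρ' x ≤ ρ' l := by
    intro x
    have := hlmax x
    omega
  have hfin : ∀ V, IsSeparating C k V → BigFibers 𝒯 (cutBy ρ' V) →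
      ((fiberAt ρ' r ∩ Vᶜ).Nonempty ∧ (fiberAt ρ' l ∩ V).Nonempty) →
      ∃ σ, RankFlower C k 𝒯 σ ∧ Refines σ ρ' V ∧
        ∀ x y, σ x = σ y → ρ' x = ρ' p → (x ∈ V ↔ y ∈ V) := by
    rintro V hV hbV ⟨⟨r', hr1, hr2⟩, l', hl1, hl2⟩
    rw [mem_fiberAt] at hr1 hl1
    exact hρ'.split_first h hV hbV hp0 hr2 (by omega) (by rwa [hr1]) hl2 (by omega)
      (by rwa [hl1])
  have hconv : (∃ σ, RankFlower C k 𝒯 σ ∧ Refines σ ρ' Uᶜ ∧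
        ∀ x y, σ x = σ y → ρ' x = ρ' p → (x ∈ Uᶜ ↔ y ∈ Uᶜ)) →
      ∃ σ, RankFlower C k 𝒯 σ ∧ Refines σ ρ' U ∧
        ∀ x y, σ x = σ y → ρ' x = ρ' p → (x ∈ U ↔ y ∈ U) := by
    rintro ⟨σ, h1, h2, h3⟩
    refine ⟨σ, h1, ?_, fun x y hxy hxp => not_iff_not.1 (h3 x y hxy hxp)⟩
    have := h2.compl
    rwa [compl_compl] at this
  have hsub : ∀ {A B : Set E}, ¬ (A ∩ B).Nonempty → A ⊆ Bᶜ := by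
    intro A B hAB z hz hzB
    exact hAB ⟨z, hz, hzB⟩
  -- Either the neighbours meet opposite sides of `U`, in one of the two orders, or both lie
  -- entirely inside `U` or both inside `Uᶜ`.
  by_cases c1 : (fiberAt ρ' r ∩ Uᶜ).Nonempty ∧ (fiberAt ρ' l ∩ U).Nonempty
  · exact hfin U hU hb c1
  by_cases c2 : (fiberAt ρ' r ∩ U).Nonempty ∧ (fiberAt ρ' l ∩ Uᶜ).Nonempty
  · exact hconv (hfin Uᶜ hU.compl (bigFibers_cutBy_compl hb) (by rwa [compl_compl]))
  by_cases c3 : (fiberAt ρ' r ∩ Uᶜ).Nonempty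
  · have hl1 : fiberAt ρ' l ⊆ Uᶜ := hsub fun h0 => c1 ⟨c3, h0⟩
    have hr1 : fiberAt ρ' r ⊆ Uᶜ := hsub fun h0 => c2 ⟨h0, l, mem_fiberAt_self l,
      hl1 (mem_fiberAt_self l)⟩
    exact hconv (hρ'.split_first_of_subset h hU.compl (bigFibers_cutBy_compl hb) hp0
      (by rw [compl_compl]; exact hp.1) (by rwa [compl_compl]) hr1 hr0 hrmin hl1 hlmax)
  · have hr1 := hsub c3
    rw [compl_compl] at hr1
    have hl1 := hsub fun h0 => c2 ⟨⟨r, mem_fiberAt_self r, hr1 (mem_fiberAt_self r)⟩, h0⟩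
    rw [compl_compl] at hl1
    exact hρ'.split_first_of_subset h hU hb hp0 hp.2 hUp' hr1 hr0 hrmin hl1 hlmax

/-- A flower can be refined so as to display a separation that splits each of its petals into
strong parts, unless one side of that separation lies in a petal. -/
theorem RankFlower.exists_refinement (h : IsRobustTangle C k 𝒯) (hU : IsSeparating C k U) (n : ℕ) :
    ∀ ρ : E → ℕ, RankFlower C k 𝒯 ρ → BigFibers 𝒯 (cutBy ρ U) → (splitPoints ρ U).ncard ≤ n →
      (∀ p, ¬ U ⊆ fiberAt ρ p ∧ ¬ Uᶜ ⊆ fiberAt ρ p) →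
      ∃ σ, RankFlower C k 𝒯 σ ∧ Refines σ ρ U ∧ Saturated σ U := by
  induction n with
  | zero =>
    intro ρ hρ _ hn _
    refine ⟨ρ, hρ, ⟨fun _ _ h0 => h0, fun _ _ h0 _ => h0⟩, fun x y hxy => ?_⟩
    have he : splitPoints ρ U = ∅ := by
      rw [← Set.ncard_eq_zero (Set.toFinite _)]
      omega
    by_contra hcon
    have hx : x ∈ splitPoints ρ U := by
      by_cases hxU : x ∈ U
      · exact ⟨⟨x, rfl, hxU⟩, y, hxy.symm, fun hyU => hcon ⟨fun _ => hyU, fun _ => hxU⟩⟩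
      · refine ⟨⟨y, hxy.symm, ?_⟩, x, rfl, hxU⟩
        by_contra hyU
        exact hcon ⟨fun h0 => absurd h0 hxU, fun h0 => absurd h0 hyU⟩
    rw [he] at hx
    exact hx
  | succ n ih =>
    intro ρ hρ hb hn hp
    by_cases hle : (splitPoints ρ U).ncard ≤ n
    · exact ih ρ hρ hb hle hp
    obtain ⟨p, hps⟩ : (splitPoints ρ U).Nonempty := by
      rw [← Set.ncard_pos (Set.toFinite _)]
      omega
    obtain ⟨σ, hσ, href, hσp⟩ := hρ.exists_split h hU hb hps (hp p).1 (hp p).2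
    have hlt : (splitPoints σ U).ncard < (splitPoints ρ U).ncard := by
      apply Set.ncard_lt_ncard _ (Set.toFinite _)
      refine ⟨?_, fun h0 => ?_⟩
      · rintro x ⟨⟨y, hy1, hy2⟩, z, hz1, hz2⟩
        exact ⟨⟨y, href.eq_of_eq _ _ hy1, hy2⟩, z, href.eq_of_eq _ _ hz1, hz2⟩
      · obtain ⟨⟨y, hy1, hy2⟩, z, hz1, hz2⟩ := h0 hps
        have h1 := hσp p y hy1.symm rfl
        have h2 := hσp p z hz1.symm rfl
        exact hz2 (h2.1 (h1.2 hy2))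
    obtain ⟨τ, hτ, hτref, hτU⟩ := ih σ hσ (href.bigFibers hb) (by omega) (fun q =>
      ⟨fun h0 => (hp q).1 (h0.trans fun y hy => href.eq_of_eq _ _ hy),
        fun h0 => (hp q).2 (h0.trans fun y hy => href.eq_of_eq _ _ hy)⟩)
    exact ⟨τ, hτ, href.trans hτref, hτU⟩

end Refinement

/-! ### Maximal tight flowers and the separations that conform with them. -/

section MaximalFlowers

variable {E : Type u} [Finite E] {C : ConnectivitySystem E} {k : ℤ} {𝒯 : Set (Set E)}
  {ρ : E → ℕ} {F U : Set E}

/-- The full closures of the non-sequential unions of petals. -/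
def displayedClosures (C : ConnectivitySystem E) (k : ℤ) (𝒯 : Set (Set E)) (ρ : E → ℕ) :
    Set (Set E) :=
  {A | ∃ W, Saturated ρ W ∧ NonSeq C k 𝒯 W ∧ fcl C k 𝒯 W = A}

/-- Some set equivalent to `U`, or its complement, is contained in `P`. -/
def LiesIn (C : ConnectivitySystem E) (k : ℤ) (𝒯 : Set (Set E)) (U P : Set E) : Prop :=
  ∃ W, NonSeq C k 𝒯 W ∧ fcl C k 𝒯 W = fcl C k 𝒯 U ∧ fcl C k 𝒯 Wᶜ = fcl C k 𝒯 Uᶜ ∧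
    (W ⊆ P ∨ Wᶜ ⊆ P)

theorem Refines.displayedClosures_subset {σ : E → ℕ} (h : Refines σ ρ U) :
    displayedClosures C k 𝒯 ρ ⊆ displayedClosures C k 𝒯 σ := by
  rintro A ⟨W, hW, hN, he⟩
  exact ⟨W, hW.congr h.eq_of_eq, hN, he⟩

theorem RankFlower.exists_tight_maximal (h : IsRobustTangle C k 𝒯) [Nonempty E]
    (hρ : RankFlower C k 𝒯 ρ) (hF : ∀ x ∈ F, ∀ y ∈ F, ρ x = ρ y) :
    ∃ σ, RankFlower C k 𝒯 σ ∧ (∀ x ∈ F, ∀ y ∈ F, σ x = σ y) ∧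
      displayedClosures C k 𝒯 ρ ⊆ displayedClosures C k 𝒯 σ ∧ Tight C k 𝒯 σ ∧
      ∀ τ, RankFlower C k 𝒯 τ → (∀ x ∈ F, ∀ y ∈ F, τ x = τ y) →
        displayedClosures C k 𝒯 σ ⊆ displayedClosures C k 𝒯 τ →
        displayedClosures C k 𝒯 τ ⊆ displayedClosures C k 𝒯 σ := by
  have hfin : {D | ∃ τ, RankFlower C k 𝒯 τ ∧ (∀ x ∈ F, ∀ y ∈ F, τ x = τ y) ∧
      displayedClosures C k 𝒯 ρ ⊆ displayedClosures C k 𝒯 τ ∧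
      displayedClosures C k 𝒯 τ = D}.Finite := Set.toFinite _
  obtain ⟨D, ⟨τ, hτ, hτF, hρτ, rfl⟩, hmax⟩ := hfin.exists_maximal ⟨_, ρ, hρ, hF, le_rfl, rfl⟩
  -- Once the displayed closures are maximal, the number of petals is minimised; merging a petal
  -- into another would lower it without losing a closure, which gives tightness.
  obtain ⟨σ, ⟨hσ, hσF, hτσ⟩, hmin⟩ := (measure fun σ : E → ℕ => (Set.range σ).ncard).wf.has_min
    {σ | RankFlower C k 𝒯 σ ∧ (∀ x ∈ F, ∀ y ∈ F, σ x = σ y) ∧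
      displayedClosures C k 𝒯 τ ⊆ displayedClosures C k 𝒯 σ} ⟨τ, hτ, hτF, le_rfl⟩
  refine ⟨σ, hσ, hσF, hρτ.trans hτσ, ?_, ?_⟩
  · intro p q hpq hsep hcl
    refine hmin (fun x => if σ x = σ p then σ q else σ x) ⟨hσ.merge h hsep, ?_, ?_⟩ ?_
    · intro x hx y hy
      dsimp only
      rw [hσF x hx y hy]
    · refine hτσ.trans ?_
      rintro A ⟨W, hW, hN, rfl⟩
      exact hσ.merge_saturated h hsep hcl hW hN
    · change Set.ncard _ < Set.ncard _
      apply Set.ncard_lt_ncard _ (Set.finite_range σ)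
      refine ⟨?_, fun h0 => ?_⟩
      · rintro _ ⟨x, rfl⟩
        dsimp only
        split_ifs
        · exact ⟨q, rfl⟩
        · exact ⟨x, rfl⟩
      · obtain ⟨x, hx⟩ := h0 ⟨p, rfl⟩
        dsimp only at hx
        split_ifs at hx with h1
        · exact hpq hx.symm
        · exact h1 hx
  · intro υ hυ hυF hσυ
    exact (hmax ⟨υ, hυ, hυF, hρτ.trans (hτσ.trans hσυ), rfl⟩ (hτσ.trans hσυ)).trans hτσ

/-- In a reduced cut, a split petal with one big half has both halves big, so excluding petals with
two small halves makes all pieces big. This is the entry condition for refinement. -/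
theorem Reduced.bigFibers_cutBy (h : IsRobustTangle C k 𝒯) [Nonempty E]
    (hρ : RankFlower C k 𝒯 ρ) (hU : Reduced C k 𝒯 ρ F U) (hF : ∀ x ∈ F, ∀ y ∈ F, ρ x = ρ y)
    (hns : ∀ x ∈ splitPoints ρ U, IsSmall 𝒯 (fiberAt ρ x ∩ U) → ¬ IsSmall 𝒯 (fiberAt ρ x ∩ Uᶜ)) :
    BigFibers 𝒯 (cutBy ρ U) := by
  have key : ∀ V, Reduced C k 𝒯 ρ F V → (∀ x ∈ splitPoints ρ V, IsSmall 𝒯 (fiberAt ρ x ∩ V) →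
      ¬ IsSmall 𝒯 (fiberAt ρ x ∩ Vᶜ)) → ∀ x ∈ V, IsBig 𝒯 (fiberAt ρ x ∩ V) := by
    intro V hV hVs x hx
    by_cases hxs : x ∈ splitPoints ρ V
    · intro hs
      have h1 := (hV.compl h).isBig_of_mem_splitPoints h hρ hF (x := x)
        (by rwa [splitPoints_compl]) (hVs x hxs hs)
      rw [compl_compl] at h1
      exact h1 hs
    · have : fiberAt ρ x ⊆ V := by
        intro y hy
        by_contra hyV
        exact hxs ⟨⟨x, rfl, hx⟩, y, hy, hyV⟩
      rw [Set.inter_eq_left.2 this]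
      exact hρ.big x
  intro x
  by_cases hx : x ∈ U
  · refine (key U hU hns x hx).mono fun y hy => ?_
    rw [mem_fiberAt, cutBy_eq_iff]
    exact ⟨hy.1, iff_of_true hy.2 hx⟩
  · refine (key Uᶜ (hU.compl h) ?_ x hx).mono fun y hy => ?_
    · intro y hy hs
      rw [compl_compl]
      rw [splitPoints_compl] at hy
      exact fun hs' => hns y hy hs' hs
    · rw [mem_fiberAt, cutBy_eq_iff]
      exact ⟨hy.1, iff_of_false hy.2 hx⟩

theorem RankFlower.extend (h : IsRobustTangle C k 𝒯) [Nonempty E]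
    (hρ : RankFlower C k 𝒯 ρ) (hU : Reduced C k 𝒯 ρ F U) (hF : ∀ x ∈ F, ∀ y ∈ F, ρ x = ρ y)
    (hns : ∀ x ∈ splitPoints ρ U, IsSmall 𝒯 (fiberAt ρ x ∩ U) → ¬ IsSmall 𝒯 (fiberAt ρ x ∩ Uᶜ))
    (hp : ∀ p, ¬ LiesIn C k 𝒯 U (fiberAt ρ p)) :
    ∃ σ, RankFlower C k 𝒯 σ ∧ (∀ x ∈ F, ∀ y ∈ F, σ x = σ y) ∧
      displayedClosures C k 𝒯 ρ ⊆ displayedClosures C k 𝒯 σ ∧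
      fcl C k 𝒯 U ∈ displayedClosures C k 𝒯 σ := by
  obtain ⟨σ, hσ, href, hσU⟩ := RankFlower.exists_refinement h hU.nonSeq.sep _ ρ hρ
    (hU.bigFibers_cutBy h hρ hF hns) le_rfl (fun p =>
      ⟨fun h0 => hp p ⟨U, hU.nonSeq, rfl, rfl, Or.inl h0⟩,
        fun h0 => hp p ⟨U, hU.nonSeq, rfl, rfl, Or.inr h0⟩⟩)
  exact ⟨σ, hσ, fun x hx y hy => href.eq_of_cutBy x y (hF x hx y hy)
    ⟨hU.respects x hx y hy, hU.respects y hy x hx⟩, href.displayedClosures_subset,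
    U, hσU, hU.nonSeq, rfl⟩

theorem LiesIn.congr {U V P : Set E} (hL : LiesIn C k 𝒯 V P) (h1 : fcl C k 𝒯 V = fcl C k 𝒯 U)
    (h2 : fcl C k 𝒯 Vᶜ = fcl C k 𝒯 Uᶜ) : LiesIn C k 𝒯 U P := by
  obtain ⟨W, hW, h3, h4, h5⟩ := hL
  exact ⟨W, hW, h3.trans h1, h4.trans h2, h5⟩

/-- Two crossing non-sequential separations are displayed, up to equivalence, by a flower. -/
theorem exists_rankFlower_of_crossing (h : IsRobustTangle C k 𝒯) [Nonempty E] {X : Set E}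
    (hX : NonSeq C k 𝒯 X) (hXF : Respects F X) (hU : NonSeq C k 𝒯 U) (hUF : Respects F U)
    (h1 : ¬ LiesIn C k 𝒯 U X) (h2 : ¬ LiesIn C k 𝒯 U Xᶜ) :
    ∃ ρ, RankFlower C k 𝒯 ρ ∧ (∀ x ∈ F, ∀ y ∈ F, ρ x = ρ y) ∧
      fcl C k 𝒯 X ∈ displayedClosures C k 𝒯 ρ ∧ fcl C k 𝒯 U ∈ displayedClosures C k 𝒯 ρ := by
  classical
  obtain ⟨ρ, hρ1, hρ2⟩ : ∃ ρ : E → ℕ, (∀ x ∈ X, ρ x = 0) ∧ ∀ x ∉ X, ρ x = 1 :=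
    ⟨fun x => if x ∈ X then 0 else 1, fun x hx => if_pos hx, fun x hx => if_neg hx⟩
  have hsat : Saturated ρ X := by
    intro x y hxy
    by_cases hx : x ∈ X <;> by_cases hy : y ∈ X
    · exact iff_of_true hx hy
    · rw [hρ1 x hx, hρ2 y hy] at hxy
      omega
    · rw [hρ2 x hx, hρ1 y hy] at hxy
      omega
    · exact iff_of_false hx hy
  have hfib1 : ∀ x ∈ X, fiberAt ρ x = X := by
    intro x hx
    refine Set.Subset.antisymm (hsat.fiberAt_subset hx) fun y hy => ?_
    rw [mem_fiberAt, hρ1 x hx, hρ1 y hy]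
  have hfib2 : ∀ x ∉ X, fiberAt ρ x = Xᶜ := by
    intro x hx
    refine Set.Subset.antisymm (hsat.compl.fiberAt_subset hx) fun y hy => ?_
    rw [mem_fiberAt, hρ2 x hx, hρ2 y hy]
  have hfl : RankFlower C k 𝒯 ρ := by
    constructor
    · intro x
      by_cases hx : x ∈ X
      · rw [hfib1 x hx]
        exact hX.big
      · rw [hfib2 x hx]
        exact hX.big_compl
    · intro i j
      have hρ : ∀ y, (y ∈ X ∧ ρ y = 0) ∨ (y ∉ X ∧ ρ y = 1) := by
        intro y
        by_cases hy : y ∈ X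
        · exact Or.inl ⟨hy, hρ1 y hy⟩
        · exact Or.inr ⟨hy, hρ2 y hy⟩
      by_cases h3 : 1 < i ∨ j < i
      · convert hX.sep.empty using 1
        ext y
        simp only [Set.mem_ofPred_eq, Set.mem_empty_iff_false, iff_false]
        rcases hρ y with ⟨-, h0⟩ | ⟨-, h0⟩ <;> omega
      by_cases h4 : i = 0
      · by_cases h5 : j = 0
        · convert hX.sep using 1
          ext y
          simp only [Set.mem_ofPred_eq]
          rcases hρ y with ⟨h6, h0⟩ | ⟨h6, h0⟩ <;> simp only [h6, iff_true, iff_false] <;> omega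
        · convert hX.sep.univ using 1
          ext y
          simp only [Set.mem_ofPred_eq, Set.mem_univ, iff_true]
          rcases hρ y with ⟨-, h0⟩ | ⟨-, h0⟩ <;> omega
      · convert hX.sep.compl using 1
        ext y
        simp only [Set.mem_ofPred_eq, Set.mem_compl_iff]
        rcases hρ y with ⟨h6, h0⟩ | ⟨h6, h0⟩ <;>
          simp only [h6, not_true_eq_false, not_false_eq_true, iff_true, iff_false] <;> omega
  have hF : ∀ x ∈ F, ∀ y ∈ F, ρ x = ρ y := by
    intro x hx y hy
    by_cases hxX : x ∈ X
    · rw [hρ1 x hxX, hρ1 y (hXF x hx y hy hxX)]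
    · rw [hρ2 x hxX, hρ2 y fun h0 => hxX (hXF y hy x hx h0)]
  obtain ⟨V, hV, hVU⟩ := hU.exists_reduced hUF ρ
  obtain ⟨-, hVU'⟩ := hU.of_fcl_eq h hV.nonSeq.sep hV.nonSeq.big.isStrong hVU
  -- The flower with petals `X` and `Xᶜ` displays only one separation, so `Reduced.not_isSmall` does
  -- not apply. Its petals are themselves non-sequential, however, and so cannot be split into two
  -- small halves.
  obtain ⟨σ, hσ, hσF, hsub, hmem⟩ := hfl.extend h hV hF (by
      intro x hx hs hs'
      have hN : NonSeq C k 𝒯 (fiberAt ρ x) := by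
        by_cases hxX : x ∈ X
        · rw [hfib1 x hxX]
          exact hX
        · rw [hfib2 x hxX]
          exact hX.compl
      exact hV.false_of_isSmall h hF (saturated_fiberAt x) hN hs hs' (mem_fiberAt_self x) hx) (by
      intro p hp
      by_cases hpX : p ∈ X
      · rw [hfib1 p hpX] at hp
        exact h1 (hp.congr hVU hVU')
      · rw [hfib2 p hpX] at hp
        exact h2 (hp.congr hVU hVU'))
  exact ⟨σ, hσ, hσF, hsub ⟨X, hsat, hX, rfl⟩, by rwa [← hVU]⟩

/-- If `U` lies in no petal, its reduced form can be added to the flower, and maximality says that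
its closure was displayed already. The two inequivalent separations serve to exclude petals with two
small halves. -/
theorem RankFlower.conforms (h : IsRobustTangle C k 𝒯) [Nonempty E]
    (hρ : RankFlower C k 𝒯 ρ) (hF : ∀ x ∈ F, ∀ y ∈ F, ρ x = ρ y) (ht : Tight C k 𝒯 ρ)
    (hmax : ∀ τ, RankFlower C k 𝒯 τ → (∀ x ∈ F, ∀ y ∈ F, τ x = τ y) →
        displayedClosures C k 𝒯 ρ ⊆ displayedClosures C k 𝒯 τ →
        displayedClosures C k 𝒯 τ ⊆ displayedClosures C k 𝒯 ρ)
    {W₁ W₂ : Set E} (hW₁ : Saturated ρ W₁) (hN₁ : NonSeq C k 𝒯 W₁) (hW₂ : Saturated ρ W₂)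
    (hN₂ : NonSeq C k 𝒯 W₂) (hne : ¬ SepEquiv C k 𝒯 W₁ W₂) (hU : NonSeq C k 𝒯 U)
    (hUF : Respects F U) :
    fcl C k 𝒯 U ∈ displayedClosures C k 𝒯 ρ ∨ ∃ p, LiesIn C k 𝒯 U (fiberAt ρ p) := by
  by_contra hcon
  push Not at hcon
  obtain ⟨V, hV, hVU⟩ := hU.exists_reduced hUF ρ
  obtain ⟨-, hVU'⟩ := hU.of_fcl_eq h hV.nonSeq.sep hV.nonSeq.big.isStrong hVU
  obtain ⟨σ, hσ, hσF, hsub, hmem⟩ := hρ.extend h hV hF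
    (fun x hx hs => hV.not_isSmall h hρ ht hF hW₁ hN₁ hW₂ hN₂ hne hx hs)
    (fun p hp => hcon.2 p (hp.congr hVU hVU'))
  rw [hVU] at hmem
  exact hcon.1 (hmax σ hσ hσF hsub hmem)

end MaximalFlowers

/-! ### From rank functions to cyclically indexed flowers. -/

section IndexedFlowers

variable {E : Type u} [Finite E] {C : ConnectivitySystem E} {k : ℤ} {𝒯 : Set (Set E)}
  {ρ : E → ℕ} {n : ℕ} {r : E → Fin n}

theorem exists_rank_fin (ρ : E → ℕ) :
    ∃ (n : ℕ) (r : E → Fin n), Function.Surjective r ∧ ∀ x y, r x ≤ r y ↔ ρ x ≤ ρ y := by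
  classical
  have : Fintype E := Fintype.ofFinite E
  let s : Finset ℕ := Finset.univ.image ρ
  let f := s.orderIsoOfFin rfl
  have hs : ∀ x, ρ x ∈ s := fun x => Finset.mem_image_of_mem ρ (Finset.mem_univ x)
  refine ⟨s.card, fun x => f.symm ⟨ρ x, hs x⟩, fun i => ?_, fun x y => ?_⟩
  · obtain ⟨x, -, hx⟩ := Finset.mem_image.1 (f i).2
    refine ⟨x, ?_⟩
    rw [OrderIso.symm_apply_eq]
    exact Subtype.ext hx
  · rw [OrderIso.le_iff_le]
    rfl

theorem RankFlower.val (hρ : RankFlower C k 𝒯 ρ) (hr : ∀ x y, r x ≤ r y ↔ ρ x ≤ ρ y) :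
    RankFlower C k 𝒯 fun x => (r x : ℕ) := by
  have hr' : ∀ x y, (r x : ℕ) ≤ r y ↔ ρ x ≤ ρ y := hr
  constructor
  · intro x
    refine (hρ.big x).mono fun y hy => ?_
    rw [mem_fiberAt] at *
    have := hr' x y
    have := hr' y x
    omega
  · intro i j
    by_cases hne : {x | i ≤ (r x : ℕ) ∧ (r x : ℕ) ≤ j}.Nonempty
    · obtain ⟨a, ha, hmin⟩ := Set.exists_min_image _ ρ (Set.toFinite _) hne
      obtain ⟨b, hb, hmax⟩ := Set.exists_max_image _ ρ (Set.toFinite _) hne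
      convert hρ.sep (ρ a) (ρ b) using 1
      ext y
      constructor
      · exact fun hy => ⟨hmin y hy, hmax y hy⟩
      · rintro ⟨h1, h2⟩
        rw [← hr'] at h1 h2
        exact ⟨ha.1.trans h1, h2.trans hb.2⟩
    · rw [Set.not_nonempty_iff_eq_empty] at hne
      rw [hne]
      exact (hρ.sep 0 0).empty

theorem fiberAt_val (hr : ∀ x y, r x ≤ r y ↔ ρ x ≤ ρ y) :
    fiberAt (fun x => (r x : ℕ)) = fiberAt ρ := by
  have hr' : ∀ x y, (r x : ℕ) ≤ r y ↔ ρ x ≤ ρ y := hr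
  ext x y
  rw [mem_fiberAt, mem_fiberAt]
  have := hr' x y
  have := hr' y x
  omega

theorem iUnion_preimage_singleton (I : Set (Fin n)) : (⋃ i ∈ I, r ⁻¹' {i}) = r ⁻¹' I := by
  ext x
  simp

theorem preimage_eq_fiberAt (x : E) : r ⁻¹' {r x} = fiberAt (fun x => (r x : ℕ)) x := by
  ext y
  rw [mem_fiberAt, Set.mem_preimage, Set.mem_singleton_iff, Fin.ext_iff]

theorem saturated_preimage (I : Set (Fin n)) : Saturated (fun x => (r x : ℕ)) (r ⁻¹' I) := by
  intro x y hxy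
  rw [Set.mem_preimage, Set.mem_preimage, Fin.ext hxy]

theorem Saturated.exists_preimage {W : Set E} (hW : Saturated (fun x => (r x : ℕ)) W) :
    ∃ I, W = r ⁻¹' I := by
  refine ⟨r '' W, Set.Subset.antisymm (Set.subset_preimage_image r W) ?_⟩
  rintro x ⟨y, hy, hxy⟩
  exact (hW y x (congrArg Fin.val hxy)).1 hy

theorem coe_iterate_finRotate {n : ℕ} (a : Fin n) (t : ℕ) (ht : t ≤ n) :
    (a + t < n ∧ (((finRotate n)^[t] a : Fin n) : ℕ) = a + t) ∨
      (n ≤ a + t ∧ (((finRotate n)^[t] a : Fin n) : ℕ) = a + t - n) := by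
  induction t with
  | zero =>
    left
    have := a.2
    simp
  | succ t ih =>
    have ih := ih (by omega)
    rw [Function.iterate_succ_apply']
    set b := (finRotate n)^[t] a with hb
    have ha := a.2
    obtain ⟨m, rfl⟩ : ∃ m, n = m + 1 := ⟨n - 1, by omega⟩
    have hbl := b.2
    rw [coe_finRotate]
    split_ifs with h1
    · have h2 : (b : ℕ) = m := by rw [h1]; rfl
      omega
    · have h2 : (b : ℕ) ≠ m := fun h0 => h1 (Fin.ext h0)
      omega

theorem RankFlower.separating_consecutive (hρ : RankFlower C k 𝒯 fun x => (r x : ℕ)) (i : Fin n) :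
    IsSeparating C k (r ⁻¹' {i} ∪ r ⁻¹' {finRotate n i}) := by
  have h1 := coe_iterate_finRotate i 1 (by have := i.2; omega)
  simp only [Function.iterate_one] at h1
  set j := finRotate n i
  have hi := i.2
  rcases h1 with ⟨h2, h1⟩ | ⟨h2, h1⟩
  · convert hρ.sep i (i + 1) using 1
    ext y
    simp only [Set.mem_union, Set.mem_preimage, Set.mem_singleton_iff, Fin.ext_iff,
      Set.mem_ofPred_eq]
    omega
  · convert (hρ.sep 1 (n - 2)).compl using 1
    ext y
    have := (r y).2
    simp only [Set.mem_union, Set.mem_preimage, Set.mem_singleton_iff, Fin.ext_iff,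
      Set.mem_ofPred_eq, Set.mem_compl_iff]
    omega

theorem RankFlower.isFlower [Nonempty E] (hρ : RankFlower C k 𝒯 fun x => (r x : ℕ))
    (hr : Function.Surjective r) : IsFlower C k 𝒯 fun i => r ⁻¹' {i} := by
  refine ⟨?_, ?_, ?_, ?_, ?_, hρ.separating_consecutive⟩
  · obtain ⟨x⟩ := ‹Nonempty E›
    exact (r x).pos
  · intro i j hij
    rw [Set.disjoint_left]
    rintro x rfl h0
    exact hij h0
  · ext x
    simp
  · intro i
    obtain ⟨x, rfl⟩ := hr i
    rw [preimage_eq_fiberAt]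
    exact (hρ.big x).isStrong
  · intro i
    obtain ⟨x, rfl⟩ := hr i
    rw [preimage_eq_fiberAt]
    exact hρ.separating_fiberAt x

theorem RankAnemone.isAnemone [Nonempty E] (hρ : RankFlower C k 𝒯 fun x => (r x : ℕ))
    (hr : Function.Surjective r) (hA : RankAnemone C k fun x => (r x : ℕ)) :
    IsAnemone C k 𝒯 fun i => r ⁻¹' {i} := by
  refine ⟨hρ.isFlower hr, fun I _ => ?_⟩
  rw [iUnion_preimage_singleton]
  exact hA _ (saturated_preimage I)

/-- Extend the interval one petal at a time: it shares its last petal with the next consecutive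
pair, so uncrossing applies. Lengths beyond `n` need no special treatment. -/
theorem RankFlower.separating_cyclicInterval (h : IsRobustTangle C k 𝒯)
    (hρ : RankFlower C k 𝒯 fun x => (r x : ℕ)) (hr : Function.Surjective r) (a : Fin n) (m : ℕ) :
    IsSeparating C k (r ⁻¹' {j | ∃ t < m, j = (finRotate n)^[t] a}) := by
  induction m with
  | zero =>
    convert (hρ.sep 0 0).empty using 1
    ext x
    simp
  | succ m ih =>
    rcases m with _ | m
    · obtain ⟨x, rfl⟩ := hr a
      convert hρ.separating_fiberAt x using 1
      rw [← preimage_eq_fiberAt]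
      ext y
      simp [Set.mem_preimage]
    · obtain ⟨x, hx⟩ := hr ((finRotate n)^[m] a)
      convert hρ.big.separating_union h ih (hρ.separating_consecutive ((finRotate n)^[m] a))
        (saturated_preimage _) ((saturated_preimage _).union (saturated_preimage _))
        ⟨x, ⟨m, by omega, hx⟩, Or.inl hx⟩ using 1
      ext y
      simp only [Set.mem_preimage, Set.mem_ofPred_eq, Set.mem_union, Set.mem_singleton_iff]
      rw [← Function.iterate_succ_apply' (f := finRotate n)]
      constructor
      · rintro ⟨t, ht, hy⟩
        by_cases h1 : t < m + 1
        · exact Or.inl ⟨t, h1, hy⟩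
        · have : t = m + 1 := by omega
          subst this
          exact Or.inr (Or.inr hy)
      · rintro (⟨t, ht, hy⟩ | hy | hy)
        · exact ⟨t, by omega, hy⟩
        · exact ⟨m, by omega, hy⟩
        · exact ⟨m + 1, by omega, hy⟩

theorem isCyclicInterval_of_convex {n : ℕ} {I : Set (Fin n)} (hne : I.Nonempty)
    (hI : ∀ x ∈ I, ∀ z ∈ I, ∀ y, x < y → y < z → y ∈ I) : IsCyclicInterval I := by
  obtain ⟨a, ha, hmin⟩ := Set.exists_min_image I id (Set.toFinite _) hne
  obtain ⟨b, hb, hmax⟩ := Set.exists_max_image I id (Set.toFinite _) hne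
  simp only [id] at hmin hmax
  have hmem : ∀ j, j ∈ I ↔ a ≤ j ∧ j ≤ b := by
    intro j
    refine ⟨fun hj => ⟨hmin j hj, hmax j hj⟩, fun ⟨h1, h2⟩ => ?_⟩
    rcases h1.eq_or_lt with rfl | h1
    · exact ha
    rcases h2.eq_or_lt with rfl | h2
    · exact hb
    exact hI a ha b hb j h1 h2
  refine ⟨a, b - a + 1, ?_⟩
  ext j
  have hab := hmin b hb
  have hbn := b.2
  rw [hmem, Set.mem_ofPred_eq]
  simp only [Fin.le_def] at *
  constructor
  · rintro ⟨h1, h2⟩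
    refine ⟨j - a, by omega, Fin.ext ?_⟩
    have := coe_iterate_finRotate a (j - a) (by omega)
    omega
  · rintro ⟨t, ht, rfl⟩
    have := coe_iterate_finRotate a t (by omega)
    omega

theorem isCyclicInterval_of_convex_compl {n : ℕ} {I : Set (Fin n)} (hne : I.Nonempty)
    (hI : ∀ x ∉ I, ∀ z ∉ I, ∀ y, x < y → y < z → y ∉ I) : IsCyclicInterval I := by
  by_cases hc : Iᶜ.Nonempty
  swap
  · rw [Set.not_nonempty_iff_eq_empty, Set.compl_empty_iff] at hc
    refine isCyclicInterval_of_convex hne ?_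
    rw [hc]
    intros
    trivial
  obtain ⟨a, ha, hmin⟩ := Set.exists_min_image Iᶜ id (Set.toFinite _) hc
  obtain ⟨b, hb, hmax⟩ := Set.exists_max_image Iᶜ id (Set.toFinite _) hc
  simp only [id] at hmin hmax
  have hmem : ∀ j, j ∈ I ↔ j < a ∨ b < j := by
    intro j
    constructor
    · intro hj
      by_contra hcon
      rw [not_or, not_lt, not_lt] at hcon
      rcases hcon.1.eq_or_lt with rfl | h1
      · exact ha hj
      rcases hcon.2.eq_or_lt with rfl | h2
      · exact hb hj
      exact hI a ha b hb j h1 h2 hj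
    · intro hj
      by_contra hjI
      have h1 := hmin j hjI
      have h2 := hmax j hjI
      rcases hj with hj | hj
      · exact absurd h1 (not_le.2 hj)
      · exact absurd h2 (not_le.2 hj)
  -- The missing indices form the linear interval from `a` to `b`; the cyclic interval starts just
  -- after `b` and has the remaining length.
  refine ⟨finRotate n b, n - (b - a + 1), ?_⟩
  ext j
  have hab := hmin b hb
  have hbn := b.2
  have hjn := j.2
  rw [hmem, Set.mem_ofPred_eq]
  simp only [Fin.le_def, Fin.lt_def, ← Function.iterate_succ_apply] at *
  constructor
  · rintro (h1 | h1)
    · refine ⟨n + j - b - 1, by omega, Fin.ext ?_⟩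
      have := coe_iterate_finRotate b (n + j - b - 1 + 1) (by omega)
      simp only [Nat.succ_eq_add_one] at *
      omega
    · refine ⟨j - b - 1, by omega, Fin.ext ?_⟩
      have := coe_iterate_finRotate b (j - b - 1 + 1) (by omega)
      simp only [Nat.succ_eq_add_one] at *
      omega
  · rintro ⟨t, ht, rfl⟩
    have := coe_iterate_finRotate b (t + 1) (by omega)
    simp only [Nat.succ_eq_add_one] at *
    omega

theorem RankFlower.isDaisy [Nonempty E] (h : IsRobustTangle C k 𝒯)
    (hρ : RankFlower C k 𝒯 fun x => (r x : ℕ)) (hr : Function.Surjective r)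
    (hA : ¬ RankAnemone C k fun x => (r x : ℕ)) : IsDaisy C k 𝒯 fun i => r ⁻¹' {i} := by
  refine ⟨hρ.isFlower hr, fun I hI => ?_⟩
  rw [iUnion_preimage_singleton]
  constructor
  · intro hs
    have hno : ∀ J : Set (Fin n), IsSeparating C k (r ⁻¹' J) → ∀ x ∈ J, ∀ y ∉ J, ∀ z ∈ J,
        ∀ w ∉ J, x < y → y < z → ¬ z < w := by
      intro J hJ x hx y hy z hz w hw hxy hyz hzw
      obtain ⟨x, rfl⟩ := hr x
      obtain ⟨y, rfl⟩ := hr y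
      obtain ⟨z, rfl⟩ := hr z
      obtain ⟨w, rfl⟩ := hr w
      exact hA (hρ.rankAnemone h hJ (saturated_preimage J) hxy hyz hzw hx hy hz hw)
    by_contra hcon
    have h1 : ¬ ∀ x ∈ I, ∀ z ∈ I, ∀ y, x < y → y < z → y ∈ I :=
      fun h0 => hcon (isCyclicInterval_of_convex hI h0)
    have h2 : ¬ ∀ x ∉ I, ∀ z ∉ I, ∀ y, x < y → y < z → y ∉ I :=
      fun h0 => hcon (isCyclicInterval_of_convex_compl hI h0)
    push Not at h1 h2
    obtain ⟨x, hx, z, hz, y, hxy, hyz, hy⟩ := h1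
    obtain ⟨p, hp, q, hq, w, hpw, hwq, hw⟩ := h2
    -- Failure of convexity for `I` and for its complement gives an alternating triple of each kind.
    -- The smaller of the two first entries can be put in front of the other triple to form an
    -- alternating quadruple.
    rcases lt_trichotomy x p with h3 | rfl | h3
    · exact hno I hs x hx p hp w hw q hq h3 hpw hwq
    · exact hp hx
    · refine hno Iᶜ ?_ p hp x (fun h0 => h0 hx) y hy z (fun h0 => h0 hz) h3 hxy hyz
      rw [Set.preimage_compl]
      exact hs.compl
  · rintro ⟨a, m, rfl⟩
    exact hρ.separating_cyclicInterval h hr a m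

theorem FlowerDisplays.of_two {m : ℕ} {Q : Fin m → Set E}
    (hQ : IsFlower C k 𝒯 Q) (hm : m < 3) :
    ∃ Z, ∀ Y, FlowerDisplays C k Q Y → NonSeq C k 𝒯 Y → Y = Z ∨ Y = Zᶜ := by
  have hpos := hQ.pos
  refine ⟨Q ⟨0, hpos⟩, ?_⟩
  rintro Y ⟨-, I, rfl⟩ hN
  have hcov : ∀ x, ∃ i, x ∈ Q i := fun x => Set.mem_iUnion.1 (hQ.cover ▸ Set.mem_univ x)
  obtain ⟨x, hx⟩ := hN.big.nonempty
  obtain ⟨y, hy⟩ := hN.big_compl.nonempty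
  obtain ⟨i, hi, hxi⟩ := Set.mem_iUnion₂.1 hx
  obtain ⟨j, hyj⟩ := hcov y
  have hj : j ∉ I := fun h0 => hy (Set.mem_iUnion₂.2 ⟨j, h0, hyj⟩)
  have hij : i ≠ j := fun h0 => hj (h0 ▸ hi)
  have hval : ∀ l : Fin m, l = i ∨ l = j := by
    intro l
    have h1 := i.2
    have h2 := j.2
    have h3 := l.2
    rw [Fin.ext_iff, Fin.ext_iff]
    rw [Ne, Fin.ext_iff] at hij
    omega
  have hY : (⋃ l ∈ I, Q l) = Q i := by
    refine Set.Subset.antisymm (Set.iUnion₂_subset fun l hl => ?_) (Set.subset_biUnion_of_mem hi)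
    rcases hval l with rfl | rfl
    · exact le_rfl
    · exact absurd hl hj
  rw [hY]
  rcases hval ⟨0, hpos⟩ with h0 | h0
  · left
    rw [h0]
  · right
    rw [h0]
    ext z
    constructor
    · intro hz hz'
      exact Set.disjoint_left.1 (hQ.disjoint hij) hz hz'
    · intro hz
      obtain ⟨l, hl⟩ := hcov z
      rcases hval l with rfl | rfl
      · exact hl
      · exact absurd hl hz

/-- A flower with at most two petals displays at most one non-sequential separation, so it cannot
account for two inequivalent ones. -/
theorem IsFlower.three_le_flowerOrder {P : Fin n → Set E} (h : IsRobustTangle C k 𝒯) [Nonempty E]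
    (hP : IsFlower C k 𝒯 P) {W₁ W₂ : Set E} (hW₁ : FlowerDisplays C k P W₁)
    (hN₁ : NonSeq C k 𝒯 W₁) (hW₂ : FlowerDisplays C k P W₂) (hN₂ : NonSeq C k 𝒯 W₂)
    (hne : ¬ SepEquiv C k 𝒯 W₁ W₂) :
    3 ≤ flowerOrder C k 𝒯 (nonSequentialSets C k 𝒯) P := by
  have hrefl : FlowerLE C k 𝒯 (nonSequentialSets C k 𝒯) P P := by
    intro X hX hXS
    have hXN := ((isSSeparation_iff h).1 hXS).isStrongSeparation
    exact ⟨X, hX, hXS, hXN, hXN, rfl⟩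
  have hmem := Nat.sInf_mem (s := {m | ∃ Q : Fin m → Set E, IsFlower C k 𝒯 Q ∧
    FlowerLE C k 𝒯 (nonSequentialSets C k 𝒯) P Q ∧ FlowerLE C k 𝒯 (nonSequentialSets C k 𝒯) Q P})
    ⟨n, P, hP, hrefl, hrefl⟩
  obtain ⟨Q, hQ, hPQ, -⟩ := hmem
  by_contra hlt
  obtain ⟨Z, hZ⟩ := FlowerDisplays.of_two hQ (not_le.1 hlt)
  obtain ⟨Y₁, hY₁, hS₁, he₁⟩ := hPQ W₁ hW₁ ((isSSeparation_iff h).2 hN₁)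
  obtain ⟨Y₂, hY₂, hS₂, he₂⟩ := hPQ W₂ hW₂ ((isSSeparation_iff h).2 hN₂)
  have h1 := hZ Y₁ hY₁ ((isSSeparation_iff h).1 hS₁)
  have h2 := hZ Y₂ hY₂ ((isSSeparation_iff h).1 hS₂)
  have h3 : Y₂ = Y₁ ∨ Y₂ = Y₁ᶜ := by
    rcases h1 with rfl | rfl <;> rcases h2 with rfl | rfl <;> simp
  apply hne
  refine SepEquiv.trans ?_ he₂.symm
  rcases h3 with rfl | rfl
  · exact he₁
  · exact he₁.compl_right

theorem Tight.not_isLoose (hr : Function.Surjective r) (ht : Tight C k 𝒯 fun x => (r x : ℕ))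
    (hf : IsFlower C k 𝒯 fun i => r ⁻¹' {i}) (i : Fin n) :
    ¬ IsLoose C k 𝒯 (fun i => r ⁻¹' {i}) i := by
  rintro ⟨j, hji, hadj, hsub⟩
  have hs : IsSeparating C k (r ⁻¹' {i} ∪ r ⁻¹' {j}) := by
    rcases hadj with hA | hadj | hadj
    · have := hA.2 {i, j} ⟨i, Or.inl rfl⟩
      rwa [iUnion_preimage_singleton, Set.insert_eq, Set.preimage_union] at this
    · rw [hadj]
      exact hf.consecutive i
    · rw [hadj, Set.union_comm]
      exact hf.consecutive j
  obtain ⟨x, rfl⟩ := hr i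
  obtain ⟨y, rfl⟩ := hr j
  rw [preimage_eq_fiberAt, preimage_eq_fiberAt] at hs
  dsimp only at hsub
  rw [preimage_eq_fiberAt, preimage_eq_fiberAt] at hsub
  exact ht x y (fun h0 => hji (Fin.ext h0.symm)) hs hsub

/-- Two crossing non-sequential separations that respect `F` are displayed by a tight flower of
order at least three with which all non-sequential separations respecting `F` conform. -/
theorem exists_flower_of_crossing (h : IsRobustTangle C k 𝒯) [Nonempty E] {F U X : Set E}
    (hX : NonSeq C k 𝒯 X) (hXF : Respects F X) (hU : NonSeq C k 𝒯 U) (hUF : Respects F U)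
    (h1 : ¬ LiesIn C k 𝒯 U X) (h2 : ¬ LiesIn C k 𝒯 U Xᶜ) :
    ∃ (n : ℕ) (r : E → Fin n), (IsAnemone C k 𝒯 (fun i => r ⁻¹' {i}) ∨
        IsDaisy C k 𝒯 (fun i => r ⁻¹' {i})) ∧
      3 ≤ flowerOrder C k 𝒯 (nonSequentialSets C k 𝒯) (fun i => r ⁻¹' {i}) ∧
      (∀ i, ¬ IsLoose C k 𝒯 (fun i => r ⁻¹' {i}) i) ∧ Function.Surjective r ∧
      (∀ x ∈ F, ∀ y ∈ F, r x = r y) ∧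
      (∃ W, FlowerDisplays C k (fun i => r ⁻¹' {i}) W ∧ NonSeq C k 𝒯 W ∧
        fcl C k 𝒯 W = fcl C k 𝒯 X) ∧
      ∀ V, NonSeq C k 𝒯 V → Respects F V →
        (∃ W, FlowerDisplays C k (fun i => r ⁻¹' {i}) W ∧ NonSeq C k 𝒯 W ∧
          fcl C k 𝒯 W = fcl C k 𝒯 V) ∨ ∃ i, LiesIn C k 𝒯 V (r ⁻¹' {i}) := by
  obtain ⟨ρ₀, hρ₀, hF₀, hX₀, hU₀⟩ := exists_rankFlower_of_crossing h hX hXF hU hUF h1 h2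
  obtain ⟨ρ, hρ, hF, hsub, ht, hmax⟩ := hρ₀.exists_tight_maximal h hF₀
  obtain ⟨WX, hWX, hNX, heX⟩ := hsub hX₀
  obtain ⟨WU, hWU, hNU, heU⟩ := hsub hU₀
  -- If the two were equivalent, `X` or `Xᶜ` would itself witness that `U` lies in `X` or in `Xᶜ`.
  have hne : ¬ SepEquiv C k 𝒯 WX WU := by
    intro hsim
    rcases hsim.fcl_eq with ⟨h3, -⟩ | ⟨-, h3⟩
    · rw [heX, heU] at h3
      obtain ⟨-, h4⟩ := hX.of_fcl_eq h hU.sep hU.big.isStrong h3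
      exact h1 ⟨X, hX, h3.symm, h4.symm, Or.inl le_rfl⟩
    · obtain ⟨-, h4⟩ := hX.of_fcl_eq h hNX.sep hNX.big.isStrong heX
      rw [heU, h4] at h3
      obtain ⟨-, h5⟩ := hX.compl.of_fcl_eq h hU.sep hU.big.isStrong h3
      exact h2 ⟨Xᶜ, hX.compl, h3.symm, h5.symm, Or.inl le_rfl⟩
  have hconf := fun V hV hVF => hρ.conforms h hF ht hmax hWX hNX hWU hNU hne (U := V) hV hVF
  obtain ⟨n, r, hr, hrρ⟩ := exists_rank_fin ρ
  have hfib := fiberAt_val hrρ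
  have hval := hρ.val hrρ
  have heq : ∀ x y, r x = r y ↔ ρ x = ρ y := by
    intro x y
    rw [le_antisymm_iff, hrρ, hrρ, le_antisymm_iff]
  have hfl := hval.isFlower hr
  have hdisp : ∀ W, Saturated ρ W → NonSeq C k 𝒯 W →
      FlowerDisplays C k (fun i => r ⁻¹' {i}) W := by
    intro W hW hWN
    obtain ⟨I, rfl⟩ := (hW.congr (σ := fun x => (r x : ℕ))
      fun x y hxy => (heq x y).1 (Fin.ext hxy)).exists_preimage
    exact ⟨hWN.sep, I, (iUnion_preimage_singleton I).symm⟩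
  refine ⟨n, r, ?_, hfl.three_le_flowerOrder h (hdisp WX hWX hNX) hNX (hdisp WU hWU hNU) hNU hne,
    (ht.congr hfib).not_isLoose hr hfl, hr, fun x hx y hy => (heq x y).2 (hF x hx y hy),
    ⟨WX, hdisp WX hWX hNX, hNX, heX⟩, ?_⟩
  · by_cases hA : RankAnemone C k fun x => (r x : ℕ)
    · exact Or.inl (hA.isAnemone hval hr)
    · exact Or.inr (hval.isDaisy h hr hA)
  · intro V hV hVF
    rcases hconf V hV hVF with ⟨W, hW, hWN, he⟩ | ⟨p, hp⟩
    · exact Or.inl ⟨W, hdisp W hW hWN, hWN, he⟩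
    · refine Or.inr ⟨r p, ?_⟩
      rwa [preimage_eq_fiberAt, hfib]

end IndexedFlowers

/-! ### Joining two trees by an edge. -/

section GraftedGraphs

variable {V W : Type}

theorem reachable_of_forall_adj {G : SimpleGraph V} {p : V → Prop}
    (h : ∀ x y, G.Adj x y → p x → p y) {x y : V} (hxy : G.Reachable x y) (hx : p x) : p y := by
  rw [SimpleGraph.reachable_iff_reflTransGen] at hxy
  induction hxy with
  | refl => exact hx
  | tail _ hab ih => exact h _ _ hab ih

theorem reachable_map_of_adj {G : SimpleGraph V} {H : SimpleGraph W} {f : V → W}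
    (hf : ∀ a b, G.Adj a b → H.Reachable (f a) (f b)) {a b : V} (hab : G.Reachable a b) :
    H.Reachable (f a) (f b) :=
  reachable_of_forall_adj (p := fun x => H.Reachable (f a) (f x))
    (fun x y hxy hx => hx.trans (hf x y hxy)) hab SimpleGraph.Reachable.rfl

/-- A map to `H` with an inverse up to reachability in `G` identifies the components. It is applied
to the collapse of either half of a grafted graph to its attachment vertex. -/
theorem reachable_iff_of_retract {G : SimpleGraph V} {H : SimpleGraph W} {f : W → V} {π : V → W}
    (hf : ∀ a b, H.Adj a b → G.Reachable (f a) (f b))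
    (hπ : ∀ x y, G.Adj x y → H.Reachable (π x) (π y))
    (hfπ : ∀ x, G.Reachable x (f (π x))) (x y : V) :
    G.Reachable x y ↔ H.Reachable (π x) (π y) :=
  ⟨fun hxy => reachable_map_of_adj hπ hxy,
    fun hxy => (hfπ x).trans ((reachable_map_of_adj hf hxy).trans (hfπ y).symm)⟩

/-- The disjoint union of two graphs, together with an edge from `v` to `r`. -/
def graftGraph (G : SimpleGraph V) (v : V) (H : SimpleGraph W) (r : W) : SimpleGraph (V ⊕ W) where
  Adj
    | Sum.inl a, Sum.inl b => G.Adj a b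
    | Sum.inr p, Sum.inr q => H.Adj p q
    | Sum.inl a, Sum.inr q => a = v ∧ q = r
    | Sum.inr p, Sum.inl b => b = v ∧ p = r
  symm := ⟨by
    rintro (a | p) (b | q) h
    · exact SimpleGraph.Adj.symm h
    · exact h
    · exact h
    · exact SimpleGraph.Adj.symm h⟩
  loopless := ⟨by
    rintro (a | p) h
    · exact G.loopless.irrefl a h
    · exact H.loopless.irrefl p h⟩

variable {G : SimpleGraph V} {v : V} {H : SimpleGraph W} {r : W}

@[simp] theorem graftGraph_adj_inl_inl {a b : V} :
    (graftGraph G v H r).Adj (Sum.inl a) (Sum.inl b) ↔ G.Adj a b := Iff.rfl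

@[simp] theorem graftGraph_adj_inr_inr {p q : W} :
    (graftGraph G v H r).Adj (Sum.inr p) (Sum.inr q) ↔ H.Adj p q := Iff.rfl

@[simp] theorem graftGraph_adj_inl_inr {a : V} {q : W} :
    (graftGraph G v H r).Adj (Sum.inl a) (Sum.inr q) ↔ a = v ∧ q = r := Iff.rfl

@[simp] theorem graftGraph_adj_inr_inl {p : W} {b : V} :
    (graftGraph G v H r).Adj (Sum.inr p) (Sum.inl b) ↔ b = v ∧ p = r := Iff.rfl

/-- The map that collapses the second graph to the vertex `v`. -/
def collapseRight (v : V) : V ⊕ W → V := Sum.elim id fun _ => v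

/-- The map that collapses the first graph to the vertex `r`. -/
def collapseLeft (r : W) : V ⊕ W → W := Sum.elim (fun _ => r) id

theorem graftGraph_deleteEdges_inl (hH : H.Connected) (a b : V) (x y : V ⊕ W) :
    ((graftGraph G v H r).deleteEdges {s(Sum.inl a, Sum.inl b)}).Reachable x y ↔
      (G.deleteEdges {s(a, b)}).Reachable (collapseRight v x) (collapseRight v y) := by
  have hinr : ∀ p q : W, H.Reachable p q →
      ((graftGraph G v H r).deleteEdges {s(Sum.inl a, Sum.inl b)}).Reachable
        (Sum.inr p) (Sum.inr q) := fun p q hpq =>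
    reachable_map_of_adj (f := Sum.inr) (fun p q hpq => SimpleGraph.Adj.reachable
      (by simp [SimpleGraph.deleteEdges_adj, hpq])) hpq
  refine reachable_iff_of_retract (f := Sum.inl) ?_ ?_ ?_ x y
  · intro c d hcd
    refine SimpleGraph.Adj.reachable ?_
    simpa [SimpleGraph.deleteEdges_adj] using hcd
  · rintro (c | p) (d | q) hcd
    · refine SimpleGraph.Adj.reachable ?_
      simpa [SimpleGraph.deleteEdges_adj, collapseRight] using hcd
    · obtain ⟨rfl, rfl⟩ := (SimpleGraph.deleteEdges_adj.1 hcd).1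
      exact SimpleGraph.Reachable.rfl
    · obtain ⟨rfl, rfl⟩ := (SimpleGraph.deleteEdges_adj.1 hcd).1
      exact SimpleGraph.Reachable.rfl
    · exact SimpleGraph.Reachable.rfl
  · rintro (c | p)
    · exact SimpleGraph.Reachable.rfl
    · refine (hinr p r (hH.preconnected p r)).trans (SimpleGraph.Adj.reachable ?_)
      simp [SimpleGraph.deleteEdges_adj, collapseRight]

theorem graftGraph_deleteEdges_inr (hG : G.Connected) (p q : W) (x y : V ⊕ W) :
    ((graftGraph G v H r).deleteEdges {s(Sum.inr p, Sum.inr q)}).Reachable x y ↔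
      (H.deleteEdges {s(p, q)}).Reachable (collapseLeft r x) (collapseLeft r y) := by
  have hinl : ∀ a b : V, G.Reachable a b →
      ((graftGraph G v H r).deleteEdges {s(Sum.inr p, Sum.inr q)}).Reachable
        (Sum.inl a) (Sum.inl b) := fun a b hab =>
    reachable_map_of_adj (f := Sum.inl) (fun a b hab => SimpleGraph.Adj.reachable
      (by simp [SimpleGraph.deleteEdges_adj, hab])) hab
  refine reachable_iff_of_retract (f := Sum.inr) ?_ ?_ ?_ x y
  · intro c d hcd
    refine SimpleGraph.Adj.reachable ?_
    simpa [SimpleGraph.deleteEdges_adj] using hcd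
  · rintro (c | s) (d | t) hcd
    · exact SimpleGraph.Reachable.rfl
    · obtain ⟨rfl, rfl⟩ := (SimpleGraph.deleteEdges_adj.1 hcd).1
      exact SimpleGraph.Reachable.rfl
    · obtain ⟨rfl, rfl⟩ := (SimpleGraph.deleteEdges_adj.1 hcd).1
      exact SimpleGraph.Reachable.rfl
    · refine SimpleGraph.Adj.reachable ?_
      simpa [SimpleGraph.deleteEdges_adj, collapseLeft] using hcd
  · rintro (c | s)
    · refine (hinl c v (hG.preconnected c v)).trans (SimpleGraph.Adj.reachable ?_)
      simp [SimpleGraph.deleteEdges_adj, collapseLeft]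
    · exact SimpleGraph.Reachable.rfl

theorem graftGraph_deleteEdges_link (hG : G.Connected) (hH : H.Connected) (x y : V ⊕ W) :
    ((graftGraph G v H r).deleteEdges {s(Sum.inl v, Sum.inr r)}).Reachable x y ↔
      x.isLeft = y.isLeft := by
  constructor
  · intro hxy
    refine reachable_of_forall_adj (p := fun z => x.isLeft = z.isLeft) ?_ hxy rfl
    rintro (c | s) (d | t) hcd hx
    · exact hx
    · obtain ⟨h1, h2⟩ := SimpleGraph.deleteEdges_adj.1 hcd
      obtain ⟨rfl, rfl⟩ := h1
      simp at h2
    · obtain ⟨h1, h2⟩ := SimpleGraph.deleteEdges_adj.1 hcd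
      obtain ⟨rfl, rfl⟩ := h1
      simp at h2
    · exact hx
  · intro hxy
    rcases x with c | s <;> rcases y with d | t
    · exact reachable_map_of_adj (f := Sum.inl) (fun a b hab => SimpleGraph.Adj.reachable
        (by simp [SimpleGraph.deleteEdges_adj, hab])) (hG.preconnected c d)
    · simp at hxy
    · simp at hxy
    · exact reachable_map_of_adj (f := Sum.inr) (fun a b hab => SimpleGraph.Adj.reachable
        (by simp [SimpleGraph.deleteEdges_adj, hab])) (hH.preconnected s t)

/-- Every edge is a bridge: collapsing the opposite half reduces an edge of either tree to that
tree, and deleting the link separates the two halves. -/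
theorem graftGraph_isTree (hG : G.IsTree) (hH : H.IsTree) : (graftGraph G v H r).IsTree := by
  have hGc := hG.connected
  have hHc := hH.connected
  have hGb := SimpleGraph.isAcyclic_iff_forall_adj_isBridge.1 hG.isAcyclic
  have hHb := SimpleGraph.isAcyclic_iff_forall_adj_isBridge.1 hH.isAcyclic
  have hinl : ∀ a b : V, (graftGraph G v H r).Reachable (Sum.inl a) (Sum.inl b) := fun a b =>
    reachable_map_of_adj (f := Sum.inl) (fun a b hab => SimpleGraph.Adj.reachable hab)
      (hGc.preconnected a b)
  have hinr : ∀ p q : W, (graftGraph G v H r).Reachable (Sum.inr p) (Sum.inr q) := fun p q =>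
    reachable_map_of_adj (f := Sum.inr) (fun a b hab => SimpleGraph.Adj.reachable hab)
      (hHc.preconnected p q)
  have hlink : (graftGraph G v H r).Reachable (Sum.inl v) (Sum.inr r) :=
    SimpleGraph.Adj.reachable (by simp)
  have hall : ∀ x, (graftGraph G v H r).Reachable (Sum.inl v) x := by
    rintro (a | p)
    · exact hinl v a
    · exact hlink.trans (hinr r p)
  have hne : Nonempty (V ⊕ W) := ⟨Sum.inl v⟩
  refine ⟨⟨fun x y => (hall x).symm.trans (hall y)⟩, ?_⟩
  rw [SimpleGraph.isAcyclic_iff_forall_adj_isBridge]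
  rintro (a | p) (b | q) hab
  · rw [SimpleGraph.isBridge_iff, graftGraph_deleteEdges_inl hHc]
    exact SimpleGraph.isBridge_iff.1 (hGb hab)
  · obtain ⟨rfl, rfl⟩ := hab
    rw [SimpleGraph.isBridge_iff, graftGraph_deleteEdges_link hGc hHc]
    simp
  · obtain ⟨rfl, rfl⟩ := hab
    rw [SimpleGraph.isBridge_iff, Sym2.eq_swap, graftGraph_deleteEdges_link hGc hHc]
    simp
  · rw [SimpleGraph.isBridge_iff, graftGraph_deleteEdges_inr hGc]
    exact SimpleGraph.isBridge_iff.1 (hHb hab)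

/-- Away from the vertex `v` the grafted graph has the same neighbours as the original one. -/
def graftNeighborEquiv (G : SimpleGraph V) (v : V) (H : SimpleGraph W) (r : W) {a : V}
    (ha : a ≠ v) : G.neighborSet a ≃ (graftGraph G v H r).neighborSet (Sum.inl a) where
  toFun b := ⟨Sum.inl b.1, b.2⟩
  invFun x := match x with
    | ⟨Sum.inl b, hb⟩ => ⟨b, hb⟩
    | ⟨Sum.inr _, hq⟩ => absurd hq.1 ha
  left_inv _ := rfl
  right_inv x := match x with
    | ⟨Sum.inl _, _⟩ => rfl
    | ⟨Sum.inr _, hq⟩ => absurd hq.1 ha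

end GraftedGraphs

/-! ### Edge sides, branches and bags of a labelled tree. -/

section TreeSides

variable {E : Type u} (T : LabelledTree E) {v w : T.V}

theorem edgeSide_swap (hvw : T.graph.Adj v w) : T.edgeSide w v = (T.edgeSide v w)ᶜ := by
  have hb := SimpleGraph.isBridge_iff.1
    (SimpleGraph.isAcyclic_iff_forall_adj_isBridge.1 T.isTree.isAcyclic hvw)
  have hall : ∀ x, (T.graph.deleteEdges {s(v, w)}).Reachable v x ∨
      (T.graph.deleteEdges {s(v, w)}).Reachable w x := by
    intro x
    refine reachable_of_forall_adj (p := fun x => (T.graph.deleteEdges {s(v, w)}).Reachable v x ∨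
      (T.graph.deleteEdges {s(v, w)}).Reachable w x) ?_ (T.isTree.connected.preconnected v x)
      (Or.inl SimpleGraph.Reachable.rfl)
    intro a b hab ha
    by_cases he : s(a, b) = s(v, w)
    · rcases Sym2.eq_iff.1 he with ⟨-, rfl⟩ | ⟨-, rfl⟩
      · exact Or.inr SimpleGraph.Reachable.rfl
      · exact Or.inl SimpleGraph.Reachable.rfl
    · have hab' : (T.graph.deleteEdges {s(v, w)}).Adj a b :=
        SimpleGraph.deleteEdges_adj.2 ⟨hab, he⟩
      exact ha.imp (fun h => h.trans hab'.reachable) fun h => h.trans hab'.reachable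
  ext e
  simp only [LabelledTree.edgeSide, Set.mem_compl_iff, Set.mem_ofPred_eq, Sym2.eq_swap (a := w)]
  constructor
  · intro h1 h2
    exact hb (h1.trans h2.symm)
  · intro h1
    exact (hall _).resolve_right h1

theorem branch_eq_edgeSide (hvw : T.graph.Adj v w) : T.branch v w = T.edgeSide v w := by
  have hb := SimpleGraph.isBridge_iff.1
    (SimpleGraph.isAcyclic_iff_forall_adj_isBridge.1 T.isTree.isAcyclic hvw)
  ext e
  constructor
  · intro he
    refine reachable_map_of_adj (f := id) ?_ he
    intro a b hab
    rw [SimpleGraph.deleteIncidenceSet_adj] at hab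
    refine SimpleGraph.Adj.reachable (SimpleGraph.deleteEdges_adj.2 ⟨hab.1, ?_⟩)
    intro h
    rcases Sym2.eq_iff.1 h with ⟨h, -⟩ | ⟨-, h⟩
    · exact hab.2.1 h
    · exact hab.2.2 h
  · intro he
    refine (reachable_of_forall_adj (p := fun x => (T.graph.deleteEdges {s(v, w)}).Reachable w x ∧
      (T.graph.deleteIncidenceSet v).Reachable w x) ?_ he
      ⟨SimpleGraph.Reachable.rfl, SimpleGraph.Reachable.rfl⟩).2
    rintro a b hab ⟨h1, h2⟩
    have h3 := h1.trans hab.reachable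
    refine ⟨h3, h2.trans (SimpleGraph.Adj.reachable ?_)⟩
    rw [SimpleGraph.deleteIncidenceSet_adj]
    refine ⟨(SimpleGraph.deleteEdges_adj.1 hab).1, ?_, ?_⟩
    · rintro rfl
      exact hb h1.symm
    · rintro rfl
      exact hb h3.symm

theorem petals_eq (v : T.V) (i) : T.petals v i = T.edgeSide v (T.order v i) :=
  branch_eq_edgeSide T (T.order v i).2

/-- A path from any other vertex to `v` enters `v` through a neighbour, whose branch contains the
starting vertex. -/
theorem bag_compl (v : T.V) : (T.bag v)ᶜ = ⋃ w ∈ T.graph.neighborSet v, T.edgeSide v w := by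
  ext e
  simp only [Set.mem_compl_iff, Set.mem_iUnion, SimpleGraph.mem_neighborSet, LabelledTree.bag,
    Set.mem_ofPred_eq]
  constructor
  · intro he
    by_contra hcon
    push Not at hcon
    refine (reachable_of_forall_adj
      (p := fun x => x ≠ v ∧ (T.graph.deleteIncidenceSet v).Reachable x (T.label e)) ?_
      (T.isTree.connected.preconnected (T.label e) v) ⟨he, SimpleGraph.Reachable.rfl⟩).1 rfl
    rintro x y hxy ⟨hx, hxe⟩
    by_cases hy : y = v
    · subst hy
      refine absurd ?_ (hcon x hxy.symm)
      rw [← branch_eq_edgeSide T hxy.symm]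
      exact hxe
    · refine ⟨hy, (SimpleGraph.Adj.reachable ?_).trans hxe⟩
      rw [SimpleGraph.deleteIncidenceSet_adj]
      exact ⟨hxy.symm, hy, hx⟩
  · rintro ⟨w, hw, he⟩ rfl
    exact SimpleGraph.isBridge_iff.1
      (SimpleGraph.isAcyclic_iff_forall_adj_isBridge.1 T.isTree.isAcyclic hw)
      (SimpleGraph.Reachable.symm he)

end TreeSides

/-! ### Attaching a leaf or a flower vertex to a partial tree. -/

section GraftedTrees

variable {E : Type u}

/-- The labelled tree obtained from `T` by attaching the tree `H` at the vertex `v`, where `lab`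
assigns those elements that are moved to bags of the new vertices. -/
noncomputable def LabelledTree.graft (T : LabelledTree E) (v : T.V) {W : Type} [hW : Finite W]
    (H : SimpleGraph W) (hH : H.IsTree) (r : W) (kindW : W → VertexKind) (lab : E → Option W)
    (hlab : ∀ e w, lab e = some w → kindW w = VertexKind.bag)
    (ordW : ∀ w, Fin (Nat.card ((graftGraph T.graph v H r).neighborSet (Sum.inr w))) ≃
      (graftGraph T.graph v H r).neighborSet (Sum.inr w)) : LabelledTree E where
  V := T.V ⊕ W
  finite := by
    have := T.finite
    infer_instance
  graph := graftGraph T.graph v H r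
  isTree := graftGraph_isTree T.isTree hH
  kind := Sum.elim T.kind kindW
  label e := (lab e).elim (Sum.inl (T.label e)) Sum.inr
  kind_label e := by
    rcases he : lab e with _ | w
    · exact T.kind_label e
    · exact hlab e w he
  order
    | Sum.inl a => by
      classical
      -- The attachment vertex gains a neighbour and receives an arbitrary enumeration, which is
      -- harmless for a bag vertex. All other old vertices keep their order.
      exact if ha : a = v then
        have := T.finite
        (Finite.equivFin _).symm
      else
        (finCongr (Nat.card_congr (graftNeighborEquiv T.graph v H r ha).symm)).trans
          ((T.order a).trans (graftNeighborEquiv T.graph v H r ha))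
    | Sum.inr w => ordW w

/-- The number of petals at a vertex is a cardinality that equals the intended number only
propositionally; this transports statements about flowers along that equality. -/
theorem petals_property_iff {n m : ℕ} (hnm : n = m) {P : Fin n → Set E} {Q : Fin m → Set E}
    (h : ∀ i, P i = Q (Fin.cast hnm i)) (p : ∀ n, (Fin n → Set E) → Prop) : p n P ↔ p m Q := by
  subst hnm
  obtain rfl : P = Q := funext h
  rfl

variable {T : LabelledTree E} {v : T.V} {W : Type} [Finite W] {H : SimpleGraph W} {hH : H.IsTree}
  {r : W} {kindW : W → VertexKind} {lab : E → Option W}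
  {hlab : ∀ e w, lab e = some w → kindW w = VertexKind.bag}
  {ordW : ∀ w, Fin (Nat.card ((graftGraph T.graph v H r).neighborSet (Sum.inr w))) ≃
    (graftGraph T.graph v H r).neighborSet (Sum.inr w)}

/-- Only elements of the bag at `v` move, so collapsing the attached tree to `v` restores the old
labels and the old sides. -/
theorem graft_edgeSide_inl (hv : ∀ e w, lab e = some w → T.label e = v) (a b : T.V) :
    (T.graft v H hH r kindW lab hlab ordW).edgeSide (Sum.inl a) (Sum.inl b) = T.edgeSide a b := by
  ext e
  refine (graftGraph_deleteEdges_inl hH.connected a b _ _).trans ?_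
  have : collapseRight v ((T.graft v H hH r kindW lab hlab ordW).label e) = T.label e := by
    rcases he : lab e with _ | w
    · simp [LabelledTree.graft, he, collapseRight]
    · simp [LabelledTree.graft, he, collapseRight, hv e w he]
  rw [this]
  rfl

theorem graft_edgeSide_inr (p q : W) :
    (T.graft v H hH r kindW lab hlab ordW).edgeSide (Sum.inr p) (Sum.inr q) =
      {e | (H.deleteEdges {s(p, q)}).Reachable q ((lab e).getD r)} := by
  ext e
  refine (graftGraph_deleteEdges_inr T.isTree.connected p q _ _).trans ?_
  have : collapseLeft r ((T.graft v H hH r kindW lab hlab ordW).label e) = (lab e).getD r := by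
    rcases he : lab e with _ | w <;> simp [LabelledTree.graft, he, collapseLeft]
  rw [this]
  rfl

theorem graft_edgeSide_link :
    (T.graft v H hH r kindW lab hlab ordW).edgeSide (Sum.inr r) (Sum.inl v) =
      {e | lab e = none} := by
  ext e
  have h1 := graftGraph_deleteEdges_link (v := v) (r := r) T.isTree.connected hH.connected
    (Sum.inl v) ((T.graft v H hH r kindW lab hlab ordW).label e)
  rw [Sym2.eq_swap] at h1
  refine h1.trans ?_
  rcases he : lab e with _ | w <;> simp [LabelledTree.graft, he]

theorem graft_petals_inl (hv : ∀ e w, lab e = some w → T.label e = v) {a : T.V} (ha : a ≠ v) (i) :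
    (T.graft v H hH r kindW lab hlab ordW).petals (Sum.inl a) i =
      T.petals a (Fin.cast
        (Nat.card_congr (graftNeighborEquiv T.graph v H r ha).symm) i) := by
  have hord : ((T.graft v H hH r kindW lab hlab ordW).order (Sum.inl a) i).1 =
      Sum.inl (T.order a (Fin.cast
        (Nat.card_congr (graftNeighborEquiv T.graph v H r ha).symm) i)).1 := by
    simp only [LabelledTree.graft, dif_neg ha]
    rfl
  exact (petals_eq _ _ _).trans ((congrArg _ hord).trans
    ((graft_edgeSide_inl hv _ _).trans (petals_eq _ _ _).symm))

theorem graft_bag_inl (hv : ∀ e w, lab e = some w → T.label e = v) {a : T.V} (ha : a ≠ v) :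
    (T.graft v H hH r kindW lab hlab ordW).bag (Sum.inl a) = T.bag a := by
  ext e
  rcases he : lab e with _ | w
  · simp [LabelledTree.bag, LabelledTree.graft, he]
  · simp [LabelledTree.bag, LabelledTree.graft, he, hv e w he, ha.symm]

theorem graft_bag_self :
    (T.graft v H hH r kindW lab hlab ordW).bag (Sum.inl v) = T.bag v ∩ {e | lab e = none} := by
  ext e
  rcases he : lab e with _ | w <;> simp [LabelledTree.bag, LabelledTree.graft, he]

theorem graft_bag_inr (w : W) :
    (T.graft v H hH r kindW lab hlab ordW).bag (Sum.inr w) = {e | lab e = some w} := by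
  ext e
  rcases he : lab e with _ | w <;> simp [LabelledTree.bag, LabelledTree.graft, he]

variable [Finite E] {C : ConnectivitySystem E} {k : ℤ} {𝒯 : Set (Set E)}

theorem TreeDisplays.graft (hvb : T.kind v = VertexKind.bag)
    (hv : ∀ e w, lab e = some w → T.label e = v) {X : Set E} (hX : TreeDisplays C k 𝒯 T X) :
    TreeDisplays C k 𝒯 (T.graft v H hH r kindW lab hlab ordW) X := by
  refine ⟨hX.1, hX.2.imp ?_ ?_⟩
  · rintro ⟨a, b, hab, rfl⟩
    exact ⟨Sum.inl a, Sum.inl b, hab, (graft_edgeSide_inl hv a b).symm⟩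
  · rintro ⟨a, ha, hfl⟩
    have hav : a ≠ v := by
      rintro rfl
      exact ha hvb
    exact ⟨Sum.inl a, ha, (petals_property_iff _ (graft_petals_inl hv hav)
      fun n P => IsFlower C k 𝒯 P ∧ FlowerDisplays C k P X).2 hfl⟩

theorem edge_property_graft (p : VertexKind → VertexKind → Set E → Prop)
    (hp : ∀ a b S, p a b S → p b a Sᶜ) (hv : ∀ e w, lab e = some w → T.label e = v)
    (hT : ∀ a b, T.graph.Adj a b → p (T.kind a) (T.kind b) (T.edgeSide a b))
    (hlink : p (kindW r) (T.kind v) {e | lab e = none})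
    (hW : ∀ a b, H.Adj a b →
      p (kindW a) (kindW b) {e | (H.deleteEdges {s(a, b)}).Reachable b ((lab e).getD r)}) :
    ∀ a b, (T.graft v H hH r kindW lab hlab ordW).graph.Adj a b →
      p ((T.graft v H hH r kindW lab hlab ordW).kind a)
        ((T.graft v H hH r kindW lab hlab ordW).kind b)
        ((T.graft v H hH r kindW lab hlab ordW).edgeSide a b) := by
  rintro (a | a) (b | b) hab
  · rw [graft_edgeSide_inl hv]
    exact hT a b hab
  · have hswap := edgeSide_swap _ (SimpleGraph.Adj.symm hab)
    obtain ⟨rfl, rfl⟩ := hab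
    rw [hswap]
    refine hp _ _ _ ?_
    rw [graft_edgeSide_link]
    exact hlink
  · obtain ⟨rfl, rfl⟩ := hab
    rw [graft_edgeSide_link]
    exact hlink
  · rw [graft_edgeSide_inr]
    exact hW a b hab

theorem IsPartialTree.graft (h : IsRobustTangle C k 𝒯) [Nonempty E]
    (hT : IsPartialTree C k 𝒯 (nonSequentialSets C k 𝒯) T)
    (hvb : T.kind v = VertexKind.bag) (hv : ∀ e w, lab e = some w → T.label e = v)
    (hlink : NonSeq C k 𝒯 {e | lab e = none} ∨
      kindW r ≠ VertexKind.bag ∧ IsStrongSeparation C k 𝒯 {e | lab e = none})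
    (hedge : ∀ a b, H.Adj a b → (kindW a ≠ VertexKind.bag ∨ kindW b ≠ VertexKind.bag) ∧
      IsStrongSeparation C k 𝒯 {e | (H.deleteEdges {s(a, b)}).Reachable b ((lab e).getD r)})
    (hanemone : ∀ w, kindW w = VertexKind.anemone →
      ∃ n, ∃ hn : Nat.card ((graftGraph T.graph v H r).neighborSet (Sum.inr w)) = n,
      ∃ P : Fin n → Set E, (∀ i, (T.graft v H hH r kindW lab hlab ordW).petals (Sum.inr w) i =
        P (Fin.cast hn i)) ∧ IsAnemone C k 𝒯 P ∧
        3 ≤ flowerOrder C k 𝒯 (nonSequentialSets C k 𝒯) P ∧ ∀ i, ¬ IsLoose C k 𝒯 P i)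
    (hdaisy : ∀ w, kindW w = VertexKind.daisy →
      ∃ n, ∃ hn : Nat.card ((graftGraph T.graph v H r).neighborSet (Sum.inr w)) = n,
      ∃ P : Fin n → Set E, (∀ i, (T.graft v H hH r kindW lab hlab ordW).petals (Sum.inr w) i =
        P (Fin.cast hn i)) ∧ IsDaisy C k 𝒯 P ∧
        3 ≤ flowerOrder C k 𝒯 (nonSequentialSets C k 𝒯) P ∧ ∀ i, ¬ IsLoose C k 𝒯 P i)
    (hconf : ∀ X, NonSeq C k 𝒯 X →
      Conforms C k 𝒯 (T.graft v H hH r kindW lab hlab ordW) X) :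
    IsPartialTree C k 𝒯 (nonSequentialSets C k 𝒯) (T.graft v H hH r kindW lab hlab ordW) where
  strong_edge := edge_property_graft (fun _ _ S => IsStrongSeparation C k 𝒯 S)
    (fun _ _ _ hS => hS.compl) hv hT.strong_edge
    (hlink.elim (fun h1 => h1.isStrongSeparation) fun h1 => h1.2) fun a b hab => (hedge a b hab).2
  bag_edge := edge_property_graft (fun x y S => x = VertexKind.bag → y = VertexKind.bag →
      IsSSeparation C k (nonSequentialSets C k 𝒯) S)
    (fun _ _ _ hS hx hy => (isSSeparation_iff h).2 ((isSSeparation_iff h).1 (hS hy hx)).compl) hv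
    hT.bag_edge
    (fun h1 _ => hlink.elim (fun h2 => (isSSeparation_iff h).2 h2) fun h2 => absurd h1 h2.1)
    fun a b hab h1 h2 => (hedge a b hab).1.elim (fun h3 => absurd h1 h3) fun h3 => absurd h2 h3
  anemone_vertex := by
    rintro (a | w) ha
    · have hav : a ≠ v := by
        rintro rfl
        exact VertexKind.noConfusion (hvb.symm.trans ha)
      exact (petals_property_iff _ (graft_petals_inl hv hav) fun n P => IsAnemone C k 𝒯 P ∧
        3 ≤ flowerOrder C k 𝒯 (nonSequentialSets C k 𝒯) P ∧ ∀ i, ¬ IsLoose C k 𝒯 P i).2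
          (hT.anemone_vertex a ha)
    · obtain ⟨n, hn, P, hP, hprop⟩ := hanemone w ha
      exact (petals_property_iff hn hP fun n P => IsAnemone C k 𝒯 P ∧
        3 ≤ flowerOrder C k 𝒯 (nonSequentialSets C k 𝒯) P ∧ ∀ i, ¬ IsLoose C k 𝒯 P i).2 hprop
  daisy_vertex := by
    rintro (a | w) ha
    · have hav : a ≠ v := by
        rintro rfl
        exact VertexKind.noConfusion (hvb.symm.trans ha)
      exact (petals_property_iff _ (graft_petals_inl hv hav) fun n P => IsDaisy C k 𝒯 P ∧
        3 ≤ flowerOrder C k 𝒯 (nonSequentialSets C k 𝒯) P ∧ ∀ i, ¬ IsLoose C k 𝒯 P i).2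
          (hT.daisy_vertex a ha)
    · obtain ⟨n, hn, P, hP, hprop⟩ := hdaisy w ha
      exact (petals_property_iff hn hP fun n P => IsDaisy C k 𝒯 P ∧
        3 ≤ flowerOrder C k 𝒯 (nonSequentialSets C k 𝒯) P ∧ ∀ i, ¬ IsLoose C k 𝒯 P i).2 hprop
  conforms X hX := hconf X ((isSSeparation_iff h).1 hX)

/-- The bag at `v` is divided into a new leaf bag `X` and the remainder `T.bag v \ X`. The
hypothesis `hconf` is conformity stated for these two bags and the unchanged ones. -/
theorem exists_leaf_extension (h : IsRobustTangle C k 𝒯) [Nonempty E]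
    (hT : IsPartialTree C k 𝒯 (nonSequentialSets C k 𝒯) T) (hvb : T.kind v = VertexKind.bag)
    {X : Set E} (hX : NonSeq C k 𝒯 X) (hXv : X ⊆ T.bag v)
    (hconf : ∀ U, NonSeq C k 𝒯 U → (∃ Y, TreeDisplays C k 𝒯 T Y ∧ SepEquiv C k 𝒯 U Y) ∨
      SepEquiv C k 𝒯 U X ∨ ∃ Y, SepEquiv C k 𝒯 U Y ∧
        ((∃ a, T.kind a = VertexKind.bag ∧ a ≠ v ∧ Y ⊆ T.bag a) ∨ Y ⊆ X ∨ Y ⊆ T.bag v \ X)) :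
    ∃ T' : LabelledTree E, IsPartialTree C k 𝒯 (nonSequentialSets C k 𝒯) T' ∧
      (∀ Y, TreeDisplays C k 𝒯 T Y → TreeDisplays C k 𝒯 T' Y) ∧ TreeDisplays C k 𝒯 T' X := by
  classical
  let lab : E → Option Unit := fun e => if e ∈ X then some () else none
  have hv : ∀ e w, lab e = some w → T.label e = v := by
    intro e w he
    by_cases h1 : e ∈ X
    · exact hXv h1
    · simp [lab, h1] at he
  have hnone : {e | lab e = none} = Xᶜ := by
    ext e
    simp [lab]
  have hsome : {e | lab e = some ()} = X := by
    ext e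
    simp [lab]
  have := T.finite
  let T' := T.graft v (⊥ : SimpleGraph Unit) SimpleGraph.IsTree.of_subsingleton ()
    (fun _ => VertexKind.bag) lab (fun _ _ _ => rfl) fun w => (Finite.equivFin _).symm
  have hXd : TreeDisplays C k 𝒯 T' X := by
    refine ⟨hX.sep, Or.inl ⟨Sum.inl v, Sum.inr (), ⟨rfl, rfl⟩, ?_⟩⟩
    have hadj : T'.graph.Adj (Sum.inr ()) (Sum.inl v) := ⟨rfl, rfl⟩
    rw [edgeSide_swap T' hadj, graft_edgeSide_link, hnone, compl_compl]
  refine ⟨T', IsPartialTree.graft h hT hvb hv (Or.inl ?_) ?_ ?_ ?_ ?_,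
    fun Y hY => hY.graft hvb hv, hXd⟩
  · rw [hnone]
    exact hX.compl
  · intro a b hab
    exact absurd hab (by simp)
  · intro w hw
    exact VertexKind.noConfusion hw
  · intro w hw
    exact VertexKind.noConfusion hw
  · intro U hU
    rcases hconf U hU with ⟨Y, hY, hUY⟩ | hUX | ⟨Y, hUY, ⟨a, ha, hav, hYa⟩ | hY | hY⟩
    · exact Or.inl ⟨Y, hY.graft hvb hv, hUY⟩
    · exact Or.inl ⟨X, hXd, hUX⟩
    · exact Or.inr ⟨Y, hUY, Sum.inl a, ha, Or.inl (by rwa [graft_bag_inl hv hav])⟩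
    · exact Or.inr ⟨Y, hUY, Sum.inr (), rfl, Or.inl (by rwa [graft_bag_inr, hsome])⟩
    · exact Or.inr ⟨Y, hUY, Sum.inl v, hvb, Or.inl (by rwa [graft_bag_self, hnone])⟩

theorem star_deleteEdges_reachable_iff {J : Type} (j : J) (x : Option J) :
    ((SimpleGraph.starGraph (none : Option J)).deleteEdges {s(none, some j)}).Reachable
      (some j) x ↔ x = some j := by
  constructor
  · intro hx
    refine reachable_of_forall_adj (p := fun y => y = some j) ?_ hx rfl
    rintro a b hab rfl
    exfalso
    rw [SimpleGraph.deleteEdges_adj, SimpleGraph.starGraph_adj] at hab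
    obtain ⟨⟨-, h1 | rfl⟩, h2⟩ := hab
    · simp at h1
    · exact h2 (Sym2.eq_swap)
  · rintro rfl
    exact SimpleGraph.Reachable.rfl

theorem star_deleteEdges_reachable_none_iff {J : Type} (j : J) (x : Option J) :
    ((SimpleGraph.starGraph (none : Option J)).deleteEdges {s(some j, none)}).Reachable
      none x ↔ x ≠ some j := by
  constructor
  · intro hx
    rw [Sym2.eq_swap] at hx
    rintro rfl
    simpa using (star_deleteEdges_reachable_iff j none).1 hx.symm
  · intro hx
    rcases x with _ | i
    · exact SimpleGraph.Reachable.rfl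
    · refine SimpleGraph.Adj.reachable ?_
      rw [SimpleGraph.deleteEdges_adj, SimpleGraph.starGraph_adj]
      refine ⟨by simp, ?_⟩
      intro h1
      rcases Sym2.eq_iff.1 h1 with ⟨h1, -⟩ | ⟨-, h1⟩
      · simp at h1
      · exact hx h1

theorem IsFlower.flowerOrder_le (h : IsRobustTangle C k 𝒯) [Nonempty E] {n : ℕ}
    {P : Fin n → Set E} (hP : IsFlower C k 𝒯 P) :
    flowerOrder C k 𝒯 (nonSequentialSets C k 𝒯) P ≤ n := by
  have hle : FlowerLE C k 𝒯 (nonSequentialSets C k 𝒯) P P := fun X hX hXS =>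
    ⟨X, hX, hXS, ((isSSeparation_iff h).1 hXS).isStrongSeparation,
      ((isSSeparation_iff h).1 hXS).isStrongSeparation, rfl⟩
  exact Nat.sInf_le ⟨P, hP, hle, hle⟩

/-- The neighbours of the centre of a star that is attached at `v`, one for each member of
`Fin n`; the index `i₀` corresponds to `v`. -/
def starNeighbor {V : Type} (G : SimpleGraph V) (v : V) {n : ℕ} (i₀ : Fin n) (i : Fin n) :
    (graftGraph G v (SimpleGraph.starGraph (none : Option {i : Fin n // i ≠ i₀}))
      none).neighborSet (Sum.inr none) :=
  if hi : i = i₀ then ⟨Sum.inl v, rfl, rfl⟩ else ⟨Sum.inr (some ⟨i, hi⟩),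
    SimpleGraph.starGraph_adj.2 ⟨by simp, Or.inl rfl⟩⟩

theorem starNeighbor_bijective {V : Type} (G : SimpleGraph V) (v : V) {n : ℕ} (i₀ : Fin n) :
    Function.Bijective (starNeighbor G v i₀) := by
  constructor
  · intro i j hij
    replace hij := congrArg Subtype.val hij
    unfold starNeighbor at hij
    split_ifs at hij with h1 h2 h2
    · rw [h1, h2]
    · simpa using hij
  · rintro ⟨a | w, hw⟩
    · obtain ⟨rfl, -⟩ := hw
      exact ⟨i₀, by simp [starNeighbor]⟩
    · rcases w with _ | ⟨j, hj⟩
      · rw [SimpleGraph.mem_neighborSet, graftGraph_adj_inr_inr] at hw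
        exact (SimpleGraph.irrefl _ hw).elim
      · exact ⟨j, by simp [starNeighbor, hj]⟩

/-- A star is attached at `v`: its centre is the flower vertex and its leaves are the petals other
than `i₀`. The petal `i₀` contains everything outside the bag at `v`, so together with what stays in
that bag it is exactly the branch towards `v`. -/
theorem exists_flower_extension (h : IsRobustTangle C k 𝒯) [Nonempty E]
    (hT : IsPartialTree C k 𝒯 (nonSequentialSets C k 𝒯) T) (hvb : T.kind v = VertexKind.bag)
    {n : ℕ} {r : E → Fin n} {i₀ : Fin n}
    (hfl : IsAnemone C k 𝒯 (fun i => r ⁻¹' {i}) ∨ IsDaisy C k 𝒯 (fun i => r ⁻¹' {i}))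
    (hord : 3 ≤ flowerOrder C k 𝒯 (nonSequentialSets C k 𝒯) (fun i => r ⁻¹' {i}))
    (hloose : ∀ i, ¬ IsLoose C k 𝒯 (fun i => r ⁻¹' {i}) i)
    (hr : ∀ e, T.label e ≠ v → r e = i₀)
    (hconf : ∀ U, NonSeq C k 𝒯 U → (∃ Y, TreeDisplays C k 𝒯 T Y ∧ SepEquiv C k 𝒯 U Y) ∨
      (∃ Y, FlowerDisplays C k (fun i => r ⁻¹' {i}) Y ∧ SepEquiv C k 𝒯 U Y) ∨
      ∃ Y, SepEquiv C k 𝒯 U Y ∧ ((∃ a, T.kind a = VertexKind.bag ∧ a ≠ v ∧ Y ⊆ T.bag a) ∨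
        ∃ i, Y ⊆ T.bag v ∩ r ⁻¹' {i})) :
    ∃ T' : LabelledTree E, IsPartialTree C k 𝒯 (nonSequentialSets C k 𝒯) T' ∧
      (∀ Y, TreeDisplays C k 𝒯 T Y → TreeDisplays C k 𝒯 T' Y) ∧
      ∀ Y, FlowerDisplays C k (fun i => r ⁻¹' {i}) Y → TreeDisplays C k 𝒯 T' Y := by
  classical
  have hflower : IsFlower C k 𝒯 (fun i => r ⁻¹' {i}) := hfl.elim (fun h1 => h1.1) fun h1 => h1.1
  have hn : 3 ≤ n := hord.trans (hflower.flowerOrder_le h)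
  have hstrong : ∀ i, IsStrongSeparation C k 𝒯 (r ⁻¹' {i}) := by
    intro i
    have : Nontrivial (Fin n) := Fin.nontrivial_iff_two_le.2 (by omega)
    obtain ⟨j, hj⟩ := exists_ne i
    refine ⟨hflower.petal i, hflower.strong i, (hflower.strong j).mono ?_⟩
    rintro x rfl
    exact hj
  let lab : E → Option (Option {i : Fin n // i ≠ i₀}) :=
    fun e => if he : r e = i₀ then none else some (some ⟨r e, he⟩)
  have hnone : {e | lab e = none} = r ⁻¹' {i₀} := by
    ext e
    simp [lab]
  have hsome : ∀ j, {e | lab e = some (some j)} = r ⁻¹' {j.1} := by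
    rintro ⟨j, hj⟩
    ext e
    by_cases he : r e = i₀
    · simp [lab, he, hj.symm]
    · simp [lab, he]
  have hget : ∀ e j, (lab e).getD none = some j ↔ lab e = some (some j) := by
    intro e j
    rcases lab e with _ | x <;> simp
  have hv : ∀ e w, lab e = some w → T.label e = v := by
    intro e w he
    by_contra h1
    simp [lab, hr e h1] at he
  let kindW : Option {i : Fin n // i ≠ i₀} → VertexKind := fun w => w.elim
    (if IsAnemone C k 𝒯 (fun i => r ⁻¹' {i}) then VertexKind.anemone else VertexKind.daisy)
    fun _ => VertexKind.bag
  have hcentre : kindW none ≠ VertexKind.bag := by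
    simp only [kindW, Option.elim]
    split_ifs <;> exact VertexKind.noConfusion
  have hcard : Nat.card ((graftGraph T.graph v
      (SimpleGraph.starGraph (none : Option {i : Fin n // i ≠ i₀})) none).neighborSet
      (Sum.inr none)) = n := by
    rw [← Nat.card_congr (Equiv.ofBijective _ (starNeighbor_bijective T.graph v i₀)), Nat.card_fin]
  have := T.finite
  let T' := T.graft v (SimpleGraph.starGraph (none : Option {i : Fin n // i ≠ i₀}))
    (SimpleGraph.isTree_starGraph none) none kindW lab
    (by
      rintro e (_ | j) he
      · by_cases h1 : r e = i₀ <;> simp [lab, h1] at he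
      · rfl)
    (fun w => match w with
      | none => (finCongr hcard).trans
          (Equiv.ofBijective _ (starNeighbor_bijective T.graph v i₀))
      | some _ => (Finite.equivFin _).symm)
  have hside : ∀ j, T'.edgeSide (Sum.inr none) (Sum.inr (some j)) = r ⁻¹' {j.1} := by
    intro j
    refine (graft_edgeSide_inr none (some j)).trans ?_
    simp only [star_deleteEdges_reachable_iff, hget, hsome]
  have hpetals : ∀ i, T'.petals (Sum.inr none) i = r ⁻¹' {Fin.cast hcard i} := by
    intro i
    refine (petals_eq T' _ i).trans ?_
    have h1 : (T'.order (Sum.inr none) i).1 =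
        (starNeighbor T.graph v i₀ (Fin.cast hcard i)).1 := rfl
    refine (congrArg (T'.edgeSide (Sum.inr none)) h1).trans ?_
    unfold starNeighbor
    split_ifs with h2
    · refine graft_edgeSide_link.trans ?_
      rw [hnone, h2]
    · exact hside _
  have hdisp : ∀ Y, FlowerDisplays C k (fun i => r ⁻¹' {i}) Y → TreeDisplays C k 𝒯 T' Y :=
    fun Y hY => ⟨hY.1, Or.inr ⟨Sum.inr none, hcentre, (petals_property_iff
      (P := T'.petals (Sum.inr none)) (Q := fun i => r ⁻¹' {i}) hcard hpetals
      fun n P => IsFlower C k 𝒯 P ∧ FlowerDisplays C k P Y).2 ⟨hflower, hY⟩⟩⟩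
  refine ⟨T', IsPartialTree.graft h hT hvb hv (Or.inr ⟨hcentre, ?_⟩) ?_ ?_ ?_ ?_,
    fun Y hY => hY.graft hvb hv, hdisp⟩
  · rw [hnone]
    exact hstrong i₀
  · rintro (_ | a) (_ | b) hab
    · exact absurd hab (SimpleGraph.irrefl _)
    · refine ⟨Or.inl hcentre, ?_⟩
      simp only [star_deleteEdges_reachable_iff, hget, hsome]
      exact hstrong _
    · refine ⟨Or.inr hcentre, ?_⟩
      have h1 : {e | lab e ≠ some (some a)} = (r ⁻¹' {a.1})ᶜ := by
        rw [← hsome]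
        rfl
      simp only [star_deleteEdges_reachable_none_iff, ne_eq, hget]
      exact h1 ▸ (hstrong _).compl
    · simp [SimpleGraph.starGraph_adj] at hab
  · rintro (_ | a) hw
    · refine ⟨n, hcard, _, hpetals, ?_, hord, hloose⟩
      by_contra h1
      simp [kindW, h1] at hw
    · exact VertexKind.noConfusion hw
  · rintro (_ | a) hw
    · refine ⟨n, hcard, _, hpetals, ?_, hord, hloose⟩
      refine hfl.resolve_left fun h1 => ?_
      simp [kindW, h1] at hw
    · exact VertexKind.noConfusion hw
  · intro U hU
    rcases hconf U hU with ⟨Y, hY, hUY⟩ | ⟨Y, hY, hUY⟩ | ⟨Y, hUY, ⟨a, ha, hav, hYa⟩ | ⟨i, hY⟩⟩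
    · exact Or.inl ⟨Y, hY.graft hvb hv, hUY⟩
    · exact Or.inl ⟨Y, hdisp Y hY, hUY⟩
    · exact Or.inr ⟨Y, hUY, Sum.inl a, ha, Or.inl (by rwa [graft_bag_inl hv hav])⟩
    · refine Or.inr ⟨Y, hUY, ?_⟩
      by_cases hi : i = i₀
      · subst hi
        exact ⟨Sum.inl v, hvb, Or.inl (by rwa [graft_bag_self, hnone])⟩
      · refine ⟨Sum.inr (some ⟨i, hi⟩), rfl, Or.inl ?_⟩
        rw [graft_bag_inr, hsome]
        exact hY.trans Set.inter_subset_right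

end GraftedTrees

/-! ### Extending a tree that misses a separation. -/

section MaximalTrees

variable {E : Type u} [Finite E] {C : ConnectivitySystem E} {k : ℤ} {𝒯 : Set (Set E)}
  {T : LabelledTree E} {v : T.V}

theorem finRotate_ne_self {n : ℕ} (hn : 2 ≤ n) (i : Fin n) : finRotate n i ≠ i := by
  obtain ⟨m, rfl⟩ : ∃ m, n = m + 2 := ⟨n - 2, by omega⟩
  rw [finRotate_apply]
  simp

/-- Otherwise the next petal, a different one because the order is at least three, would be loose.
-/
theorem fcl_petal_ne_univ (h : IsRobustTangle C k 𝒯) [Nonempty E] {n : ℕ} {P : Fin n → Set E}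
    (hP : IsFlower C k 𝒯 P) (hord : 3 ≤ flowerOrder C k 𝒯 (nonSequentialSets C k 𝒯) P)
    (hloose : ∀ i, ¬ IsLoose C k 𝒯 P i) (i : Fin n) : fcl C k 𝒯 (P i) ≠ Set.univ := by
  intro hi
  have hn := hord.trans (hP.flowerOrder_le h)
  refine hloose (finRotate n i)
    ⟨i, (finRotate_ne_self (by omega) i).symm, Or.inr (Or.inr rfl), ?_⟩
  rw [hi]
  exact Set.subset_univ _

/-- If `w` is a bag vertex, the edge is non-sequential. If `w` is a flower vertex, the complement of
the side is one of its petals, and these are not loose. -/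
theorem IsPartialTree.fcl_compl_edgeSide_ne (h : IsRobustTangle C k 𝒯) [Nonempty E]
    (hT : IsPartialTree C k 𝒯 (nonSequentialSets C k 𝒯) T) (hvb : T.kind v = VertexKind.bag)
    {w : T.V} (hvw : T.graph.Adj v w) : fcl C k 𝒯 (T.edgeSide v w)ᶜ ≠ Set.univ := by
  have hpetal : ∃ i, T.petals w i = (T.edgeSide v w)ᶜ := by
    refine ⟨(T.order w).symm ⟨v, hvw.symm⟩, ?_⟩
    rw [petals_eq, Equiv.apply_symm_apply, edgeSide_swap T hvw]
  obtain ⟨i, hi⟩ := hpetal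
  rcases hw : T.kind w
  · exact ((isSSeparation_iff h).1 (hT.bag_edge v w hvw hvb hw)).fcl_compl_ne
  · obtain ⟨h1, h2, h3⟩ := hT.daisy_vertex w hw
    rw [← hi]
    exact fcl_petal_ne_univ h h1.1 h2 h3 i
  · obtain ⟨h1, h2, h3⟩ := hT.anemone_vertex w hw
    rw [← hi]
    exact fcl_petal_ne_univ h h1.1 h2 h3 i

/-- Otherwise the complement of some edge side at `v`, which contains the bag, would have that side
in its closure and hence all of `E`. -/
theorem IsPartialTree.not_bag_compl_subset_fcl (h : IsRobustTangle C k 𝒯) [Nonempty E]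
    (hT : IsPartialTree C k 𝒯 (nonSequentialSets C k 𝒯) T) (hvb : T.kind v = VertexKind.bag)
    (hne : (T.bag v)ᶜ.Nonempty) {U : Set E} (hU : U ⊆ T.bag v) :
    ¬ (T.bag v)ᶜ ⊆ fcl C k 𝒯 U := by
  intro hsub
  have hbag := bag_compl T v
  obtain ⟨x, hx⟩ := hne
  rw [hbag] at hx
  simp only [Set.mem_iUnion] at hx
  obtain ⟨w, hw, -⟩ := hx
  have hS : T.edgeSide v w ⊆ (T.bag v)ᶜ := by
    rw [hbag]
    exact Set.subset_biUnion_of_mem hw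
  refine hT.fcl_compl_edgeSide_ne h hvb hw (Set.eq_univ_of_forall fun y => ?_)
  by_cases hy : y ∈ T.edgeSide v w
  · exact fcl_mono (hU.trans (Set.subset_compl_comm.1 hS)) (hsub (hS hy))
  · exact subset_fcl _ hy

theorem NonSeq.sepEquiv_compl_fcl (h : IsRobustTangle C k 𝒯) [Nonempty E] {U : Set E}
    (hU : NonSeq C k 𝒯 U) : SepEquiv C k 𝒯 U (fcl C k 𝒯 U)ᶜ := by
  have h1 := (hU.compl.sepEquiv_core h).compl_left
  rwa [compl_compl] at h1

theorem LiesIn.subset {U P : Set E} (hL : LiesIn C k 𝒯 U P) :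
    (fcl C k 𝒯 Uᶜ)ᶜ ⊆ P ∨ (fcl C k 𝒯 U)ᶜ ⊆ P := by
  obtain ⟨W, -, h1, h2, h3⟩ := hL
  refine h3.imp (fun h4 => (compl_fcl_compl_subset h2).trans h4) fun h4 => ?_
  rw [← h1]
  exact (Set.compl_subset_compl.2 (subset_fcl W)).trans h4

/-- The non-sequential separations that conform with `T` through the bag at `v` only. -/
def undisplayed (C : ConnectivitySystem E) (k : ℤ) (𝒯 : Set (Set E)) (T : LabelledTree E)
    (v : T.V) : Set (Set E) :=
  {U | NonSeq C k 𝒯 U ∧ U ⊆ T.bag v ∧ ¬ ∃ Y, TreeDisplays C k 𝒯 T Y ∧ SepEquiv C k 𝒯 U Y}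

theorem IsPartialTree.displayed_or (h : IsRobustTangle C k 𝒯) [Nonempty E]
    (hT : IsPartialTree C k 𝒯 (nonSequentialSets C k 𝒯) T) (v : T.V) {U : Set E}
    (hU : NonSeq C k 𝒯 U) : (∃ Y, TreeDisplays C k 𝒯 T Y ∧ SepEquiv C k 𝒯 U Y) ∨
      (∃ Y, SepEquiv C k 𝒯 U Y ∧ ∃ a, T.kind a = VertexKind.bag ∧ a ≠ v ∧ Y ⊆ T.bag a) ∨
      ∃ Y ∈ undisplayed C k 𝒯 T v, SepEquiv C k 𝒯 U Y := by
  by_cases hd : ∃ Y, TreeDisplays C k 𝒯 T Y ∧ SepEquiv C k 𝒯 U Y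
  · exact Or.inl hd
  · have key : ∃ Y, SepEquiv C k 𝒯 U Y ∧ ∃ a, T.kind a = VertexKind.bag ∧ Y ⊆ T.bag a := by
      rcases hT.conforms U ((isSSeparation_iff h).2 hU) with h1 | ⟨Y, hUY, a, ha, hY | hY⟩
      · exact absurd h1 hd
      · exact ⟨Y, hUY, a, ha, hY⟩
      · exact ⟨Yᶜ, hUY.compl_right, a, ha, hY⟩
    obtain ⟨Y, hUY, a, ha, hY⟩ := key
    by_cases hav : a = v
    · subst hav
      exact Or.inr (Or.inr ⟨Y, ⟨hUY.nonSeq h hU, hY,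
        fun ⟨Z, hZ, hYZ⟩ => hd ⟨Z, hZ, hUY.trans hYZ⟩⟩, hUY⟩)
    · exact Or.inr (Or.inl ⟨Y, hUY, a, ha, hav, hY⟩)

/-- A partial tree with an undisplayed non-sequential separation can be extended. -/
theorem IsPartialTree.exists_extension (h : IsRobustTangle C k 𝒯) [Nonempty E]
    (hT : IsPartialTree C k 𝒯 (nonSequentialSets C k 𝒯) T) (hvb : T.kind v = VertexKind.bag)
    (hne : (undisplayed C k 𝒯 T v).Nonempty) :
    ∃ T' : LabelledTree E, IsPartialTree C k 𝒯 (nonSequentialSets C k 𝒯) T' ∧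
      (∀ Y, TreeDisplays C k 𝒯 T Y → TreeDisplays C k 𝒯 T' Y) ∧
      ∃ X ∈ undisplayed C k 𝒯 T v, ∃ Y, TreeDisplays C k 𝒯 T' Y ∧ SepEquiv C k 𝒯 X Y := by
  -- Maximality of `fcl X` is used only through `heq`: an undisplayed set whose closure contains `X`
  -- has the same closure as `X`.
  obtain ⟨X, hX, hmax⟩ := Set.Finite.exists_maximalFor (fcl C k 𝒯) (undisplayed C k 𝒯 T v)
    (Set.toFinite _) hne
  have hX' : X ∈ undisplayed C k 𝒯 T v := hX
  obtain ⟨hXN, hXv, hXd⟩ := hX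
  have heq : ∀ {Y}, Y ∈ undisplayed C k 𝒯 T v → X ⊆ fcl C k 𝒯 Y → fcl C k 𝒯 Y = fcl C k 𝒯 X :=
    fun hY hXY => (hmax hY (fcl_subset_fcl hXY)).antisymm (fcl_subset_fcl hXY)
  have hrefl : SepEquiv C k 𝒯 X X := ⟨hXN.isStrongSeparation, hXN.isStrongSeparation, rfl⟩
  have hcore : ∀ {Y}, Y ∈ undisplayed C k 𝒯 T v → (fcl C k 𝒯 Yᶜ)ᶜ ⊆ T.bag v :=
    fun hY => (compl_fcl_compl_subset rfl).trans hY.2.1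
  by_cases hcross : ∀ U ∈ undisplayed C k 𝒯 T v, LiesIn C k 𝒯 U X ∨ LiesIn C k 𝒯 U Xᶜ
  · obtain ⟨T', h1, h2, h3⟩ := exists_leaf_extension h hT hvb hXN hXv (by
      intro U hU
      rcases hT.displayed_or h v hU with h1 | ⟨Y, hUY, ha⟩ | ⟨Y, hY, hUY⟩
      · exact Or.inl h1
      · exact Or.inr (Or.inr ⟨Y, hUY, Or.inl ha⟩)
      · have hc := hUY.trans (hY.1.sepEquiv_core h)
        have hc' := hUY.trans (hY.1.sepEquiv_compl_fcl h)
        rcases hcross Y hY with hL | hL <;> rcases hL.subset with hs | hs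
        · exact Or.inr (Or.inr ⟨_, hc, Or.inr (Or.inl hs)⟩)
        · exact Or.inr (Or.inr ⟨_, hc', Or.inr (Or.inl hs)⟩)
        · exact Or.inr (Or.inr ⟨_, hc, Or.inr (Or.inr fun x hx => ⟨hcore hY hx, hs hx⟩)⟩)
        -- This side need not fit into the bag that remains at `v`. But `(fcl Y)ᶜ ⊆ Xᶜ` means `X ⊆
        -- fcl Y`, so `Y` is equivalent to `X`.
        · refine Or.inr (Or.inl (hUY.trans (hY.1.sepEquiv h hXN.sep hXN.big.isStrong ?_)))
          exact (heq hY (Set.compl_subset_compl.1 hs)).symm)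
    exact ⟨T', h1, h2, X, hX', X, h3, hrefl⟩
  · push Not at hcross
    obtain ⟨U₀, hU₀, hL1, hL2⟩ := hcross
    -- The outside of the bag plays the role of `F`: kept within one petal, it lets `v` stand for
    -- that petal in the extended tree.
    have hresp : ∀ {U}, U ∈ undisplayed C k 𝒯 T v → Respects (T.bag v)ᶜ U :=
      fun hU x hx y _ hxU => absurd (hU.2.1 hxU) hx
    obtain ⟨n, r, hfl, hord, hloose, -, hrF, ⟨X', hX'd, hX'N, hX'e⟩, hV⟩ :=
      exists_flower_of_crossing h hXN (hresp hX') hU₀.1 (hresp hU₀) hL1 hL2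
    have hflower : IsFlower C k 𝒯 (fun i => r ⁻¹' {i}) := hfl.elim (fun h1 => h1.1) fun h1 => h1.1
    obtain ⟨i₀, hi₀⟩ : ∃ i₀, ∀ e, T.label e ≠ v → r e = i₀ := by
      by_cases hF : (T.bag v)ᶜ.Nonempty
      · obtain ⟨x, hx⟩ := hF
        exact ⟨r x, fun e he => hrF e he x hx⟩
      · exact ⟨⟨0, hflower.pos⟩, fun e he => absurd ⟨e, he⟩ hF⟩
    have hXX' : SepEquiv C k 𝒯 X X' := hXN.sepEquiv h hX'N.sep hX'N.big.isStrong hX'e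
    obtain ⟨T', h1, h2, h3⟩ := exists_flower_extension h hT hvb hfl hord hloose hi₀ (by
      intro U hU
      rcases hT.displayed_or h v hU with h1 | ⟨Y, hUY, ha⟩ | ⟨Y, hY, hUY⟩
      · exact Or.inl h1
      · exact Or.inr (Or.inr ⟨Y, hUY, Or.inl ha⟩)
      · rcases hV Y hY.1 (hresp hY) with ⟨W, hW, hWN, hWe⟩ | ⟨i, hL⟩
        · exact Or.inr (Or.inl ⟨W, hW, hUY.trans (hY.1.sepEquiv h hWN.sep hWN.big.isStrong hWe)⟩)
        · rcases hL.subset with hs | hs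
          · exact Or.inr (Or.inr ⟨_, hUY.trans (hY.1.sepEquiv_core h),
              Or.inr ⟨i, Set.subset_inter (hcore hY) hs⟩⟩)
          by_cases hF : (T.bag v)ᶜ.Nonempty
          · have hFY := hT.not_bag_compl_subset_fcl h hvb hF hY.2.1
            have hFX := hT.not_bag_compl_subset_fcl h hvb hF hXv
            -- Some element outside the bag is not in `fcl Y`, hence lies in the petal `i`, which
            -- must be the distinguished one.
            have hii : i = i₀ := by
              by_contra hne'
              refine hFY fun x hx => ?_
              by_contra hxY
              exact hne' ((hs hxY : r x = i).symm.trans (hi₀ x hx))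
            subst hii
            obtain ⟨I, hI⟩ := hX'd.2
            have hI' : X' = r ⁻¹' I := hI.trans (iUnion_preimage_singleton I)
            -- If `X'` contained the distinguished petal, the closure of `X` would contain
            -- everything outside the bag. So `X'` avoids that petal and lies in `fcl Y`, and
            -- maximality of `fcl X` makes `Y` equivalent to `X'`.
            have hiI : i ∉ I := by
              intro hiI
              refine hFX fun x hx => ?_
              rw [← hX'e]
              refine subset_fcl _ ?_
              rw [hI', Set.mem_preimage, hi₀ x hx]
              exact hiI
            have hX'Y : X' ⊆ fcl C k 𝒯 Y := by
              intro x hx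
              by_contra hxY
              have hxi : r x = i := hs hxY
              rw [hI', Set.mem_preimage, hxi] at hx
              exact hiI hx
            have hXY : X ⊆ fcl C k 𝒯 Y :=
              ((subset_fcl X).trans_eq hX'e.symm).trans (fcl_subset_fcl hX'Y)
            refine Or.inr (Or.inl ⟨X', hX'd, hUY.trans
              (hY.1.sepEquiv h hX'N.sep hX'N.big.isStrong ?_)⟩)
            rw [hX'e, heq hY hXY]
          · rw [Set.not_nonempty_iff_eq_empty, Set.compl_empty_iff] at hF
            exact Or.inr (Or.inr ⟨_, hUY.trans (hY.1.sepEquiv_compl_fcl h), Or.inr ⟨i, by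
              rw [hF, Set.univ_inter]
              exact hs⟩⟩))
    exact ⟨T', h1, h2, X, hX', X', h3 X' hX'd, hXX'⟩

theorem nonempty_of_isNonSequentialSeparation (h : IsRobustTangle C k 𝒯) {X : Set E}
    (hX : IsNonSequentialSeparation C k 𝒯 X) : Nonempty E := by
  by_contra hE
  rw [not_nonempty_iff] at hE
  refine hX.2.1 ⟨hX.1, ?_, Subsingleton.elim _ _⟩
  rintro ⟨A, hA, -⟩
  exact h.not_cover (fun _ => A) (fun _ => hA) (Subsingleton.elim _ _)

end MaximalTrees

end TangleTree

theorem corollary6p2 {E : Type*} [Finite E] (C : TangleTree.ConnectivitySystem E)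
    (k : ℤ) (hk : 0 < k) (𝒯 : Set (Set E)) (h𝒯 : TangleTree.IsRobustTangle C k 𝒯)
    (T : TangleTree.LabelledTree E) (hT : TangleTree.IsMaximalPartialTree C k 𝒯 T)
    (X : Set E) (hX : TangleTree.IsNonSequentialSeparation C k 𝒯 X) :
    ∃ Y : Set E, TangleTree.TreeDisplays C k 𝒯 T Y ∧ TangleTree.SepEquiv C k 𝒯 X Y := by
  have hE := TangleTree.nonempty_of_isNonSequentialSeparation h𝒯 hX
  obtain ⟨e⟩ := id hE
  have hXN := (TangleTree.isNonSequentialSeparation_iff h𝒯).1 hX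
  obtain ⟨hTp, hmax⟩ := hT
  by_contra hd
  have key : ∃ v, T.kind v = TangleTree.VertexKind.bag ∧
      (TangleTree.undisplayed C k 𝒯 T v).Nonempty := by
    -- The vertex `T.label e` is just some bag vertex at which to apply the trichotomy; in either
    -- undisplayed case a suitable bag is found.
    rcases hTp.displayed_or h𝒯 (T.label e) hXN with h1 | ⟨Y, hXY, a, ha, -, hYa⟩ | ⟨Y, hY, -⟩
    · exact absurd h1 hd
    · exact ⟨a, ha, Y, hXY.nonSeq h𝒯 hXN, hYa, fun ⟨Z, hZ, hYZ⟩ => hd ⟨Z, hZ, hXY.trans hYZ⟩⟩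
    · exact ⟨T.label e, T.kind_label e, Y, hY⟩
  obtain ⟨v, hv, hne⟩ := key
  obtain ⟨T', hT', hsub, U, hU, Y, hY, hUY⟩ := hTp.exists_extension h𝒯 hv hne
  have hle : TangleTree.TreeLE C k 𝒯 (TangleTree.nonSequentialSets C k 𝒯) T T' :=
    fun Z hZ hZS => ⟨Z, hsub Z hZ, hZS, ((TangleTree.isSSeparation_iff h𝒯).1 hZS).isStrongSeparation,
      ((TangleTree.isSSeparation_iff h𝒯).1 hZS).isStrongSeparation, rfl⟩
  obtain ⟨Z, hZ, -, hYZ⟩ := hmax T' hT' hle Y hY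
    ((TangleTree.isSSeparation_iff h𝒯).2 (hUY.nonSeq h𝒯 hU.1))
  exact hU.2.2 ⟨Z, hZ, hUY.trans hYZ⟩
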